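/- **Definitions.** Products of subspaces denote linear spans of products. For a C*-algebra $A_0$ let $K(A_0)$ be its Pedersen ideal (the smallest dense two-sided ideal), $M(A_0)$ its multiplier algebra, and $\Gamma(K(A_0))$ the unital $*$-algebra of all pairs $(S,T)$ of linear maps $K(A_0)\to K(A_0)$ with $x\,S(y)=T(x)\,y$ for all $x,y$, where $(S,T)(U,V)=(SU,VT)$ and $(S,T)^*=(T^*,S^*)$ with $S^*(x)=S(x^*)^*$; $a\in A_0$ is identified with the multiplier $(y\mapsto ay,\ y\mapsto ya)$. The projective topology of $\Gamma(K(A_0))$ is given by the seminorms $(S,T)\mapsto\sup\{\|S(y)\|: y\in \overline{A_0a},\ \|y\|\le 1\}$, where $a\in K(A_0)$ is positive. A unital topological $*$-algebra $A$ is a *locally compact $\sigma$-C\*-algebra with support algebra $A_{00}\subseteq A$* if it is the inverse limit of a sequence of C*-algebras $A_n$ (with the projective topology) such that all maps $\pi_n:A\to A_n$ are surjective, and, with $\|a\|_\infty=\sup_n\|\pi_n(a)\|\in[0,\infty]$, there are $e_n\in A$ $(n\in\mathbb N)$ with $0\le e_n\le 1$ such that: $\|ae_n\|_\infty<\infty$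 and $\|e_na\|_\infty<\infty$ for all $a\in A$; $e_me_n=e_n$ for $n<m$; $A_{00}=\bigcup_n Ae_n^2A$; in the weakest topology on $A$ making all maps $a\mapsto xa$ and $a\mapsto ax$ $(x\in A_{00})$ continuous for $\|\cdot\|_\infty$, $e_n\to 1$ and $A$ is complete; and $$\sup\{\|e_nba\|_\infty: b\in A,\ \|e_nb\|_\infty\le 1\}\ \ge\ \|\pi_n(a)\|\ \ge\ \|e_na\|_\infty\qquad(a\in A,\ n\in\mathbb N).$$ *Source category.* Objects are the $\sigma$-unital C*-algebras. Morphisms $A_0\to B_0$ are the $*$-homomorphisms $\varphi_0:A_0\to M(B_0)$ that are nondegenerate ($\varphi_0(A_0)B_0$ is dense in $B_0$) and strictly nondegenerate ($\varphi_0(K(A_0))B_0\supseteq K(B_0)$). They are composed by means of their unique extensions to unital $*$-homomorphisms $M(A_0)\to M(B_0)$; the identity of $A_0$ is the inclusion $A_0\to M(A_0)$. *Target category.* Objects are the locally compact $\sigma$-C*-algebras $A$ with support algebra $A_{00}$. Morphisms $A\to B$ are the continuous unital $*$-homomorphisms $\varphi:A\to B$ that are strictly nondegenerate ($\varphi(A_{00})B\supseteq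 B_{00}$). **Theorem.** For every $\sigma$-unital C*-algebra $A_0$, the algebra $\Gamma(K(A_0))$ with its projective topology is a locally compact $\sigma$-C*-algebra with support algebra $K(A_0)$. There is a covariant functor from the source category to the target category which sends each $A_0$ to $\Gamma(K(A_0))$ and each $\varphi_0:A_0\to M(B_0)$ to a morphism $\varphi:\Gamma(K(A_0))\to\Gamma(K(B_0))$ extending it: for $a\in A_0$, $\varphi(a)$ is the pair $(y\mapsto\varphi_0(a)y,\ y\mapsto y\varphi_0(a))$ on $K(B_0)$. In particular, for every $\sigma$-compact locally compact Hausdorff space $X$, $C_0(X)$ is $\sigma$-unital, $C(X)$ with the compact-open topology is a locally compact $\sigma$-C*-algebra whose support algebra is the algebra of compactly supported functions, and the functor sends $C_0(X)$ to $C(X)$: there is an isomorphism $\Gamma(K(C_0(X)))\cong C(X)$ in the target category under which $f\in C(X)$ corresponds to multiplication by $f$ on $K(C_0(X))$. -/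

import Mathlib

open Filter Topology CategoryTheory
open scoped ENNReal MultiplierAlgebra ZeroAtInfty

universe u

noncomputable section

/-! ### The Pedersen ideal of a C*-algebra -/

section Pedersen

variable (A : Type u) [NonUnitalCStarAlgebra A]

/-- A linear subspace which is a (not necessarily closed) two-sided ideal and is norm dense. -/
def IsDenseIdeal (I : Submodule ℂ A) : Prop :=
  (∀ a x : A, x ∈ I → a * x ∈ I ∧ x * a ∈ I) ∧ Dense (I : Set A)

/-- The Pedersen ideal `K(A)`: the minimum dense two-sided ideal, i.e. the intersection of
all dense two-sided ideals (its density is `pedersenIdeal_dense` below). -/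
def pedersenIdeal : Submodule ℂ A := sInf {I | IsDenseIdeal A I}

variable {A}

theorem pedersenIdeal_le {I : Submodule ℂ A} (hI : IsDenseIdeal A I) : pedersenIdeal A ≤ I :=
  sInf_le hI

theorem mul_mem_pedersenIdeal (a : A) {x : A} (hx : x ∈ pedersenIdeal A) :
    a * x ∈ pedersenIdeal A := by
  simp only [pedersenIdeal, Submodule.mem_sInf] at hx ⊢
  exact fun I hI => (hI.1 a x (hx I hI)).1

theorem pedersenIdeal_mul_mem (a : A) {x : A} (hx : x ∈ pedersenIdeal A) :
    x * a ∈ pedersenIdeal A := by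
  simp only [pedersenIdeal, Submodule.mem_sInf] at hx ⊢
  exact fun I hI => (hI.1 a x (hx I hI)).2

theorem star_mem_pedersenIdeal {x : A} (hx : x ∈ pedersenIdeal A) :
    star x ∈ pedersenIdeal A := by
  simp only [pedersenIdeal, Submodule.mem_sInf] at hx ⊢
  intro I hI
  let J : Submodule ℂ A :=
    { carrier := {y | star y ∈ I}
      add_mem' := fun {a b} ha hb => by
        simp only [Set.mem_ofPred_eq, star_add] at *
        exact I.add_mem ha hb
      zero_mem' := by simp
      smul_mem' := fun c y hy => by
        simp only [Set.mem_ofPred_eq, star_smul] at *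
        exact I.smul_mem _ hy }
  have hJ : IsDenseIdeal A J := by
    refine ⟨fun a y hy => ⟨?_, ?_⟩, ?_⟩
    · change star (a * y) ∈ I
      rw [star_mul]
      exact (hI.1 (star a) (star y) hy).2
    · change star (y * a) ∈ I
      rw [star_mul]
      exact (hI.1 (star a) (star y) hy).1
    · have h1 : (J : Set A) = star ⁻¹' (I : Set A) := rfl
      rw [h1]
      exact hI.2.preimage (Homeomorph.mk (Equiv.mk star star star_star star_star)
        continuous_star continuous_star).isOpenMap
  exact hx J hJ

/-- If `x * y = x` then `x` lies in every dense ideal. -/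
theorem mem_of_mul_eq {I : Submodule ℂ A} (hI : IsDenseIdeal A I) {x y : A} (hxy : x * y = x) :
    x ∈ I := by
  obtain ⟨z, hz, hzy⟩ := hI.2.exists_dist_lt y one_pos
  set w := y - z with hw
  have hw1 : ‖w‖ < 1 := by rwa [hw, ← dist_eq_norm]
  have hw1' : ‖(w : Unitization ℂ A)‖ < 1 := by rwa [Unitization.norm_inr]
  -- the geometric series of `w` is computed in the unitization
  set g : Unitization ℂ A := ∑' n : ℕ, (w : Unitization ℂ A) ^ n with hg
  have hgeo : (1 - (w : Unitization ℂ A)) * g = 1 := by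
    rw [hg]; exact mul_neg_geom_series _ hw1'
  have hxz : x * z = x - x * w := by rw [hw, mul_sub, hxy]; abel
  have hxz' : ((x * z : A) : Unitization ℂ A) = (x : Unitization ℂ A) * (1 - w) := by
    rw [hxz]
    simp [mul_sub]
  have key : ((x * z : A) : Unitization ℂ A) * g = x := by
    rw [hxz', mul_assoc, hgeo, mul_one]
  have hg2 : g = (algebraMap ℂ (Unitization ℂ A) g.fst) + (g.snd : Unitization ℂ A) := by
    rw [Unitization.algebraMap_eq_inl]
    exact (Unitization.inl_fst_add_inr_snd_eq g).symm
  have key2 : ((x * z : A) : Unitization ℂ A) * g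
      = ((g.fst • (x * z) + x * z * g.snd : A) : Unitization ℂ A) := by
    conv_lhs => rw [hg2]
    rw [mul_add, ← Algebra.commutes, ← Algebra.smul_def]
    simp
  have hx : x = g.fst • (x * z) + x * z * g.snd :=
    (Unitization.inr_injective (key2.symm.trans key)).symm
  have hxzI : x * z ∈ I := (hI.1 x z hz).1
  rw [hx]
  exact I.add_mem (I.smul_mem _ hxzI) (hI.1 _ _ hxzI).2

/-- Soft thresholding of a selfadjoint element gives an element of the Pedersen ideal. -/
theorem exists_pedersen_near_of_selfAdjoint {x : A} (hx : IsSelfAdjoint x) {ε : ℝ} (hε : 0 < ε) :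
    ∃ y ∈ pedersenIdeal A, ‖x - y‖ ≤ ε := by
  set c : ℝ → ℝ := fun t => max (-ε) (min t ε) with hc
  set f : ℝ → ℝ := fun t => t - c t with hf
  set g : ℝ → ℝ := fun t => min (|t| / ε) 1 with hg
  have hcc : Continuous c := by fun_prop
  have hfc : Continuous f := by fun_prop
  have hgc : Continuous g := by fun_prop
  have hc0 : c 0 = 0 := by simp [hc, hε.le]
  have hf0 : f 0 = 0 := by simp [hf, hc0]
  have hg0 : g 0 = 0 := by simp [hg]
  have hfg : ∀ t, f t * g t = f t := by
    intro t
    by_cases ht : |t| ≤ ε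
    · have h := abs_le.1 ht
      have : f t = 0 := by simp [hf, hc, min_eq_left h.2, max_eq_right h.1]
      simp [this]
    · have : g t = 1 := by
        simp only [hg]
        exact min_eq_right ((one_le_div hε).2 (not_le.1 ht).le)
      simp [this]
  refine ⟨cfcₙ f x, ?_, ?_⟩
  · simp only [pedersenIdeal, Submodule.mem_sInf]
    intro I hI
    refine mem_of_mul_eq hI (y := cfcₙ g x) ?_
    rw [← cfcₙ_mul f g x hfc.continuousOn hf0 hgc.continuousOn hg0]
    simp only [hfg]
  · have h1 : x - cfcₙ f x = cfcₙ c x := by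
      conv_lhs => enter [1]; rw [← cfcₙ_id ℝ x]
      rw [← cfcₙ_sub (fun t => id t) f x (by fun_prop) rfl hfc.continuousOn hf0]
      simp [hf]
    rw [h1]
    refine norm_cfcₙ_le (fun t _ => ?_)
    rw [Real.norm_eq_abs, abs_le]
    simp only [hc]
    exact ⟨le_max_left _ _, max_le (by linarith) (min_le_right _ _)⟩

theorem pedersenIdeal_dense : Dense (pedersenIdeal A : Set A) := by
  intro a
  rw [Metric.mem_closure_iff]
  intro ε hε
  obtain ⟨y, hy, hy'⟩ := exists_pedersen_near_of_selfAdjoint (realPart a).2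
    (show (0 : ℝ) < ε / 3 by positivity)
  obtain ⟨z, hz, hz'⟩ := exists_pedersen_near_of_selfAdjoint (imaginaryPart a).2
    (show (0 : ℝ) < ε / 3 by positivity)
  refine ⟨y + Complex.I • z, Submodule.add_mem _ hy (Submodule.smul_mem _ _ hz), ?_⟩
  rw [dist_eq_norm]
  have h : a - (y + Complex.I • z)
      = ((realPart a : A) - y) + Complex.I • ((imaginaryPart a : A) - z) := by
    conv_lhs => rw [← realPart_add_I_smul_imaginaryPart a]
    rw [smul_sub]; abel
  rw [h]
  calc _ ≤ ‖(realPart a : A) - y‖ + ‖Complex.I • ((imaginaryPart a : A) - z)‖ := norm_add_le _ _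
    _ ≤ ε / 3 + ε / 3 := by
      refine add_le_add hy' ?_
      rw [norm_smul, Complex.norm_I, one_mul]
      exact hz'
    _ < ε := by linarith

theorem isDenseIdeal_pedersenIdeal : IsDenseIdeal A (pedersenIdeal A) :=
  ⟨fun a _ hx => ⟨mul_mem_pedersenIdeal a hx, pedersenIdeal_mul_mem a hx⟩, pedersenIdeal_dense⟩

end Pedersen

/-! ### Multipliers of the Pedersen ideal -/

section Multipliers

variable (A : Type u) [NonUnitalCStarAlgebra A]

/-- Pairs `(S, T)` of linear maps `K(A) → K(A)` with `x * S y = T x * y` for all `x, y ∈ K(A)`,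
with product `(S, T) (U, V) = (S U, V T)`: the second component is composed in the opposite
order. -/
def multiplierSubalgebra :
    Subalgebra ℂ (Module.End ℂ (pedersenIdeal A) × (Module.End ℂ (pedersenIdeal A))ᵐᵒᵖ) where
  carrier := {m | ∀ x y : pedersenIdeal A, (x : A) * (m.1 y : A) = (m.2.unop x : A) * (y : A)}
  mul_mem' := fun {m n} hm hn x y => by
    have h1 := hm x (n.1 y)
    have h2 := hn (m.2.unop x) y
    simpa using h1.trans h2
  add_mem' := fun {m n} hm hn x y => by
    have h1 := hm x y
    have h2 := hn x y
    simp [mul_add, add_mul, h1, h2]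
  algebraMap_mem' := fun c x y => by
    simp [Algebra.algebraMap_eq_smul_one, mul_smul_comm, smul_mul_assoc]

/-- `Γ(K(A))`, the algebra of (possibly unbounded) multipliers of the Pedersen ideal of `A`. -/
def PedersenMultiplier : Type u := multiplierSubalgebra A

instance : Ring (PedersenMultiplier A) := inferInstanceAs (Ring (multiplierSubalgebra A))

instance : Algebra ℂ (PedersenMultiplier A) :=
  inferInstanceAs (Algebra ℂ (multiplierSubalgebra A))

variable {A}

namespace PedersenMultiplier

/-- The left multiplier `S` of `(S, T)`. -/
def left (m : PedersenMultiplier A) : pedersenIdeal A →ₗ[ℂ] pedersenIdeal A := m.1.1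

/-- The right multiplier `T` of `(S, T)`. -/
def right (m : PedersenMultiplier A) : pedersenIdeal A →ₗ[ℂ] pedersenIdeal A := m.1.2.unop

theorem central (m : PedersenMultiplier A) (x y : pedersenIdeal A) :
    (x : A) * (m.left y : A) = (m.right x : A) * (y : A) := m.2 x y

/-- Build a multiplier from a pair `(S, T)`. -/
def mk' (S T : pedersenIdeal A →ₗ[ℂ] pedersenIdeal A)
    (h : ∀ x y : pedersenIdeal A, (x : A) * (S y : A) = (T x : A) * (y : A)) :
    PedersenMultiplier A := ⟨(S, MulOpposite.op T), h⟩

@[ext]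
theorem ext {m n : PedersenMultiplier A} (h1 : ∀ x, m.left x = n.left x)
    (h2 : ∀ x, m.right x = n.right x) : m = n :=
  Subtype.ext (Prod.ext (LinearMap.ext h1) (MulOpposite.unop_injective (LinearMap.ext h2)))

@[simp] theorem left_mk' (S T : pedersenIdeal A →ₗ[ℂ] pedersenIdeal A) (h) :
    (mk' S T h).left = S := rfl

@[simp] theorem right_mk' (S T : pedersenIdeal A →ₗ[ℂ] pedersenIdeal A) (h) :
    (mk' S T h).right = T := rfl

@[simp] theorem left_add (m n : PedersenMultiplier A) (x : pedersenIdeal A) :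
    (m + n).left x = m.left x + n.left x := rfl

@[simp] theorem right_add (m n : PedersenMultiplier A) (x : pedersenIdeal A) :
    (m + n).right x = m.right x + n.right x := rfl

@[simp] theorem left_mul (m n : PedersenMultiplier A) (x : pedersenIdeal A) :
    (m * n).left x = m.left (n.left x) := rfl

@[simp] theorem right_mul (m n : PedersenMultiplier A) (x : pedersenIdeal A) :
    (m * n).right x = n.right (m.right x) := rfl

@[simp] theorem left_smul (c : ℂ) (m : PedersenMultiplier A) (x : pedersenIdeal A) :
    (c • m).left x = c • m.left x := rfl

@[simp] theorem right_smul (c : ℂ) (m : PedersenMultiplier A) (x : pedersenIdeal A) :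
    (c • m).right x = c • m.right x := rfl

/-- For a linear map `S` on `K(A)`, the linear map `x ↦ S(x*)*`. -/
def conj (S : pedersenIdeal A →ₗ[ℂ] pedersenIdeal A) :
    pedersenIdeal A →ₗ[ℂ] pedersenIdeal A where
  toFun x := ⟨star (S ⟨star (x : A), star_mem_pedersenIdeal x.2⟩ : A),
    star_mem_pedersenIdeal (S _).2⟩
  map_add' x y := by
    apply Subtype.ext
    have h : (⟨star ((x + y : pedersenIdeal A) : A), star_mem_pedersenIdeal (x + y).2⟩ :
        pedersenIdeal A) = ⟨star (x : A), star_mem_pedersenIdeal x.2⟩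
          + ⟨star (y : A), star_mem_pedersenIdeal y.2⟩ := Subtype.ext (by simp)
    simp only [h, map_add]
    simp
  map_smul' c x := by
    apply Subtype.ext
    have h : (⟨star ((c • x : pedersenIdeal A) : A), star_mem_pedersenIdeal (c • x).2⟩ :
        pedersenIdeal A) = star c • ⟨star (x : A), star_mem_pedersenIdeal x.2⟩ :=
      Subtype.ext (by simp)
    simp only [h, map_smul]
    simp

@[simp] theorem coe_conj (S : pedersenIdeal A →ₗ[ℂ] pedersenIdeal A) (x : pedersenIdeal A) :
    (conj S x : A) = star (S ⟨star (x : A), star_mem_pedersenIdeal x.2⟩ : A) := rfl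

/-- The involution `(S, T)* = (T*, S*)`, where `S*(x) = S(x*)*`. -/
instance : Star (PedersenMultiplier A) where
  star m := mk' (conj m.right) (conj m.left) (fun x y => by
    have h := m.central ⟨star (y : A), star_mem_pedersenIdeal y.2⟩
      ⟨star (x : A), star_mem_pedersenIdeal x.2⟩
    have h' := congrArg star h
    simp only [star_mul, star_star] at h'
    simpa using h'.symm)

@[simp] theorem left_star (m : PedersenMultiplier A) : (star m).left = conj m.right := rfl

@[simp] theorem right_star (m : PedersenMultiplier A) : (star m).right = conj m.left := rfl

instance : StarRing (PedersenMultiplier A) where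
  star_involutive m := by
    ext x <;> simp
  star_mul m n := by
    ext x <;> simp
  star_add m n := by
    ext x <;> simp

instance : StarModule ℂ (PedersenMultiplier A) where
  star_smul c m := by
    ext x <;> simp

variable (A) in
/-- The embedding `a ↦ (S_a, T_a)` of `A` in `Γ(K(A))`, where `S_a y = a * y`, `T_a y = y * a`. -/
def ofElem (a : A) : PedersenMultiplier A :=
  mk'
    { toFun := fun y => ⟨a * y, mul_mem_pedersenIdeal a y.2⟩
      map_add' := fun x y => Subtype.ext (by simp [mul_add])
      map_smul' := fun c y => Subtype.ext (by simp [mul_smul_comm]) }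
    { toFun := fun y => ⟨y * a, pedersenIdeal_mul_mem a y.2⟩
      map_add' := fun x y => Subtype.ext (by simp [add_mul])
      map_smul' := fun c y => Subtype.ext (by simp [smul_mul_assoc]) }
    (fun x y => (mul_assoc _ _ _).symm)

variable (A) in
/-- The image of `K(A)` in `Γ(K(A))`. -/
def support : Set (PedersenMultiplier A) := ofElem A '' (pedersenIdeal A : Set A)

/-- The unit ball of the closed left ideal `L_a = cl(A a)` (inside `K(A)`). -/
def leftIdealBall (a : A) : Set (pedersenIdeal A) :=
  {y | (y : A) ∈ closure (Set.range fun x : A => x * a) ∧ ‖(y : A)‖ ≤ 1}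

/-- The projective topology of `Γ(K(A))`: it is defined by the seminorms
`(S, T) ↦ ‖S|L_a‖` (the norm of the image of `(S, T)` in `M_a ≅ M(I_a)`), where `a` runs over
the positive elements of `K(A)`. In other words, it is the topology of uniform convergence of
`S` on the unit balls of the `L_a`. -/
instance : TopologicalSpace (PedersenMultiplier A) :=
  TopologicalSpace.induced
    (fun m => UniformOnFun.ofFun
      {B : Set (pedersenIdeal A) | ∃ b : A, star b * b ∈ pedersenIdeal A ∧
        B = leftIdealBall (star b * b)}
      (fun y => (m.left y : A)))
    inferInstance

end PedersenMultiplier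

end Multipliers

/-! ### Nondegenerate morphisms into multiplier algebras -/

section Nondegenerate

variable {A B C : Type u} [NonUnitalCStarAlgebra A] [NonUnitalCStarAlgebra B]
  [NonUnitalCStarAlgebra C]

/-- `φ : A → M(B)` is nondegenerate if the linear span of `φ(A)B` is dense in `B`. -/
def IsNondegenerate (φ : A →⋆ₙₐ[ℂ] 𝓜(ℂ, B)) : Prop :=
  Dense (Submodule.span ℂ {y : B | ∃ (a : A) (b : B), y = (φ a).fst b} : Set B)

/-- `φ(K(A))B ⊇ K(B)`, where `φ(K(A))B` denotes the linear span of the products. -/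
def IsStrict (φ : A →⋆ₙₐ[ℂ] 𝓜(ℂ, B)) : Prop :=
  pedersenIdeal B ≤
    Submodule.span ℂ {y : B | ∃ a ∈ pedersenIdeal A, ∃ b : B, y = (φ a).fst b}

theorem continuous_mor (φ : A →⋆ₙₐ[ℂ] 𝓜(ℂ, B)) : Continuous φ :=
  AddMonoidHomClass.continuous_of_bound φ 1 fun a => by
    rw [one_mul]; exact NonUnitalStarAlgHom.norm_apply_le φ a

theorem multiplier_ext {s t : 𝓜(ℂ, B)} (h : ∀ b, s.fst b = t.fst b) : s = t := by
  have h0 : ‖(s - t).fst‖ = 0 := by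
    rw [norm_eq_zero]
    ext b
    simp [h b]
  rw [DoubleCentralizer.norm_fst, norm_eq_zero] at h0
  exact sub_eq_zero.1 h0

theorem IsNondegenerate.eq_zero {φ : A →⋆ₙₐ[ℂ] 𝓜(ℂ, B)} (hφ : IsNondegenerate φ) {s : 𝓜(ℂ, B)}
    (h : ∀ a, φ a * s = 0) : s = 0 := by
  refine multiplier_ext fun b => ?_
  set y := s.fst b with hy
  have h1 : ∀ a, (φ a).fst y = 0 := fun a => by
    have := congrArg (fun t : 𝓜(ℂ, B) => t.fst b) (h a)
    simpa using this
  have h2 : ∀ z : B, star z * y = 0 := by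
    have hcl : IsClosed {z : B | star z * y = 0} :=
      isClosed_eq (by fun_prop) continuous_const
    intro z
    refine hcl.closure_subset_iff.2 ?_ (hφ z)
    intro z hz
    induction hz using Submodule.span_induction with
    | mem x hx =>
      obtain ⟨a, b', rfl⟩ := hx
      have e1 : star ((φ a).fst b') = (φ (star a)).snd (star b') := by
        rw [map_star φ, DoubleCentralizer.star_snd, star_star]
      change star ((φ a).fst b') * y = 0
      rw [e1, DoubleCentralizer.central, h1, mul_zero]
    | zero => simp
    | add x z _ _ hx hz =>
      change star (x + z) * y = 0
      rw [star_add, add_mul]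
      exact (congrArg₂ (· + ·) hx hz).trans (add_zero 0)
    | smul c x _ hx =>
      change star (c • x) * y = 0
      rw [star_smul, smul_mul_assoc]
      exact (congrArg _ hx).trans (smul_zero _)
  have h3 := h2 y
  rw [CStarRing.star_mul_self_eq_zero_iff] at h3
  simpa using h3

theorem IsNondegenerate.eq_of {φ : A →⋆ₙₐ[ℂ] 𝓜(ℂ, B)} (hφ : IsNondegenerate φ) {s t : 𝓜(ℂ, B)}
    (h : ∀ a, φ a * s = φ a * t) : s = t :=
  sub_eq_zero.1 (hφ.eq_zero fun a => by rw [mul_sub, h a, sub_self])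

theorem exists_tendsto_of_dense {ι : Type*} {l : Filter ι} [l.NeBot] (T : ι → B →L[ℂ] B) (M : ℝ)
    (hM : ∀ᶠ i in l, ‖T i‖ ≤ M) (S : Set B) (hS : Dense (Submodule.span ℂ S : Set B))
    (hT : ∀ b ∈ S, ∃ z, Tendsto (fun i => T i b) l (𝓝 z)) :
    ∃ T' : B →L[ℂ] B, ∀ b, Tendsto (fun i => T i b) l (𝓝 (T' b)) := by
  have hspan : ∀ b ∈ Submodule.span ℂ S, ∃ z, Tendsto (fun i => T i b) l (𝓝 z) := by
    intro b hb
    induction hb using Submodule.span_induction with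
    | mem x hx => exact hT x hx
    | zero => exact ⟨0, by simp⟩
    | add x y _ _ hx hy =>
      obtain ⟨z, hz⟩ := hx
      obtain ⟨w, hw⟩ := hy
      exact ⟨z + w, by simpa using hz.add hw⟩
    | smul c x _ hx =>
      obtain ⟨z, hz⟩ := hx
      exact ⟨c • z, by simpa using hz.const_smul c⟩
  have hM0 : 0 ≤ M := by
    obtain ⟨i, hi⟩ := hM.exists
    exact (norm_nonneg _).trans hi
  have hall : ∀ b, ∃ z, Tendsto (fun i => T i b) l (𝓝 z) := by
    intro b
    refine CompleteSpace.complete (f := map (fun i => T i b) l) ?_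
    rw [Metric.cauchy_iff]
    refine ⟨inferInstance, fun ε hε => ?_⟩
    obtain ⟨b', hb', hd⟩ := Metric.mem_closure_iff.1 (hS b) (ε / (4 * (M + 1))) (by positivity)
    rw [dist_eq_norm] at hd
    obtain ⟨z, hz⟩ := hspan b' hb'
    have hz' := Metric.tendsto_nhds.1 hz (ε / 4) (by positivity)
    have hev : ∀ᶠ i in l, dist (T i b) z < ε / 2 := by
      filter_upwards [hM, hz'] with i hi hi'
      have e1 : ‖T i (b - b')‖ ≤ ε / 4 := by
        calc ‖T i (b - b')‖ ≤ ‖T i‖ * ‖b - b'‖ := (T i).le_opNorm _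
          _ ≤ (M + 1) * (ε / (4 * (M + 1))) :=
            mul_le_mul (by linarith) hd.le (norm_nonneg _) (by positivity)
          _ = ε / 4 := by field_simp
      calc dist (T i b) z ≤ dist (T i b) (T i b') + dist (T i b') z := dist_triangle _ _ _
        _ < ε / 4 + ε / 4 := by
          refine add_lt_add_of_le_of_lt ?_ hi'
          rwa [dist_eq_norm, ← map_sub]
        _ = ε / 2 := by ring
    refine ⟨_, image_mem_map hev, ?_⟩
    rintro _ ⟨i, hi, rfl⟩ _ ⟨j, hj, rfl⟩
    calc dist (T i b) (T j b) ≤ dist (T i b) z + dist (T j b) z := dist_triangle_right _ _ _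
      _ < ε := by
        have h1 : dist (T i b) z < ε / 2 := hi
        have h2 : dist (T j b) z < ε / 2 := hj
        linarith
  choose g hg using hall
  refine ⟨LinearMap.mkContinuous
    { toFun := g
      map_add' := fun x y => tendsto_nhds_unique (hg (x + y))
        (by simpa using (hg x).add (hg y))
      map_smul' := fun c x => tendsto_nhds_unique (hg (c • x))
        (by simpa using (hg x).const_smul c) } M (fun b => ?_), hg⟩
  refine le_of_tendsto (hg b).norm ?_
  filter_upwards [hM] with i hi
  exact ((T i).le_opNorm b).trans (mul_le_mul_of_nonneg_right hi (norm_nonneg _))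

theorem exists_approximateUnit (A : Type u) [NonUnitalCStarAlgebra A] :
    ∃ l : Filter A, l.NeBot ∧ (∀ᶠ u in l, ‖u‖ ≤ 1) ∧ (∀ a, Tendsto (fun u => u * a) l (𝓝 a)) ∧
      (∀ a, Tendsto (fun u => a * u) l (𝓝 a)) := by
  let _ := CStarAlgebra.spectralOrder A
  have _ := CStarAlgebra.spectralOrderedRing A
  have h := CStarAlgebra.increasingApproximateUnit A
  exact ⟨_, h.neBot, h.eventually_norm, h.tendsto_mul_right, h.tendsto_mul_left⟩

theorem multiplier_mul_coe (m : 𝓜(ℂ, A)) (a : A) :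
    m * (a : 𝓜(ℂ, A)) = ((m.fst a : A) : 𝓜(ℂ, A)) := by
  refine multiplier_ext fun b => ?_
  have h : ∀ x y : A, m.fst (x * y) = m.fst x * y := by
    intro x y
    have h1 : ∀ c : A, c * (m.fst (x * y) - m.fst x * y) = 0 := fun c => by
      rw [mul_sub, ← mul_assoc, ← m.central, ← m.central, mul_assoc, sub_self]
    have h2 := h1 (star (m.fst (x * y) - m.fst x * y))
    rw [CStarRing.star_mul_self_eq_zero_iff] at h2
    exact sub_eq_zero.1 h2
  simp [h]

theorem coe_mul_multiplier (m : 𝓜(ℂ, A)) (a : A) :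
    (a : 𝓜(ℂ, A)) * m = ((m.snd a : A) : 𝓜(ℂ, A)) := by
  refine multiplier_ext fun b => ?_
  simp [m.central]

theorem IsNondegenerate.exists_extension {φ : A →⋆ₙₐ[ℂ] 𝓜(ℂ, B)} (hφ : IsNondegenerate φ)
    (m : 𝓜(ℂ, A)) : ∃ t : 𝓜(ℂ, B), ∀ a, φ a * t = φ (m.snd a) := by
  obtain ⟨l, hl, hb, hL, hR⟩ := exists_approximateUnit A
  have hcont : Continuous φ := continuous_mor φ
  have hbd : ∀ᶠ u in l, ‖φ (m.fst u)‖ ≤ ‖m‖ := by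
    filter_upwards [hb] with u hu
    calc ‖φ (m.fst u)‖ ≤ ‖m.fst u‖ := NonUnitalStarAlgHom.norm_apply_le φ _
      _ ≤ ‖m.fst‖ * ‖u‖ := m.fst.le_opNorm u
      _ ≤ ‖m.fst‖ * 1 := by gcongr
      _ = ‖m‖ := by rw [mul_one, DoubleCentralizer.norm_fst]
  have hfmul : ∀ x y : A, m.fst (x * y) = m.fst x * y := fun x y => by
    have h := congrArg (fun t : 𝓜(ℂ, A) => t.fst y) (multiplier_mul_coe m x)
    simpa using h
  obtain ⟨L, hLt⟩ := exists_tendsto_of_dense (l := l) (fun u => (φ (m.fst u)).fst) ‖m‖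
    (by filter_upwards [hbd] with u hu; rwa [DoubleCentralizer.norm_fst]) _ hφ (by
      rintro _ ⟨a, b, rfl⟩
      refine ⟨(φ (m.fst a)).fst b, ?_⟩
      have h1 : Tendsto (fun u => φ (m.fst (u * a))) l (𝓝 (φ (m.fst a))) :=
        (hcont.tendsto _).comp ((m.fst.continuous.tendsto _).comp (hL a))
      have h2 : Tendsto (fun u => ‖φ (m.fst (u * a)) - φ (m.fst a)‖ * ‖b‖) l (𝓝 0) := by
        simpa using (tendsto_iff_norm_sub_tendsto_zero.1 h1).mul_const ‖b‖
      refine tendsto_iff_norm_sub_tendsto_zero.2 (squeeze_zero (fun _ => norm_nonneg _) ?_ h2)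
      intro u
      have e : (φ (m.fst u)).fst ((φ a).fst b) = (φ (m.fst (u * a))).fst b := by
        rw [hfmul, map_mul]; simp
      rw [e, ← DoubleCentralizer.norm_fst (φ (m.fst (u * a)) - φ (m.fst a))]
      simpa using (φ (m.fst (u * a)) - φ (m.fst a)).fst.le_opNorm b)
  have hdense' : Dense (Submodule.span ℂ {y : B | ∃ (a : A) (b : B), y = (φ a).snd b} : Set B) := by
    have hmap : ∀ y ∈ Submodule.span ℂ {y : B | ∃ (a : A) (b : B), y = (φ a).fst b},
        star y ∈ Submodule.span ℂ {y : B | ∃ (a : A) (b : B), y = (φ a).snd b} := by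
      intro y hy
      induction hy using Submodule.span_induction with
      | mem x hx =>
        obtain ⟨a, b', rfl⟩ := hx
        refine Submodule.subset_span ⟨star a, star b', ?_⟩
        rw [map_star φ, DoubleCentralizer.star_snd, star_star]
      | zero => simp
      | add x z _ _ hx hz => rw [star_add]; exact Submodule.add_mem _ hx hz
      | smul c x _ hx => rw [star_smul]; exact Submodule.smul_mem _ _ hx
    intro y
    have h1 := image_closure_subset_closure_image (continuous_star (R := B))
      (Set.mem_image_of_mem _ (hφ (star y)))
    rw [star_star] at h1
    refine closure_mono ?_ h1
    rintro _ ⟨z, hz, rfl⟩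
    exact hmap z hz
  obtain ⟨R, hRt⟩ := exists_tendsto_of_dense (l := l) (fun u => (φ (m.fst u)).snd) ‖m‖
    (by filter_upwards [hbd] with u hu; rwa [DoubleCentralizer.norm_snd]) _ hdense' (by
      rintro _ ⟨a, b, rfl⟩
      refine ⟨(φ (m.snd a)).snd b, ?_⟩
      have h1 : Tendsto (fun u => φ (m.snd a * u)) l (𝓝 (φ (m.snd a))) :=
        (hcont.tendsto _).comp (hR (m.snd a))
      have h2 : Tendsto (fun u => ‖φ (m.snd a * u) - φ (m.snd a)‖ * ‖b‖) l (𝓝 0) := by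
        simpa using (tendsto_iff_norm_sub_tendsto_zero.1 h1).mul_const ‖b‖
      refine tendsto_iff_norm_sub_tendsto_zero.2 (squeeze_zero (fun _ => norm_nonneg _) ?_ h2)
      intro u
      have e : (φ (m.fst u)).snd ((φ a).snd b) = (φ (m.snd a * u)).snd b := by
        rw [m.central, map_mul]; simp
      rw [e, ← DoubleCentralizer.norm_snd (φ (m.snd a * u) - φ (m.snd a))]
      simpa using (φ (m.snd a * u) - φ (m.snd a)).snd.le_opNorm b)
  refine ⟨⟨(L, R), fun x y => ?_⟩, fun a => multiplier_ext fun b => ?_⟩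
  · refine tendsto_nhds_unique ((hRt x).mul_const y) ?_
    simpa only [DoubleCentralizer.central] using (hLt y).const_mul x
  · have h1 : Tendsto (fun u => (φ a).fst ((φ (m.fst u)).fst b)) l (𝓝 ((φ a).fst (L b))) :=
      ((φ a).fst.continuous.tendsto _).comp (hLt b)
    have h2 : Tendsto (fun u => φ (m.snd a * u)) l (𝓝 (φ (m.snd a))) :=
      (hcont.tendsto _).comp (hR (m.snd a))
    have h3 : Tendsto (fun u => (φ (m.snd a * u)).fst b) l (𝓝 ((φ (m.snd a)).fst b)) := by
      have h4 : Tendsto (fun u => ‖φ (m.snd a * u) - φ (m.snd a)‖ * ‖b‖) l (𝓝 0) := by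
        simpa using (tendsto_iff_norm_sub_tendsto_zero.1 h2).mul_const ‖b‖
      refine tendsto_iff_norm_sub_tendsto_zero.2 (squeeze_zero (fun _ => norm_nonneg _) ?_ h4)
      intro u
      rw [← DoubleCentralizer.norm_fst (φ (m.snd a * u) - φ (m.snd a))]
      simpa using (φ (m.snd a * u) - φ (m.snd a)).fst.le_opNorm b
    refine tendsto_nhds_unique h1 ?_
    refine h3.congr fun u => ?_
    rw [m.central, map_mul]; simp

/-- The value at `m ∈ M(A)` of the extension of a nondegenerate `φ : A → M(B)`. -/
def extensionFun {φ : A →⋆ₙₐ[ℂ] 𝓜(ℂ, B)} (hφ : IsNondegenerate φ) (m : 𝓜(ℂ, A)) : 𝓜(ℂ, B) :=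
  (hφ.exists_extension m).choose

theorem extensionFun_spec {φ : A →⋆ₙₐ[ℂ] 𝓜(ℂ, B)} (hφ : IsNondegenerate φ) (m : 𝓜(ℂ, A)) (a : A) :
    φ a * extensionFun hφ m = φ (m.snd a) :=
  (hφ.exists_extension m).choose_spec a

theorem extensionFun_unique {φ : A →⋆ₙₐ[ℂ] 𝓜(ℂ, B)} (hφ : IsNondegenerate φ) (m : 𝓜(ℂ, A))
    {t : 𝓜(ℂ, B)} (ht : ∀ a, φ a * t = φ (m.snd a)) : extensionFun hφ m = t :=
  hφ.eq_of fun a => by rw [extensionFun_spec, ht]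

theorem extensionFun_spec_left {φ : A →⋆ₙₐ[ℂ] 𝓜(ℂ, B)} (hφ : IsNondegenerate φ) (m : 𝓜(ℂ, A))
    (a : A) : extensionFun hφ m * φ a = φ (m.fst a) :=
  hφ.eq_of fun c => by
    rw [← mul_assoc, extensionFun_spec, ← map_mul, ← map_mul, m.central]

/-- The unique extension of a nondegenerate `φ : A → M(B)` to a unital *-homomorphism
`M(A) → M(B)`. -/
def extension {φ : A →⋆ₙₐ[ℂ] 𝓜(ℂ, B)} (hφ : IsNondegenerate φ) : 𝓜(ℂ, A) →⋆ₐ[ℂ] 𝓜(ℂ, B) where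
  toFun := extensionFun hφ
  map_one' := extensionFun_unique hφ _ (by simp)
  map_mul' m n := extensionFun_unique hφ _ fun a => by
    rw [← mul_assoc, extensionFun_spec, extensionFun_spec]; simp
  map_zero' := extensionFun_unique hφ _ (by simp)
  map_add' m n := extensionFun_unique hφ _ fun a => by
    rw [mul_add, extensionFun_spec, extensionFun_spec]; simp
  commutes' c := extensionFun_unique hφ _ fun a => by
    simp [Algebra.algebraMap_eq_smul_one]
  map_star' m := extensionFun_unique hφ _ fun a => by
    have h := congrArg star (extensionFun_spec_left hφ m (star a))
    rw [star_mul, ← map_star, ← map_star, star_star] at h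
    rw [h, DoubleCentralizer.star_snd]

theorem extension_coe {φ : A →⋆ₙₐ[ℂ] 𝓜(ℂ, B)} (hφ : IsNondegenerate φ) (a : A) :
    extension hφ (a : 𝓜(ℂ, A)) = φ a :=
  extensionFun_unique hφ _ fun c => by rw [← map_mul]; simp

theorem extension_unique {φ : A →⋆ₙₐ[ℂ] 𝓜(ℂ, B)} (hφ : IsNondegenerate φ)
    (Θ : 𝓜(ℂ, A) →⋆ₐ[ℂ] 𝓜(ℂ, B)) (hΘ : ∀ a : A, Θ (a : 𝓜(ℂ, A)) = φ a) : extension hφ = Θ := by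
  refine StarAlgHom.ext fun m => extensionFun_unique hφ m fun a => ?_
  rw [← hΘ, ← map_mul, coe_mul_multiplier, hΘ]

/-- The composition `A → M(B) → M(C)` of `φ : A → M(B)` with the extension of `ψ : B → M(C)`. -/
def compMor (φ : A →⋆ₙₐ[ℂ] 𝓜(ℂ, B)) {ψ : B →⋆ₙₐ[ℂ] 𝓜(ℂ, C)} (hψ : IsNondegenerate ψ) :
    A →⋆ₙₐ[ℂ] 𝓜(ℂ, C) :=
  ((extension hψ : 𝓜(ℂ, B) →⋆ₐ[ℂ] 𝓜(ℂ, C)) : 𝓜(ℂ, B) →⋆ₙₐ[ℂ] 𝓜(ℂ, C)).comp φ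

theorem compMor_apply (φ : A →⋆ₙₐ[ℂ] 𝓜(ℂ, B)) {ψ : B →⋆ₙₐ[ℂ] 𝓜(ℂ, C)} (hψ : IsNondegenerate ψ)
    (a : A) : compMor φ hψ a = extension hψ (φ a) := rfl

theorem compMor_fst_fst (φ : A →⋆ₙₐ[ℂ] 𝓜(ℂ, B)) {ψ : B →⋆ₙₐ[ℂ] 𝓜(ℂ, C)} (hψ : IsNondegenerate ψ)
    (a : A) (b : B) (c : C) :
    (compMor φ hψ a).fst ((ψ b).fst c) = (ψ ((φ a).fst b)).fst c := by
  have h := congrArg (fun t : 𝓜(ℂ, C) => t.fst c) (extensionFun_spec_left hψ (φ a) b)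
  simpa [compMor_apply, extension] using h

theorem compMor_span (φ : A →⋆ₙₐ[ℂ] 𝓜(ℂ, B)) {ψ : B →⋆ₙₐ[ℂ] 𝓜(ℂ, C)} (hψ : IsNondegenerate ψ)
    (S : Set A) (T : Set B)
    (hT : T ⊆ Submodule.span ℂ {y : B | ∃ a ∈ S, ∃ b : B, y = (φ a).fst b}) (b : B) (hb : b ∈ T)
    (c : C) : (ψ b).fst c ∈
      Submodule.span ℂ {z : C | ∃ a ∈ S, ∃ c : C, z = (compMor φ hψ a).fst c} := by
  have h := hT hb
  simp only [SetLike.mem_coe] at h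
  clear hb
  induction h using Submodule.span_induction with
  | mem x hx =>
    obtain ⟨a, ha, b', rfl⟩ := hx
    refine Submodule.subset_span ⟨a, ha, (ψ b').fst c, ?_⟩
    rw [compMor_fst_fst]
  | zero => simp
  | add x y _ _ hx hy => simpa using Submodule.add_mem _ hx hy
  | smul r x _ hx => simpa using Submodule.smul_mem _ r hx

theorem IsNondegenerate.comp {φ : A →⋆ₙₐ[ℂ] 𝓜(ℂ, B)} (hφ : IsNondegenerate φ)
    {ψ : B →⋆ₙₐ[ℂ] 𝓜(ℂ, C)} (hψ : IsNondegenerate ψ) : IsNondegenerate (compMor φ hψ) := by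
  have hcl : (Submodule.span ℂ {y : C | ∃ (b : B) (c : C), y = (ψ b).fst c} : Set C) ⊆
      closure (Submodule.span ℂ {z : C | ∃ (a : A) (c : C), z = (compMor φ hψ a).fst c} : Set C) := by
    rw [← Submodule.topologicalClosure_coe, SetLike.coe_subset_coe, Submodule.span_le]
    rintro _ ⟨b, c, rfl⟩
    have hcont : Continuous fun b : B => (ψ b).fst c := by
      have h1 : Continuous fun b : B => ψ b := continuous_mor ψ
      refine continuous_iff_continuousAt.2 fun b0 => ?_
      have h4 : Tendsto (fun b => ‖ψ b - ψ b0‖ * ‖c‖) (𝓝 b0) (𝓝 0) := by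
        simpa using (tendsto_iff_norm_sub_tendsto_zero.1 (h1.tendsto b0)).mul_const ‖c‖
      refine tendsto_iff_norm_sub_tendsto_zero.2 (squeeze_zero (fun _ => norm_nonneg _) ?_ h4)
      intro u
      rw [← DoubleCentralizer.norm_fst (ψ u - ψ b0)]
      simpa using (ψ u - ψ b0).fst.le_opNorm c
    have h2 := image_closure_subset_closure_image hcont (Set.mem_image_of_mem _ (hφ b))
    refine closure_mono ?_ h2
    rintro _ ⟨b', hb', rfl⟩
    have h3 := compMor_span φ hψ Set.univ
      (Submodule.span ℂ {y : B | ∃ (a : A) (b : B), y = (φ a).fst b}) (by simp) b' hb' c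
    simpa using h3
  intro c
  have h := closure_mono hcl (hψ c)
  rwa [closure_closure] at h

theorem IsStrict.comp {φ : A →⋆ₙₐ[ℂ] 𝓜(ℂ, B)} (hφ : IsStrict φ)
    {ψ : B →⋆ₙₐ[ℂ] 𝓜(ℂ, C)} (hψ : IsNondegenerate ψ) (hψ' : IsStrict ψ) :
    IsStrict (compMor φ hψ) := by
  refine hψ'.trans (Submodule.span_le.2 ?_)
  rintro _ ⟨b, hb, c, rfl⟩
  exact compMor_span φ hψ (pedersenIdeal A) (pedersenIdeal B) hφ b hb c

theorem isNondegenerate_coeHom : IsNondegenerate (DoubleCentralizer.coeHom (𝕜 := ℂ) (A := A)) := by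
  obtain ⟨l, hl, -, -, hR⟩ := exists_approximateUnit A
  intro a
  refine mem_closure_of_tendsto (hR a) (Eventually.of_forall fun u => ?_)
  exact Submodule.subset_span ⟨a, u, by simp [DoubleCentralizer.coeHom]⟩

theorem isStrict_coeHom : IsStrict (DoubleCentralizer.coeHom (𝕜 := ℂ) (A := A)) := by
  refine pedersenIdeal_le ⟨fun a x hx => ?_, ?_⟩
  · induction hx using Submodule.span_induction with
    | mem x hx =>
      obtain ⟨k, hk, b, rfl⟩ := hx
      constructor
      · exact Submodule.subset_span ⟨a * k, mul_mem_pedersenIdeal a hk, b,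
          by simp [DoubleCentralizer.coeHom, mul_assoc]⟩
      · exact Submodule.subset_span ⟨k, hk, b * a,
          by simp [DoubleCentralizer.coeHom, mul_assoc]⟩
    | zero => simp
    | add x y _ _ hx hy =>
      rw [mul_add, add_mul]
      exact ⟨Submodule.add_mem _ hx.1 hy.1, Submodule.add_mem _ hx.2 hy.2⟩
    | smul c x _ hx =>
      rw [mul_smul_comm, smul_mul_assoc]
      exact ⟨Submodule.smul_mem _ _ hx.1, Submodule.smul_mem _ _ hx.2⟩
  · obtain ⟨l, hl, -, -, hR⟩ := exists_approximateUnit A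
    refine Dense.of_closure (pedersenIdeal_dense.mono fun a ha => ?_)
    refine mem_closure_of_tendsto (hR a) (Eventually.of_forall fun u => ?_)
    exact Submodule.subset_span ⟨a, ha, u, by simp [DoubleCentralizer.coeHom]⟩

end Nondegenerate

/-! ### The category of σ-unital C*-algebras -/

/-- A C*-algebra is σ-unital if it has a countable approximate identity. -/
def IsSigmaUnital (A : Type u) [NonUnitalCStarAlgebra A] : Prop :=
  ∃ v : ℕ → A, (∀ n, (∃ b, v n = star b * b) ∧ ‖v n‖ ≤ 1) ∧
    ∀ a, Tendsto (fun n => v n * a) atTop (𝓝 a) ∧ Tendsto (fun n => a * v n) atTop (𝓝 a)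

/-- σ-unital C*-algebras. -/
structure SigmaUnitalCStarAlg : Type (u + 1) where
  carrier : Type u
  [cstar : NonUnitalCStarAlgebra carrier]
  sigmaUnital : IsSigmaUnital carrier

attribute [instance] SigmaUnitalCStarAlg.cstar

/-- Strictly nondegenerate morphisms `A → M(B)`. -/
@[ext]
structure SigmaUnitalCStarAlg.Hom (A B : SigmaUnitalCStarAlg.{u}) : Type u where
  toHom : A.carrier →⋆ₙₐ[ℂ] 𝓜(ℂ, B.carrier)
  nondegenerate : IsNondegenerate toHom
  strict : IsStrict toHom

/-- The identity of `A` is the inclusion `A → M(A)`; the composition of `φ : A → M(B)` and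
`ψ : B → M(C)` is `ψ' ∘ φ`, where `ψ' : M(B) → M(C)` extends `ψ`. -/
instance : Category.{u} SigmaUnitalCStarAlg.{u} where
  Hom A B := SigmaUnitalCStarAlg.Hom A B
  id A := ⟨DoubleCentralizer.coeHom (𝕜 := ℂ), isNondegenerate_coeHom, isStrict_coeHom⟩
  comp f g := ⟨compMor f.toHom g.nondegenerate, f.nondegenerate.comp g.nondegenerate,
    f.strict.comp g.nondegenerate g.strict⟩
  id_comp f := SigmaUnitalCStarAlg.Hom.ext (NonUnitalStarAlgHom.ext fun a =>
    extension_coe f.nondegenerate a)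
  comp_id f := SigmaUnitalCStarAlg.Hom.ext (NonUnitalStarAlgHom.ext fun a => by
    rw [compMor_apply, extension_unique _ (StarAlgHom.id ℂ _) fun _ => rfl]
    rfl)
  assoc f g h := SigmaUnitalCStarAlg.Hom.ext (NonUnitalStarAlgHom.ext fun a => by
    rw [compMor_apply, compMor_apply, compMor_apply,
      extension_unique _ ((extension h.nondegenerate).comp (extension g.nondegenerate)) fun b => by
        rw [StarAlgHom.comp_apply, extension_coe]; rfl]
    rfl)

/-! ### σ-C*-algebras and local compactness -/

section SigmaCStar

variable (A : Type u) [Ring A] [StarRing A] [Algebra ℂ A] [TopologicalSpace A]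

/-- A presentation of the unital topological *-algebra `A` as an inverse limit of a sequence
of C*-algebras, with surjective maps `A → A_n`: `A` is identified with the coherent sequences, and
its topology is the projective topology. (As `A` is unital and `A → A_n` is onto, the `A_n` and all
maps are unital.) -/
structure SigmaCStarPresentation : Type (u + 1) where
  stage : ℕ → Type u
  [cstar : ∀ n, CStarAlgebra (stage n)]
  bond : ∀ n, stage (n + 1) →⋆ₐ[ℂ] stage n
  proj : ∀ n, A →⋆ₐ[ℂ] stage n
  bond_proj : ∀ n a, bond n (proj (n + 1) a) = proj n a
  limit : ∀ x : ∀ n, stage n, (∀ n, bond n (x (n + 1)) = x n) → ∃! a, ∀ n, proj n a = x n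
  topology_eq : ‹TopologicalSpace A› = ⨅ n, TopologicalSpace.induced (proj n) inferInstance
  surjective : ∀ n, Function.Surjective (proj n)

attribute [instance] SigmaCStarPresentation.cstar

namespace SigmaCStarPresentation

variable {A} (P : SigmaCStarPresentation A)

/-- `‖a‖_∞ = sup_n ‖π_n(a)‖`, possibly infinite. -/
def supNorm (a : A) : ℝ≥0∞ := ⨆ n, ‖P.proj n a‖ₑ

/-- Convergence to `a` of a filter for the weakest topology on `A` such that the maps `b ↦ x b` and
`b ↦ b x`, `x ∈ S`, are continuous for `‖·‖_∞`. -/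
def SupportConverges (S : Set A) (l : Filter A) (a : A) : Prop :=
  ∀ x ∈ S, Tendsto (fun b => P.supNorm (x * b - x * a)) l (𝓝 0) ∧
    Tendsto (fun b => P.supNorm (b * x - a * x)) l (𝓝 0)

/-- Cauchy filters for the same topology. -/
def SupportCauchy (S : Set A) (l : Filter A) : Prop :=
  l.NeBot ∧ ∀ x ∈ S, Tendsto (fun p : A × A => P.supNorm (x * p.1 - x * p.2)) (l ×ˢ l) (𝓝 0) ∧
    Tendsto (fun p : A × A => P.supNorm (p.1 * x - p.2 * x)) (l ×ˢ l) (𝓝 0)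

end SigmaCStarPresentation

variable {A}

/-- The support algebra `⋃ n, A e_n² A` of a sequence, where `A e_n² A` denotes the linear span of
the products. -/
def supportAlgebra (e : ℕ → A) : Set A :=
  ⋃ n, (Submodule.span ℂ {x : A | ∃ a b : A, x = a * e n ^ 2 * b} : Set A)

/-- `A` is a locally compact σ-C*-algebra with support algebra `S`. -/
def IsLocallyCompactSigmaCStar (A : Type u) [Ring A] [StarRing A] [Algebra ℂ A]
    [TopologicalSpace A] (S : Set A) : Prop :=
  ∃ (P : SigmaCStarPresentation A) (e : ℕ → A),
    -- `0 ≤ e_n ≤ 1`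
    (∀ n, (∃ b, e n = star b * b) ∧ ∃ c, 1 - e n = star c * c) ∧
    -- multiplicatively bounded
    (∀ n a, P.supNorm (e n * a) < ⊤ ∧ P.supNorm (a * e n) < ⊤) ∧
    -- canonical
    (∀ n m, n < m → e m * e n = e n) ∧
    -- `S` is the support algebra
    S = supportAlgebra e ∧
    -- `e_n → 1` for the topology given by `S`
    P.SupportConverges S (map e atTop) 1 ∧
    -- `A` is complete for the topology given by `S`
    (∀ l : Filter A, P.SupportCauchy S l → ∃ a, P.SupportConverges S l a) ∧
    -- the compatibility condition
    ∀ n a, P.supNorm (e n * a) ≤ ‖P.proj n a‖ₑ ∧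
      ‖P.proj n a‖ₑ ≤ ⨆ (b : A) (_ : P.supNorm (e n * b) ≤ 1), P.supNorm (e n * b * a)

end SigmaCStar

/-! ### The category of locally compact σ-C*-algebras -/

/-- Locally compact σ-C*-algebras, together with the support algebra `A₀₀`. -/
structure LocallyCompactSigmaCStarAlg : Type (u + 1) where
  carrier : Type u
  [ring : Ring carrier]
  [starRing : StarRing carrier]
  [algebra : Algebra ℂ carrier]
  [starModule : StarModule ℂ carrier]
  [topology : TopologicalSpace carrier]
  support : Set carrier
  isLocallyCompact : IsLocallyCompactSigmaCStar carrier support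

attribute [instance] LocallyCompactSigmaCStarAlg.ring LocallyCompactSigmaCStarAlg.starRing
  LocallyCompactSigmaCStarAlg.algebra LocallyCompactSigmaCStarAlg.starModule
  LocallyCompactSigmaCStarAlg.topology

/-- Morphisms are the unital *-homomorphisms `φ : A → B` which are continuous (equivalently, since
the topologies are given by increasing sequences of C*-seminorms: for every `m` there is `n` with
`‖φ(a)‖_m ≤ ‖a‖_n` for all `a`) and strictly nondegenerate: `φ(A₀₀)B ⊇ B₀₀`, where `φ(A₀₀)B` denotes
the linear span of the products. -/
@[ext]
structure LocallyCompactSigmaCStarAlg.Hom (A B : LocallyCompactSigmaCStarAlg.{u}) : Type u where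
  toHom : A.carrier →⋆ₐ[ℂ] B.carrier
  cont : Continuous toHom
  strict : B.support ⊆
    Submodule.span ℂ {y : B.carrier | ∃ a ∈ A.support, ∃ b : B.carrier, y = toHom a * b}

theorem LocallyCompactSigmaCStarAlg.Hom.strict_comp {A B C : LocallyCompactSigmaCStarAlg.{u}}
    (f : A.Hom B) (g : B.Hom C) : C.support ⊆ Submodule.span ℂ
      {y : C.carrier | ∃ a ∈ A.support, ∃ c : C.carrier, y = g.toHom.comp f.toHom a * c} := by
  refine g.strict.trans (SetLike.coe_subset_coe.2 (Submodule.span_le.2 ?_))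
  rintro _ ⟨b, hb, c, rfl⟩
  have h := f.strict hb
  simp only [SetLike.mem_coe] at h ⊢
  clear hb
  induction h using Submodule.span_induction with
  | mem x hx =>
    obtain ⟨a, ha, b', rfl⟩ := hx
    exact Submodule.subset_span ⟨a, ha, g.toHom b' * c, by simp [mul_assoc]⟩
  | zero => simp
  | add x y _ _ hx hy => rw [map_add, add_mul]; exact Submodule.add_mem _ hx hy
  | smul r x _ hx => rw [map_smul, smul_mul_assoc]; exact Submodule.smul_mem _ r hx

instance : Category.{u} LocallyCompactSigmaCStarAlg.{u} where
  Hom A B := LocallyCompactSigmaCStarAlg.Hom A B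
  id A := ⟨StarAlgHom.id ℂ _, continuous_id, fun a ha =>
    Submodule.subset_span ⟨a, ha, 1, (mul_one a).symm⟩⟩
  comp f g := ⟨g.toHom.comp f.toHom, g.cont.comp f.cont, f.strict_comp g⟩

/-! ### The objects in the image of the functor -/

/-- `Γ(K(A))` with support algebra `K(A)`, as a locally compact σ-C*-algebra. -/
def gammaObj (A : SigmaUnitalCStarAlg.{u})
    (h : IsLocallyCompactSigmaCStar (PedersenMultiplier A.carrier)
      (PedersenMultiplier.support A.carrier)) : LocallyCompactSigmaCStarAlg.{u} where
  carrier := PedersenMultiplier A.carrier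
  support := PedersenMultiplier.support A.carrier
  isLocallyCompact := h

/-- `C₀(X)` as a σ-unital C*-algebra. -/
def zeroAtInftyObj (X : Type u) [TopologicalSpace X] (h : IsSigmaUnital C₀(X, ℂ)) :
    SigmaUnitalCStarAlg.{u} where
  carrier := C₀(X, ℂ)
  sigmaUnital := h

/-- `C(X)`, with the compact-open topology and with the compactly supported functions as its
support algebra, as a locally compact σ-C*-algebra. -/
def continuousObj (X : Type u) [TopologicalSpace X]
    (h : IsLocallyCompactSigmaCStar C(X, ℂ) {f | HasCompactSupport f}) :
    LocallyCompactSigmaCStarAlg.{u} where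
  carrier := C(X, ℂ)
  support := {f | HasCompactSupport f}
  isLocallyCompact := h

end

/-!
Write `K` for the Pedersen ideal of a σ-unital C*-algebra `A` and `Γ` for `Γ(K)`.

**Structure of `Γ`.** Applying piecewise linear functions to a strictly positive element of `A`
gives an approximate identity `0 ≤ e n ≤ 1` with `e m * e n = e n` for `n < m`
(`IsSigmaUnital.nonempty_localUnits`). Each `e n` lies in `K`, and by minimality `K` is the union
of the ideals generated by the `e n` (`LocalUnits.exists_mem_ideal`). Multipliers are right module
maps, and by the closed graph theorem the left component `S` of a multiplier is bounded on `A e n`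
(`PedersenMultiplier.exists_bound`). Its norm there is a C*-seminorm `p n`
(`LocalUnits.seminorm`). On an element `y` of the ideal generated by `e n` one gets `‖S y‖ ≤ C p n
(S) ‖y‖`, with `C` depending on `y`; applying this to the powers of `S* S` and using the
C*-identity, one can take `C = 1` (`LocalUnits.norm_left_le`). Hence the `p n` define the
projective topology, and `Γ` is complete both for this topology and for pointwise convergence of
the components (`LocalUnits.exists_limit`).

**Inverse limit.** The stages are the completions of `Γ` for the `p n`. For a *-algebra which is
Hausdorff and complete for an increasing sequence of C*-seminorms the maps to the completions are
onto: a selfadjoint element of a stage is the sum of a series of small selfadjoint elements coming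
from the algebra, and these can be truncated by the functional calculus, simultaneously in all
stages, so that they are small for all seminorms (`CStarSeminorm.IsSeqComplete.surjective_hom`).
For `k ∈ K` the products `k m` and `m k` lie in `K`, and `‖·‖_∞` restricts to the norm of `A`
(`LocalUnits.supNorm_ofElem`). So the topology given by `K` is that of pointwise convergence of
the components, and the remaining axioms follow (`LocalUnits.isLocallyCompactSigmaCStar`).

**The functor.** For strictly nondegenerate `φ : A → M(B)` the Pedersen ideal of `B` is spanned by
the products `φ(k) z` with `k ∈ K(A)` and `z ∈ K(B)`. Therefore the multipliers `φ (m e n)`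
converge pointwise on `K(B)`, and the limit is the only `t` with `t φ(k) = φ(m k)` for `k ∈ K(A)`
(`gammaMap`, `gammaMap_unique`). This uniqueness yields algebraic properties and functoriality.
For continuity, each `y ∈ K(B)` satisfies `‖t y‖ ≤ N p N (m)` for some `N`, and Baire's theorem
makes `N` uniform on the elements of norm at most one in `{y | y e = y}` (`continuous_gammaMap`).

**Continuous functions.** Bump functions show that `C₀(X)` is σ-unital, that its Pedersen ideal
consists of the functions with compact support, and that every multiplier of this ideal is given
by a continuous function (`bijective_ofContinuous`). The projective topology becomes the
compact-open topology (`tendsto_ofContinuous_iff`), and the axioms are transported along the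
isomorphism `C(X) ≅ Γ(K(C₀(X)))`.
-/

noncomputable section

/-! ### Completions for C*-seminorms -/

section CStarSeminorm

/-- A C*-seminorm on a complex *-algebra. -/
structure CStarSeminorm (R : Type u) [Ring R] [StarRing R] [Algebra ℂ R] where
  toSeminorm : Seminorm ℂ R
  mul_le' : ∀ a b, toSeminorm (a * b) ≤ toSeminorm a * toSeminorm b
  sq_le' : ∀ a, toSeminorm a * toSeminorm a ≤ toSeminorm (star a * a)

variable {R : Type u} [Ring R] [StarRing R] [Algebra ℂ R]

namespace CStarSeminorm

instance : CoeFun (CStarSeminorm R) fun _ => R → ℝ := ⟨fun p => p.toSeminorm⟩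

theorem mul_le (p : CStarSeminorm R) (a b : R) : p (a * b) ≤ p a * p b := p.mul_le' a b

theorem nonneg (p : CStarSeminorm R) (a : R) : 0 ≤ p a := apply_nonneg _ _

theorem le_star (p : CStarSeminorm R) (a : R) : p a ≤ p (star a) := by
  rcases (p.nonneg a).eq_or_lt with h | h
  · rw [← h]; exact p.nonneg _
  · exact le_of_mul_le_mul_right ((p.sq_le' a).trans (p.mul_le _ _)) h

@[simp] theorem apply_star (p : CStarSeminorm R) (a : R) : p (star a) = p a :=
  le_antisymm (by simpa using p.le_star (star a)) (p.le_star a)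

/-- The algebra `R`, regarded as a seminormed algebra with the seminorm `p`. -/
def Space (_ : CStarSeminorm R) : Type u := R

variable (p : CStarSeminorm R)

instance : Ring p.Space := inferInstanceAs (Ring R)

instance : SeminormedRing p.Space :=
  RingSeminorm.toSeminormedRing (R := p.Space)
    { toFun := fun a => p a
      map_zero' := map_zero p.toSeminorm
      add_le' := map_add_le_add p.toSeminorm
      neg' := map_neg_eq_map p.toSeminorm
      mul_le' := p.mul_le }

instance : StarRing p.Space := inferInstanceAs (StarRing R)

instance : NormedAlgebra ℂ p.Space :=
  { (inferInstanceAs (Algebra ℂ R) : Algebra ℂ p.Space) with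
    norm_smul_le := fun c a => (map_smul_eq_mul p.toSeminorm c (show R from a)).le }

instance : NormedStarGroup p.Space where
  norm_star_le a := (p.apply_star a).le

/-- The C*-algebra obtained from `R` by separation and completion with respect to `p`. -/
def Completion : Type u := UniformSpace.Completion p.Space

instance : NormedRing p.Completion := inferInstanceAs (NormedRing (UniformSpace.Completion p.Space))

instance : CompleteSpace p.Completion :=
  inferInstanceAs (CompleteSpace (UniformSpace.Completion p.Space))

instance : NormedAlgebra ℂ p.Completion :=
  { (inferInstanceAs (Algebra ℂ (UniformSpace.Completion p.Space)) : Algebra ℂ p.Completion) with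
    norm_smul_le := fun c a => norm_smul_le (β := UniformSpace.Completion p.Space) c a }

/-- The canonical map of `R` to its completion, as a map of sets. -/
def toCompletion (a : R) : p.Completion :=
  ((show p.Space from a : p.Space) : UniformSpace.Completion p.Space)

theorem denseRange_toCompletion : DenseRange p.toCompletion :=
  UniformSpace.Completion.denseRange_coe (α := p.Space)

theorem norm_toCompletion (a : R) : ‖p.toCompletion a‖ = p a :=
  UniformSpace.Completion.norm_coe (E := p.Space) _

theorem toCompletion_add (a b : R) :
    p.toCompletion (a + b) = p.toCompletion a + p.toCompletion b :=
  UniformSpace.Completion.coe_add (α := p.Space) a b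

theorem toCompletion_mul (a b : R) :
    p.toCompletion (a * b) = p.toCompletion a * p.toCompletion b :=
  UniformSpace.Completion.coe_mul (α := p.Space) a b

theorem toCompletion_smul (c : ℂ) (a : R) :
    p.toCompletion (c • a) = c • p.toCompletion a :=
  UniformSpace.Completion.coe_smul (X := p.Space) c a

theorem uniformContinuous_star : UniformContinuous (star : p.Space → p.Space) :=
  star_isometry.uniformContinuous

instance : Star p.Completion := ⟨UniformSpace.Completion.map (star : p.Space → p.Space)⟩

theorem toCompletion_star (a : R) : p.toCompletion (star a) = star (p.toCompletion a) :=
  (UniformSpace.Completion.map_coe p.uniformContinuous_star _).symm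

theorem continuous_star_completion : Continuous (star : p.Completion → p.Completion) :=
  UniformSpace.Completion.continuous_map

instance : StarRing p.Completion where
  star_involutive a := by
    have h := p.continuous_star_completion
    refine p.denseRange_toCompletion.induction_on (p := fun a => star (star a) = a) a
      (isClosed_eq (by fun_prop) (by fun_prop)) fun a => ?_
    rw [← toCompletion_star, ← toCompletion_star, star_star]
  star_mul a b := by
    have h := p.continuous_star_completion
    refine p.denseRange_toCompletion.induction_on₂
      (p := fun a b => star (a * b) = star b * star a)
      (isClosed_eq (by fun_prop) (by fun_prop)) (fun a b => ?_) a b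
    simp only [← toCompletion_star, ← toCompletion_mul, star_mul]
  star_add a b := by
    have h := p.continuous_star_completion
    refine p.denseRange_toCompletion.induction_on₂
      (p := fun a b => star (a + b) = star a + star b)
      (isClosed_eq (by fun_prop) (by fun_prop)) (fun a b => ?_) a b
    simp only [← toCompletion_star, ← toCompletion_add, star_add]

/-- The canonical *-homomorphism of `R` to its completion. -/
def hom : R →⋆ₐ[ℂ] p.Completion where
  toFun := p.toCompletion
  map_one' := UniformSpace.Completion.coe_one p.Space
  map_mul' := p.toCompletion_mul
  map_zero' := UniformSpace.Completion.coe_zero (α := p.Space)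
  map_add' := p.toCompletion_add
  commutes' _ := rfl
  map_star' := p.toCompletion_star

theorem denseRange_hom : DenseRange p.hom := p.denseRange_toCompletion

@[simp] theorem norm_hom (a : R) : ‖p.hom a‖ = p a := p.norm_toCompletion a

variable {p} {B : Type u} [CStarAlgebra B]

/-- The extension to the completion of a map which is bounded by `p`. -/
def liftFun (f : R →⋆ₐ[ℂ] B) : p.Completion → B :=
  UniformSpace.Completion.extension (fun a : p.Space => f a)

theorem uniformContinuous_of_le {f : R →⋆ₐ[ℂ] B} (h : ∀ a, ‖f a‖ ≤ p a) :
    UniformContinuous (fun a : p.Space => f a) :=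
  (LipschitzWith.of_dist_le_mul (K := 1) fun a b => by
      rw [dist_eq_norm, dist_eq_norm, NNReal.coe_one, one_mul]
      exact (congrArg norm (map_sub f a b).symm).trans_le (h _)).uniformContinuous

theorem liftFun_hom {f : R →⋆ₐ[ℂ] B} (h : ∀ a, ‖f a‖ ≤ p a) (a : R) :
    liftFun f (p.hom a) = f a :=
  UniformSpace.Completion.extension_coe (uniformContinuous_of_le h) _

theorem continuous_liftFun (f : R →⋆ₐ[ℂ] B) : Continuous (liftFun f : p.Completion → B) :=
  UniformSpace.Completion.continuous_extension

/-- A *-homomorphism to a C*-algebra which is bounded by `p` extends to the completion. -/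
def lift (f : R →⋆ₐ[ℂ] B) (h : ∀ a, ‖f a‖ ≤ p a) : p.Completion →⋆ₐ[ℂ] B where
  toFun := liftFun f
  map_one' := by rw [← map_one p.hom, liftFun_hom h, map_one]
  map_mul' a b := by
    have hc := continuous_liftFun (p := p) f
    refine p.denseRange_hom.induction_on₂
      (p := fun a b => liftFun f (a * b) = liftFun f a * liftFun f b)
      (isClosed_eq (hc.comp continuous_mul) ((hc.comp continuous_fst).mul (hc.comp continuous_snd)))
      (fun a b => ?_) a b
    rw [← map_mul, liftFun_hom h, liftFun_hom h, liftFun_hom h, map_mul]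
  map_zero' := by rw [← map_zero p.hom, liftFun_hom h, map_zero]
  map_add' a b := by
    have hc := continuous_liftFun (p := p) f
    refine p.denseRange_hom.induction_on₂
      (p := fun a b => liftFun f (a + b) = liftFun f a + liftFun f b)
      (isClosed_eq (hc.comp continuous_add) ((hc.comp continuous_fst).add (hc.comp continuous_snd)))
      (fun a b => ?_) a b
    rw [← map_add, liftFun_hom h, liftFun_hom h, liftFun_hom h, map_add]
  commutes' c := by rw [← AlgHomClass.commutes p.hom, liftFun_hom h, AlgHomClass.commutes]
  map_star' a := by
    have hc := continuous_liftFun (p := p) f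
    refine p.denseRange_hom.induction_on
      (p := fun a => liftFun f (star a) = star (liftFun f a)) a
      (isClosed_eq (hc.comp p.continuous_star_completion) (continuous_star.comp hc)) (fun a => ?_)
    rw [← map_star, liftFun_hom h, liftFun_hom h, map_star]

@[simp] theorem lift_hom (f : R →⋆ₐ[ℂ] B) (h : ∀ a, ‖f a‖ ≤ p a) (a : R) :
    lift f h (p.hom a) = f a := liftFun_hom h a

variable (p) in
theorem norm_mul_self_le_completion (a : p.Completion) : ‖a‖ * ‖a‖ ≤ ‖star a * a‖ := by
  have h := p.continuous_star_completion
  refine p.denseRange_toCompletion.induction_on (p := fun a => ‖a‖ * ‖a‖ ≤ ‖star a * a‖) a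
    (isClosed_le (continuous_norm.mul continuous_norm) (h.mul continuous_id).norm) fun a => ?_
  rw [← toCompletion_star, ← toCompletion_mul, norm_toCompletion, norm_toCompletion]
  exact p.sq_le' a

variable (p) [StarModule ℂ R]

instance : StarModule ℂ p.Completion where
  star_smul c a := by
    have h := p.continuous_star_completion
    refine p.denseRange_toCompletion.induction_on (p := fun a => star (c • a) = star c • star a) a
      (isClosed_eq (h.comp (continuous_const_smul c)) (h.const_smul (star c))) fun a => ?_
    rw [← toCompletion_star, ← toCompletion_smul, ← toCompletion_star, star_smul,
      toCompletion_smul]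

instance : CStarRing p.Completion := ⟨p.norm_mul_self_le_completion⟩

instance : CStarAlgebra p.Completion where

end CStarSeminorm
end CStarSeminorm

/-! ### Inverse limits of completions -/

namespace CStarSeminorm

variable {R : Type u} [Ring R] [StarRing R] [Algebra ℂ R] [StarModule ℂ R]

/-- `R` is complete for the topology defined by the sequence of C*-seminorms `p n`. -/
def IsSeqComplete (p : ℕ → CStarSeminorm R) : Prop :=
  ∀ a : ℕ → R, (∀ n, CauchySeq fun k => (p n).hom (a k)) →
    ∃ b, ∀ n, Tendsto (fun k => (p n).hom (a k)) atTop (𝓝 ((p n).hom b))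

variable {p : ℕ → CStarSeminorm R}

/-- The connecting maps between the completions for an increasing sequence of C*-seminorms. -/
def bond (hmono : ∀ n a, p n a ≤ p (n + 1) a) (n : ℕ) :
    (p (n + 1)).Completion →⋆ₐ[ℂ] (p n).Completion :=
  lift (p n).hom fun a => ((p n).norm_hom a).trans_le (hmono n a)

theorem bond_hom (hmono : ∀ n a, p n a ≤ p (n + 1) a) (n : ℕ) (a : R) :
    bond hmono n ((p (n + 1)).hom a) = (p n).hom a := lift_hom _ _ _

/-- The connecting maps are contractive, so approximation in a late stage implies approximation in
the earlier ones. -/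
theorem norm_hom_sub_le_of_le (hmono : ∀ n a, p n a ≤ p (n + 1) a)
    {x : ∀ n, (p n).Completion} (hx : ∀ n, bond hmono n (x (n + 1)) = x n) {n k : ℕ} (h : n ≤ k)
    (b : R) : ‖(p n).hom b - x n‖ ≤ ‖(p k).hom b - x k‖ := by
  induction k, h using Nat.le_induction with
  | base => exact le_rfl
  | succ k _ ih =>
    refine ih.trans ?_
    rw [← bond_hom hmono k, ← hx k, ← map_sub]
    exact NonUnitalStarAlgHom.norm_apply_le _ _

theorem IsSeqComplete.existsUnique_of_coherent (hcompl : IsSeqComplete p)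
    (hmono : ∀ n a, p n a ≤ p (n + 1) a) (hsep : ∀ a, (∀ n, p n a = 0) → a = 0)
    (x : ∀ n, (p n).Completion) (hx : ∀ n, bond hmono n (x (n + 1)) = x n) :
    ∃! a, ∀ n, (p n).hom a = x n := by
  have h1 : ∀ k : ℕ, ∃ a : R, ‖(p k).hom a - x k‖ < 1 / ((k : ℝ) + 1) := fun k => by
    obtain ⟨a, ha⟩ := (p k).denseRange_hom.exists_dist_lt (x k)
      (show (0 : ℝ) < 1 / ((k : ℝ) + 1) by positivity)
    exact ⟨a, by rwa [dist_comm, dist_eq_norm] at ha⟩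
  choose a ha using h1
  have h2 : ∀ n, Tendsto (fun k => (p n).hom (a k)) atTop (𝓝 (x n)) := fun n => by
    refine tendsto_iff_norm_sub_tendsto_zero.2 (squeeze_zero' (Eventually.of_forall fun _ =>
      norm_nonneg _) ?_ tendsto_one_div_add_atTop_nhds_zero_nat)
    filter_upwards [eventually_ge_atTop n] with k hk
    exact (norm_hom_sub_le_of_le hmono hx hk _).trans (ha k).le
  obtain ⟨b, hb⟩ := hcompl a fun n => (h2 n).cauchySeq
  refine ⟨b, fun n => tendsto_nhds_unique (hb n) (h2 n), fun c hc => ?_⟩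
  refine sub_eq_zero.1 (hsep _ fun n => ?_)
  rw [← norm_hom, map_sub, hc n, tendsto_nhds_unique (hb n) (h2 n), sub_self, norm_zero]

/-- The functional calculus truncates a selfadjoint element at its norm for one of the seminorms,
without changing it for this seminorm. -/
theorem IsSeqComplete.exists_bounded_lift (hcompl : IsSeqComplete p)
    (hmono : ∀ n a, p n a ≤ p (n + 1) a) (hsep : ∀ a, (∀ n, p n a = 0) → a = 0)
    {a : R} (ha : IsSelfAdjoint a) (n : ℕ) :
    ∃ b, (p n).hom b = (p n).hom a ∧ ∀ m, p m b ≤ p n a := by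
  set r : ℝ := p n a with hr
  have hr0 : 0 ≤ r := (p n).nonneg a
  set f : ℝ → ℝ := fun t => max (-r) (min t r) with hf
  have hfc : Continuous f := by fun_prop
  have hsa : ∀ m, IsSelfAdjoint ((p m).hom a) := fun m => ha.map (p m).hom
  obtain ⟨b, hb, -⟩ := hcompl.existsUnique_of_coherent hmono hsep
    (fun m => cfc f ((p m).hom a)) (fun m => by
      have hc : Continuous (bond hmono m) :=
        AddMonoidHomClass.continuous_of_bound (bond hmono m) 1 fun a => by
          rw [one_mul]; exact NonUnitalStarAlgHom.norm_apply_le _ a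
      rw [StarAlgHom.map_cfc (bond hmono m) f ((p (m + 1)).hom a) hfc.continuousOn hc (hsa _)
        (by rw [bond_hom]; exact hsa m), bond_hom])
  refine ⟨b, ?_, fun m => ?_⟩
  · rw [hb n]
    conv_rhs => rw [← cfc_id' ℝ ((p n).hom a) (hsa n)]
    refine cfc_congr fun t ht => ?_
    have : Nontrivial (p n).Completion := not_subsingleton_iff_nontrivial.1 fun _ => by
      rw [spectrum.of_subsingleton] at ht
      exact ht
    have h : ‖t‖ ≤ r := by
      rw [hr, ← norm_hom]; exact spectrum.norm_le_norm_of_mem ht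
    rw [Real.norm_eq_abs, abs_le] at h
    simp [hf, min_eq_left h.2, max_eq_right h.1]
  · rw [← norm_hom, hb m]
    refine norm_cfc_le hr0 fun t _ => ?_
    rw [Real.norm_eq_abs, abs_le]
    exact ⟨le_max_left _ _, max_le (by linarith) (min_le_right _ _)⟩

/-- A selfadjoint element of a completion is the limit of a rapidly converging sequence of images
of selfadjoint elements. Truncating the differences turns it into a series which converges for all
the seminorms. -/
theorem IsSeqComplete.exists_hom_eq_of_isSelfAdjoint (hcompl : IsSeqComplete p)
    (hmono : ∀ n a, p n a ≤ p (n + 1) a) (hsep : ∀ a, (∀ n, p n a = 0) → a = 0)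
    {n : ℕ} {b : (p n).Completion} (hb : IsSelfAdjoint b) : ∃ a, (p n).hom a = b := by
  have h1 : ∀ k : ℕ, ∃ c : R, IsSelfAdjoint c ∧ ‖(p n).hom c - b‖ ≤ 1 / 4 * (1 / 2) ^ k := by
    intro k
    obtain ⟨c, hc⟩ := (p n).denseRange_hom.exists_dist_lt b
      (show (0 : ℝ) < 1 / 4 * (1 / 2) ^ k by positivity)
    rw [dist_comm, dist_eq_norm] at hc
    refine ⟨(realPart c : R), (realPart c).2, ?_⟩
    have h2 : (p n).hom (realPart c : R) - b = realPart ((p n).hom c - b) := by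
      rw [map_realPart, map_sub, AddSubgroup.coe_sub, hb.coe_realPart]
    rw [h2]
    exact (realPart.norm_le _).trans hc.le
  choose c hcs hc using h1
  have h2 : ∀ k, ∃ d, (p n).hom d = (p n).hom (c (k + 1) - c k) ∧
      ∀ m, p m d ≤ 1 / 2 * (1 / 2) ^ k := by
    intro k
    obtain ⟨d, hd, hd'⟩ := hcompl.exists_bounded_lift hmono hsep ((hcs (k + 1)).sub (hcs k)) n
    refine ⟨d, hd, fun m => (hd' m).trans ?_⟩
    rw [← norm_hom]
    have e : (p n).hom (c (k + 1) - c k)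
        = ((p n).hom (c (k + 1)) - b) - ((p n).hom (c k) - b) := by rw [map_sub]; abel
    rw [e]
    refine (norm_sub_le _ _).trans ((add_le_add (hc (k + 1)) (hc k)).trans ?_)
    have : (0 : ℝ) < (1 / 2) ^ k := by positivity
    rw [pow_succ]
    linarith
  choose d hd hd' using h2
  set s : ℕ → R := fun k => c 0 + ∑ j ∈ Finset.range k, d j with hs
  have hs1 : ∀ k, (p n).hom (s k) = (p n).hom (c k) := by
    intro k
    induction k with
    | zero => simp [hs]
    | succ k ih =>
      have : s (k + 1) = s k + d k := by simp [hs, Finset.sum_range_succ, add_assoc]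
      rw [this, map_add, ih, hd, ← map_add]; congr 1; abel
  obtain ⟨a, ha⟩ := hcompl s fun m => by
    refine cauchySeq_of_le_geometric (1 / 2) (1 / 2) (by norm_num) fun k => ?_
    have : s (k + 1) = s k + d k := by simp [hs, Finset.sum_range_succ, add_assoc]
    rw [dist_comm, dist_eq_norm, ← map_sub, norm_hom, this, add_sub_cancel_left]
    exact hd' k m
  refine ⟨a, tendsto_nhds_unique (ha n) ?_⟩
  simp only [hs1]
  refine tendsto_iff_norm_sub_tendsto_zero.2 (squeeze_zero (fun _ => norm_nonneg _) hc ?_)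
  rw [← mul_zero (1 / 4 : ℝ)]
  exact (tendsto_pow_atTop_nhds_zero_of_lt_one (r := (1 / 2 : ℝ)) (by norm_num)
    (by norm_num)).const_mul _

theorem IsSeqComplete.surjective_hom (hcompl : IsSeqComplete p)
    (hmono : ∀ n a, p n a ≤ p (n + 1) a) (hsep : ∀ a, (∀ n, p n a = 0) → a = 0) (n : ℕ) :
    Function.Surjective (p n).hom := by
  intro b
  obtain ⟨a₁, h₁⟩ := hcompl.exists_hom_eq_of_isSelfAdjoint hmono hsep (realPart b).2
  obtain ⟨a₂, h₂⟩ := hcompl.exists_hom_eq_of_isSelfAdjoint hmono hsep (imaginaryPart b).2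
  exact ⟨a₁ + Complex.I • a₂, by
    rw [map_add, map_smul, h₁, h₂, realPart_add_I_smul_imaginaryPart]⟩

/-- A complex *-algebra which is Hausdorff and complete for an increasing sequence of C*-seminorms
is the inverse limit of its completions for the single seminorms, and maps onto each of them. -/
def IsSeqComplete.presentation [TopologicalSpace R] (hcompl : IsSeqComplete p)
    (hmono : ∀ n a, p n a ≤ p (n + 1) a) (hsep : ∀ a, (∀ n, p n a = 0) → a = 0)
    (htop : ‹TopologicalSpace R› = ⨅ n, TopologicalSpace.induced (p n).hom inferInstance) :
    SigmaCStarPresentation R where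
  stage n := (p n).Completion
  bond := bond hmono
  proj n := (p n).hom
  bond_proj := bond_hom hmono
  limit := hcompl.existsUnique_of_coherent hmono hsep
  topology_eq := htop
  surjective := hcompl.surjective_hom hmono hsep

end CStarSeminorm

/-! ### Local units in σ-unital C*-algebras -/

section LocalUnits

/-- A sequence `0 ≤ e n ≤ 1` in a C*-algebra which is an approximate identity and satisfies
`e m * e n = e n` for `n < m`. The inequalities `0 ≤ e n` and `e n ≤ 1` are witnessed by square
roots of `e n` and of `1 - e n`; the latter has the form `1 - c`. -/
structure LocalUnits (A : Type u) [NonUnitalCStarAlgebra A] where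
  e : ℕ → A
  exists_sqrt : ∀ n, ∃ b, e n = star b * b
  exists_sqrt_one_sub : ∀ n, ∃ c, IsSelfAdjoint c ∧ e n = c + c - c * c
  norm_le_one : ∀ n, ‖e n‖ ≤ 1
  mul_eq : ∀ n m, n < m → e m * e n = e n
  tendsto_mul : ∀ a, Tendsto (fun n => e n * a) atTop (𝓝 a)

variable {A : Type u} [NonUnitalCStarAlgebra A]

/-- The piecewise linear function which is `0` for `t ≤ 1 / (n + 2)` and `1` for
`t ≥ 1 / (n + 1)`. -/
def ramp (n : ℕ) (t : ℝ) : ℝ := max 0 (min 1 ((n + 1) * ((n + 2) * t - 1)))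

theorem continuous_ramp (n : ℕ) : Continuous (ramp n) := by unfold ramp; fun_prop

theorem ramp_nonneg (n : ℕ) (t : ℝ) : 0 ≤ ramp n t := le_max_left _ _

theorem ramp_le_one (n : ℕ) (t : ℝ) : ramp n t ≤ 1 := max_le zero_le_one (min_le_left _ _)

theorem ramp_eq_zero {n : ℕ} {t : ℝ} (h : ((n : ℝ) + 2) * t ≤ 1) : ramp n t = 0 := by
  refine max_eq_left ((min_le_right _ _).trans ?_)
  exact mul_nonpos_of_nonneg_of_nonpos (by positivity) (by linarith)

theorem ramp_eq_one {n : ℕ} {t : ℝ} (h : 1 ≤ ((n : ℝ) + 1) * t) : ramp n t = 1 := by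
  have h1 : (1 : ℝ) ≤ (n + 1) * ((n + 2) * t - 1) := by nlinarith
  rw [ramp, min_eq_left h1, max_eq_right zero_le_one]

@[simp] theorem ramp_zero (n : ℕ) : ramp n 0 = 0 := ramp_eq_zero (by simp)

theorem ramp_mul_ramp {n m : ℕ} (h : n < m) (t : ℝ) : ramp m t * ramp n t = ramp n t := by
  by_cases ht : ((n : ℝ) + 2) * t ≤ 1
  · simp [ramp_eq_zero ht]
  · have h1 : ((n : ℝ) + 1) ≤ m := by exact_mod_cast h
    have h0 : 0 < t := by
      by_contra! h0
      exact ht (by nlinarith [n.cast_nonneg (α := ℝ)])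
    rw [ramp_eq_one (n := m) (by nlinarith), one_mul]

theorem abs_mul_one_sub_ramp_sq_le (n : ℕ) {t : ℝ} (ht : 0 ≤ t) :
    |t - ramp n t * t - t * ramp n t + ramp n t * t * ramp n t| ≤ 1 / ((n : ℝ) + 1) := by
  have e : t - ramp n t * t - t * ramp n t + ramp n t * t * ramp n t
      = t * (1 - ramp n t) ^ 2 := by ring
  rw [e]
  by_cases h : 1 ≤ ((n : ℝ) + 1) * t
  · rw [ramp_eq_one h]; simp; positivity
  · rw [abs_of_nonneg (by positivity), le_div_iff₀ (by positivity)]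
    have h1 : (1 - ramp n t) ^ 2 ≤ 1 := by
      nlinarith [ramp_nonneg n t, ramp_le_one n t]
    nlinarith [mul_nonneg ht (sub_nonneg.2 h1)]

/-- Local units are obtained from a countable approximate identity `v` by applying the functions
`ramp n` to `h = ∑ 2⁻ᵏ v k`. -/
theorem IsSigmaUnital.nonempty_localUnits (hA : IsSigmaUnital A) : Nonempty (LocalUnits A) := by
  let _ := CStarAlgebra.spectralOrder A
  have _ := CStarAlgebra.spectralOrderedRing A
  obtain ⟨v, hv, hva⟩ := hA
  choose b hb using fun n => (hv n).1
  have hsum : Summable fun k => ((1 / 2 : ℝ) ^ k) • v k := by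
    refine Summable.of_norm_bounded (g := fun k => (1 / 2 : ℝ) ^ k)
      (summable_geometric_of_lt_one (by norm_num) (by norm_num)) fun k => ?_
    rw [norm_smul, norm_pow, Real.norm_of_nonneg (by norm_num : (0 : ℝ) ≤ 1 / 2)]
    exact mul_le_of_le_one_right (by positivity) (hv k).2
  obtain ⟨h, hh⟩ := hsum
  have hh0 : 0 ≤ h := hh.nonneg fun k => smul_nonneg (by positivity)
    (by rw [hb]; exact star_mul_self_nonneg _)
  have hsa : IsSelfAdjoint h := hh0.isSelfAdjoint
  have hq : ∀ t ∈ quasispectrum ℝ h, 0 ≤ t := fun t ht => quasispectrum_nonneg_of_nonneg h hh0 t ht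
  set f : ℕ → A := fun n => cfcₙ (ramp n) h with hf
  have hfs : ∀ n, IsSelfAdjoint (f n) := fun n => cfcₙ_predicate (ramp n) h
  have hf1 : ∀ n, ‖f n‖ ≤ 1 := fun n => norm_cfcₙ_le fun t _ => by
    rw [Real.norm_of_nonneg (ramp_nonneg n t)]; exact ramp_le_one n t
  -- `‖(1 - f n) h (1 - f n)‖` is at most the supremum of `t (1 - ramp n t)²`
  have hfh : ∀ n, ‖h - f n * h - h * f n + f n * h * f n‖ ≤ 1 / ((n : ℝ) + 1) := by
    intro n
    have hc := continuous_ramp n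
    have e : h - f n * h - h * f n + f n * h * f n
        = cfcₙ (fun t => t - ramp n t * t - t * ramp n t + ramp n t * t * ramp n t) h := by
      rw [cfcₙ_add (fun t => t - ramp n t * t - t * ramp n t) (fun t => ramp n t * t * ramp n t) h
          (by fun_prop) (by simp) (by fun_prop) (by simp),
        cfcₙ_sub (fun t => t - ramp n t * t) (fun t => t * ramp n t) h
          (by fun_prop) (by simp) (by fun_prop) (by simp),
        cfcₙ_sub (fun t => t) (fun t => ramp n t * t) h
          (by fun_prop) (by simp) (by fun_prop) (by simp),
        cfcₙ_mul (fun t => ramp n t * t) (ramp n) h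
          (by fun_prop) (by simp) (by fun_prop) (by simp),
        cfcₙ_mul (fun t => t) (ramp n) h (by fun_prop) (by simp) (by fun_prop) (by simp),
        cfcₙ_mul (ramp n) (fun t => t) h (by fun_prop) (by simp) (by fun_prop) (by simp),
        cfcₙ_id' ℝ h]
    rw [e]
    exact norm_cfcₙ_le fun t ht => abs_mul_one_sub_ramp_sq_le n (hq t ht)
  -- `2⁻ᵏ (1 - f n) v k (1 - f n) ≤ (1 - f n) h (1 - f n)`, where `v k = star (b k) * b k`
  have hbf : ∀ k n, ‖b k - b k * f n‖ * ‖b k - b k * f n‖ ≤ 2 ^ k * (1 / ((n : ℝ) + 1)) := by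
    intro k n
    have hs : HasSum (fun k => ((1 / 2 : ℝ) ^ k) • (star (b k - b k * f n) * (b k - b k * f n)))
        (h - f n * h - h * f n + f n * h * f n) := by
      have h1 := ((hh.sub (hh.mul_left (f n))).sub (hh.mul_right (f n))).add
        ((hh.mul_left (f n)).mul_right (f n))
      refine h1.congr_fun fun k => ?_
      simp only [hb, star_sub, star_mul, (hfs n).star_eq, mul_sub, sub_mul, smul_sub, mul_smul_comm,
        smul_mul_assoc, mul_assoc]
      abel
    have h1 : ((1 / 2 : ℝ) ^ k) • (star (b k - b k * f n) * (b k - b k * f n))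
        ≤ h - f n * h - h * f n + f n * h * f n :=
      le_hasSum hs k fun j _ => smul_nonneg (by positivity) (star_mul_self_nonneg _)
    have h2 := (CStarAlgebra.norm_le_norm_of_nonneg_of_le
      (smul_nonneg (by positivity) (star_mul_self_nonneg _)) h1).trans (hfh n)
    rw [norm_smul, norm_pow, Real.norm_of_nonneg (by norm_num : (0 : ℝ) ≤ 1 / 2),
      CStarRing.norm_star_mul_self] at h2
    calc _ = 2 ^ k * ((1 / 2 : ℝ) ^ k * (‖b k - b k * f n‖ * ‖b k - b k * f n‖)) := by
          rw [← mul_assoc, ← mul_pow]; norm_num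
      _ ≤ _ := by gcongr
  have hbf0 : ∀ k, Tendsto (fun n => ‖b k - b k * f n‖) atTop (𝓝 0) := by
    intro k
    have h1 : Tendsto (fun n : ℕ => (2 : ℝ) ^ k * (1 / ((n : ℝ) + 1))) atTop (𝓝 0) := by
      simpa using (tendsto_one_div_add_atTop_nhds_zero_nat (𝕜 := ℝ)).const_mul ((2 : ℝ) ^ k)
    have h2 := (squeeze_zero (fun n => mul_self_nonneg _) (hbf k) h1).sqrt
    simpa using h2
  have hvf : ∀ k, Tendsto (fun n => ‖f n * v k - v k‖) atTop (𝓝 0) := by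
    intro k
    refine squeeze_zero (fun _ => norm_nonneg _) (fun n => ?_)
      (by simpa using (hbf0 k).mul_const ‖b k‖)
    have e : f n * v k - v k = - (star (b k - b k * f n) * b k) := by
      rw [hb, star_sub, star_mul, (hfs n).star_eq, sub_mul, mul_assoc]; abel
    rw [e, norm_neg, ← norm_star (b k - b k * f n)]
    exact norm_mul_le _ _
  refine ⟨f, fun n => ?_, fun n => ?_, hf1, fun n m hnm => ?_, fun a => ?_⟩
  · have hc : Continuous fun t => √(ramp n t) := (continuous_ramp n).sqrt
    refine ⟨cfcₙ (fun t => √(ramp n t)) h, ?_⟩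
    have hs : IsSelfAdjoint (cfcₙ (fun t => √(ramp n t)) h) := cfcₙ_predicate _ h
    rw [hs.star_eq, ← cfcₙ_mul _ _ h hc.continuousOn (by simp) hc.continuousOn (by simp)]
    simp only [Real.mul_self_sqrt (ramp_nonneg n _)]
    rfl
  · have hc : Continuous fun t => 1 - √(1 - ramp n t) :=
      continuous_const.sub ((continuous_const.sub (continuous_ramp n)).sqrt)
    refine ⟨cfcₙ (fun t => 1 - √(1 - ramp n t)) h, cfcₙ_predicate _ h, ?_⟩
    rw [← cfcₙ_mul _ _ h hc.continuousOn (by simp) hc.continuousOn (by simp),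
      ← cfcₙ_add _ _ h hc.continuousOn (by simp) hc.continuousOn (by simp),
      ← cfcₙ_sub (fun t => 1 - √(1 - ramp n t) + (1 - √(1 - ramp n t)))
        (fun t => (1 - √(1 - ramp n t)) * (1 - √(1 - ramp n t))) h (hc.add hc).continuousOn
        (by simp) (hc.mul hc).continuousOn (by simp)]
    refine cfcₙ_congr fun t _ => ?_
    have := Real.mul_self_sqrt (sub_nonneg.2 (ramp_le_one n t))
    linarith
  · rw [hf]
    simp only
    rw [← cfcₙ_mul _ _ h (continuous_ramp m).continuousOn (by simp)
      (continuous_ramp n).continuousOn (by simp)]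
    simp only [ramp_mul_ramp hnm]
  · rw [Metric.tendsto_atTop]
    intro ε hε
    have h1 := (tendsto_iff_norm_sub_tendsto_zero.1 (hva a).1).eventually
      (gt_mem_nhds (show (0 : ℝ) < ε / 4 by positivity))
    obtain ⟨k, hk⟩ := h1.exists
    have h2 : Tendsto (fun n => ‖f n * v k - v k‖ * ‖a‖) atTop (𝓝 0) := by
      simpa using (hvf k).mul_const ‖a‖
    obtain ⟨N, hN⟩ := eventually_atTop.1
      (h2.eventually (gt_mem_nhds (show (0 : ℝ) < ε / 4 by positivity)))
    refine ⟨N, fun n hn => ?_⟩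
    rw [dist_eq_norm]
    have e : f n * a - a = - (f n * (v k * a - a)) + (f n * v k - v k) * a + (v k * a - a) := by
      rw [mul_sub, sub_mul, mul_assoc]; abel
    have h3 : ‖f n * (v k * a - a)‖ ≤ ε / 4 := by
      refine (norm_mul_le _ _).trans ?_
      exact (mul_le_of_le_one_left (norm_nonneg _) (hf1 n)).trans hk.le
    have h4 : ‖(f n * v k - v k) * a‖ ≤ ε / 4 := (norm_mul_le _ _).trans (hN n hn).le
    rw [e]
    refine (norm_add₃_le).trans_lt ?_
    rw [norm_neg]
    linarith

namespace LocalUnits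

variable (L : LocalUnits A)

theorem isSelfAdjoint (n : ℕ) : IsSelfAdjoint (L.e n) := by
  obtain ⟨b, hb⟩ := L.exists_sqrt n
  rw [hb]; exact IsSelfAdjoint.star_mul_self b

theorem mul_eq' {n m : ℕ} (h : n < m) : L.e n * L.e m = L.e n := by
  have := congrArg star (L.mul_eq n m h)
  rwa [star_mul, (L.isSelfAdjoint n).star_eq, (L.isSelfAdjoint m).star_eq] at this

theorem mul_tendsto (a : A) : Tendsto (fun n => a * L.e n) atTop (𝓝 a) := by
  have := (L.tendsto_mul (star a)).star
  simpa only [star_mul, star_star, (L.isSelfAdjoint _).star_eq] using this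

theorem mem_pedersenIdeal (n : ℕ) : L.e n ∈ pedersenIdeal A := by
  simp only [pedersenIdeal, Submodule.mem_sInf]
  exact fun I hI => mem_of_mul_eq hI (L.mul_eq' n.lt_succ_self)

/-- The two-sided ideal generated by `e n`. -/
def ideal (n : ℕ) : Submodule ℂ A := Submodule.span ℂ {x | ∃ a b, x = a * L.e n * b}

theorem ideal_mono : Monotone L.ideal := by
  refine monotone_nat_of_le_succ fun n => Submodule.span_le.2 ?_
  rintro _ ⟨a, b, rfl⟩
  refine Submodule.subset_span ⟨a, L.e n * b, ?_⟩
  rw [mul_assoc a (L.e (n + 1)), ← mul_assoc (L.e (n + 1)), L.mul_eq n _ n.lt_succ_self, mul_assoc]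

theorem mul_mem_ideal {n : ℕ} (a : A) {x : A} (hx : x ∈ L.ideal n) : a * x ∈ L.ideal n := by
  induction hx using Submodule.span_induction with
  | mem x hx =>
    obtain ⟨c, d, rfl⟩ := hx
    exact Submodule.subset_span ⟨a * c, d, by simp only [mul_assoc]⟩
  | zero => simp
  | add x y _ _ hx hy => rw [mul_add]; exact Submodule.add_mem _ hx hy
  | smul c x _ hx => rw [mul_smul_comm]; exact Submodule.smul_mem _ _ hx

theorem ideal_mul_mem {n : ℕ} (a : A) {x : A} (hx : x ∈ L.ideal n) : x * a ∈ L.ideal n := by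
  induction hx using Submodule.span_induction with
  | mem x hx =>
    obtain ⟨c, d, rfl⟩ := hx
    exact Submodule.subset_span ⟨c, d * a, by simp only [mul_assoc]⟩
  | zero => simp
  | add x y _ _ hx hy => rw [add_mul]; exact Submodule.add_mem _ hx hy
  | smul c x _ hx => rw [smul_mul_assoc]; exact Submodule.smul_mem _ _ hx

theorem mem_iSup_ideal {x : A} : x ∈ ⨆ n, L.ideal n ↔ ∃ n, x ∈ L.ideal n :=
  Submodule.mem_iSup_of_directed _ L.ideal_mono.directed_le

/-- The Pedersen ideal is the union of the ideals generated by the `e n`, as this union is a dense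
ideal. -/
theorem exists_mem_ideal {x : A} (hx : x ∈ pedersenIdeal A) : ∃ n, x ∈ L.ideal n := by
  rw [← mem_iSup_ideal]
  refine pedersenIdeal_le ⟨fun a x hx => ?_, fun a => ?_⟩ hx
  · simp only [mem_iSup_ideal] at hx ⊢
    obtain ⟨n, hn⟩ := hx
    exact ⟨⟨n, L.mul_mem_ideal a hn⟩, ⟨n, L.ideal_mul_mem a hn⟩⟩
  · refine mem_closure_of_tendsto (L.mul_tendsto a) (Eventually.of_forall fun n => ?_)
    refine L.mem_iSup_ideal.2 ⟨n, Submodule.subset_span ⟨a, L.e (n + 1), ?_⟩⟩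
    rw [mul_assoc, L.mul_eq' n.lt_succ_self]

end LocalUnits

end LocalUnits

/-! ### C*-seminorms on `Γ(K(A))` -/

section GammaSeminorms

variable {A : Type u} [NonUnitalCStarAlgebra A]

theorem eq_zero_of_pedersenIdeal_mul {x : A} (h : ∀ w : pedersenIdeal A, (w : A) * x = 0) :
    x = 0 := by
  have hcl : IsClosed {w : A | w * x = 0} := isClosed_eq (by fun_prop) continuous_const
  have h1 : star x * x = 0 :=
    hcl.closure_subset_iff.2 (fun w hw => h ⟨w, hw⟩) (pedersenIdeal_dense (star x))
  rwa [CStarRing.star_mul_self_eq_zero_iff] at h1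

theorem eq_of_pedersenIdeal_mul {x y : A} (h : ∀ w : pedersenIdeal A, (w : A) * x = w * y) :
    x = y :=
  sub_eq_zero.1 (eq_zero_of_pedersenIdeal_mul fun w => by rw [mul_sub, h w, sub_self])

theorem eq_of_mul_pedersenIdeal {x y : A} (h : ∀ w : pedersenIdeal A, x * (w : A) = y * w) :
    x = y := by
  refine star_injective (eq_of_pedersenIdeal_mul fun w => ?_)
  have := congrArg star (h ⟨star (w : A), star_mem_pedersenIdeal w.2⟩)
  simpa using this

namespace PedersenMultiplier

theorem ext_left {m n : PedersenMultiplier A} (h : ∀ x, m.left x = n.left x) : m = n :=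
  ext h fun x => Subtype.ext (eq_of_mul_pedersenIdeal fun w => by
    rw [← m.central, ← n.central, h])

@[simp] theorem coe_left_ofElem (a : A) (y : pedersenIdeal A) :
    ((ofElem A a).left y : A) = a * y := rfl

@[simp] theorem coe_right_ofElem (a : A) (y : pedersenIdeal A) :
    ((ofElem A a).right y : A) = y * a := rfl

@[simp] theorem left_one (y : pedersenIdeal A) : (1 : PedersenMultiplier A).left y = y := rfl

@[simp] theorem left_sub (m n : PedersenMultiplier A) (x : pedersenIdeal A) :
    (m - n).left x = m.left x - n.left x := rfl

/-- The left component of a multiplier is a map of right modules. -/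
theorem left_mul_elem (m : PedersenMultiplier A) {x : A} (hx : x ∈ pedersenIdeal A) (a : A)
    (hxa : x * a ∈ pedersenIdeal A) : (m.left ⟨x * a, hxa⟩ : A) = m.left ⟨x, hx⟩ * a :=
  eq_of_pedersenIdeal_mul fun w => by
    rw [m.central, ← mul_assoc (w : A), m.central, mul_assoc]

theorem star_left_mul (m : PedersenMultiplier A) (x y : pedersenIdeal A) :
    star (m.left x : A) * y = star (x : A) * (star m).left y := by
  have h := (star m).central ⟨star (x : A), star_mem_pedersenIdeal x.2⟩ y
  simpa using h.symm

theorem norm_left_sq_le (m : PedersenMultiplier A) (x : pedersenIdeal A) :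
    ‖(m.left x : A)‖ * ‖(m.left x : A)‖ ≤ ‖(x : A)‖ * ‖((star m * m).left x : A)‖ := by
  rw [← CStarRing.norm_star_mul_self, star_left_mul, ← left_mul, ← norm_star (x : A)]
  exact norm_mul_le _ _

/-- Although `y ↦ S y` need not be bounded, its norm is lower semicontinuous. -/
theorem norm_left_le_of_tendsto {ι : Type*} {l : Filter ι} [l.NeBot] (m : PedersenMultiplier A)
    {u : ι → pedersenIdeal A} {y : pedersenIdeal A}
    (hu : Tendsto (fun i => (u i : A)) l (𝓝 (y : A))) {c : ι → ℝ} {C : ℝ} (hc : Tendsto c l (𝓝 C))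
    (h : ∀ i, ‖(m.left (u i) : A)‖ ≤ c i) : ‖(m.left y : A)‖ ≤ C := by
  set w : pedersenIdeal A := ⟨star (m.left y : A), star_mem_pedersenIdeal (m.left y).2⟩ with hw
  have h1 : Tendsto (fun i => ‖(m.right w : A) * u i‖) l (𝓝 ‖(m.right w : A) * y‖) :=
    (hu.const_mul _).norm
  have h2 : ‖(m.left y : A)‖ * ‖(m.left y : A)‖ ≤ ‖(m.left y : A)‖ * C := by
    have e : ‖(m.right w : A) * y‖ = ‖(m.left y : A)‖ * ‖(m.left y : A)‖ := by
      rw [← m.central, hw, CStarRing.norm_star_mul_self]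
    rw [← e]
    refine le_of_tendsto_of_tendsto' h1 (hc.const_mul ‖(m.left y : A)‖) fun i => ?_
    rw [← m.central]
    refine (norm_mul_le _ _).trans ?_
    rw [hw, norm_star]
    exact mul_le_mul_of_nonneg_left (h i) (norm_nonneg _)
  rcases (norm_nonneg (m.left y : A)).eq_or_lt with h0 | h0
  · rw [← h0]
    exact ge_of_tendsto' hc fun i => (norm_nonneg _).trans (h i)
  · exact le_of_mul_le_mul_left h2 h0

/-- The closed left ideal of all `y` with `y * e = y`. -/
def fixedSubmodule (e : A) : Submodule ℂ A where
  carrier := {y | y * e = y}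
  add_mem' := fun {a b} ha hb => by
    simp only [Set.mem_ofPred_eq] at *; rw [add_mul, ha, hb]
  zero_mem' := zero_mul e
  smul_mem' := fun c y hy => by
    simp only [Set.mem_ofPred_eq] at *; rw [smul_mul_assoc, hy]

theorem isClosed_fixedSubmodule (e : A) : IsClosed (fixedSubmodule e : Set A) :=
  isClosed_eq (f := fun y : A => y * e) (by fun_prop) continuous_id

theorem fixedSubmodule_le {e : A} (he : e ∈ pedersenIdeal A) :
    fixedSubmodule e ≤ pedersenIdeal A := fun y hy => by
  have h : y * e = y := hy
  rw [← h]; exact mul_mem_pedersenIdeal _ he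

/-- By the closed graph theorem, multipliers are bounded on the set of all `y` with `y * e = y`,
where `e` lies in the Pedersen ideal. -/
theorem exists_bound (m : PedersenMultiplier A) {e : A} (he : e ∈ pedersenIdeal A) :
    ∃ C, 0 ≤ C ∧ ∀ y : pedersenIdeal A, (y : A) * e = y → ‖(m.left y : A)‖ ≤ C * ‖(y : A)‖ := by
  let V : Submodule ℂ A := fixedSubmodule e
  have : CompleteSpace V := (isClosed_fixedSubmodule e).completeSpace_coe
  have hVK : ∀ y : V, (y : A) ∈ pedersenIdeal A := fun y => fixedSubmodule_le he y.2
  let g : V →ₗ[ℂ] A :=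
    { toFun := fun y => (m.left ⟨y, hVK y⟩ : A)
      map_add' := fun x y => by
        rw [← Submodule.coe_add, ← map_add]; rfl
      map_smul' := fun c y => by
        rw [RingHom.id_apply, ← Submodule.coe_smul, ← map_smul]; rfl }
  have hg : Continuous g := by
    refine g.continuous_of_seq_closed_graph fun u x y hu hy => ?_
    refine eq_of_pedersenIdeal_mul fun w => ?_
    refine tendsto_nhds_unique (hy.const_mul (w : A)) ?_
    have h1 : Tendsto (fun k => (m.right w : A) * (u k : A)) atTop (𝓝 ((m.right w : A) * x)) :=
      ((continuous_subtype_val.tendsto x).comp hu).const_mul _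
    refine (h1.congr fun k => ?_).trans_eq ?_
    · exact (m.central w ⟨u k, hVK _⟩).symm
    · exact congrArg 𝓝 (m.central w ⟨x, hVK _⟩).symm
  let G : V →L[ℂ] A := ⟨g, hg⟩
  exact ⟨‖G‖, G.opNorm_nonneg, fun y hy => G.le_opNorm ⟨y, hy⟩⟩

end PedersenMultiplier

namespace LocalUnits

open PedersenMultiplier

variable (L : LocalUnits A)

/-- The element `x * e n` of the Pedersen ideal. -/
def elt (n : ℕ) (x : A) : pedersenIdeal A :=
  ⟨x * L.e n, mul_mem_pedersenIdeal x (L.mem_pedersenIdeal n)⟩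

@[simp] theorem coe_elt (n : ℕ) (x : A) : (L.elt n x : A) = x * L.e n := rfl

theorem elt_eq {n : ℕ} (x : A) : L.elt n x = L.elt (n + 1) (x * L.e n) :=
  Subtype.ext (by rw [coe_elt, coe_elt, mul_assoc, L.mul_eq' n.lt_succ_self])

theorem elt_mul {n : ℕ} (x : A) : (L.elt n x : A) * L.e (n + 1) = L.elt n x := by
  rw [coe_elt, mul_assoc, L.mul_eq' n.lt_succ_self]

/-- The left component of a multiplier maps `A * e n` to itself. -/
theorem left_elt (m : PedersenMultiplier A) (n : ℕ) (x : A) :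
    m.left (L.elt n x) = L.elt n (m.left (L.elt (n + 1) x)) := by
  refine Subtype.ext ?_
  rw [coe_elt, ← m.left_mul_elem (L.elt (n + 1) x).2 _ (pedersenIdeal_mul_mem _ (Subtype.prop _))]
  congr 2
  refine Subtype.ext ?_
  simp only [coe_elt]
  rw [mul_assoc, L.mul_eq _ _ n.lt_succ_self]

theorem left_elt_mul (m : PedersenMultiplier A) (n : ℕ) (x : A) :
    (m.left (L.elt n x) : A) * L.e (n + 1) = m.left (L.elt n x) := by
  rw [left_elt, elt_mul]

/-- The norm of the left component of a multiplier, restricted to `A * e n`. -/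
def opNorm (n : ℕ) (m : PedersenMultiplier A) : ℝ :=
  sInf {C | 0 ≤ C ∧ ∀ x, ‖(m.left (L.elt n x) : A)‖ ≤ C * ‖(L.elt n x : A)‖}

theorem opNorm_le {n : ℕ} {m : PedersenMultiplier A} {C : ℝ} (hC : 0 ≤ C)
    (h : ∀ x, ‖(m.left (L.elt n x) : A)‖ ≤ C * ‖(L.elt n x : A)‖) : L.opNorm n m ≤ C :=
  csInf_le ⟨0, fun _ hC => hC.1⟩ ⟨hC, h⟩

theorem bounds_nonempty (n : ℕ) (m : PedersenMultiplier A) :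
    {C : ℝ | 0 ≤ C ∧ ∀ x, ‖(m.left (L.elt n x) : A)‖ ≤ C * ‖(L.elt n x : A)‖}.Nonempty := by
  obtain ⟨C, hC, h⟩ := m.exists_bound (L.mem_pedersenIdeal (n + 1))
  exact ⟨C, hC, fun x => h _ (L.elt_mul x)⟩

theorem opNorm_nonneg (n : ℕ) (m : PedersenMultiplier A) : 0 ≤ L.opNorm n m :=
  le_csInf (L.bounds_nonempty n m) fun _ hC => hC.1

theorem norm_left_elt_le (n : ℕ) (m : PedersenMultiplier A) (x : A) :
    ‖(m.left (L.elt n x) : A)‖ ≤ L.opNorm n m * ‖(L.elt n x : A)‖ := by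
  rcases (norm_nonneg (L.elt n x : A)).eq_or_lt with h | h
  · have h0 : L.elt n x = 0 := Subtype.ext (norm_eq_zero.1 h.symm)
    simp [h0]
  · rw [← div_le_iff₀ h]
    exact le_csInf (L.bounds_nonempty n m) fun C hC => (div_le_iff₀ h).2 (hC.2 x)

/-- The C*-seminorms which define the projective topology. -/
def seminorm (n : ℕ) : CStarSeminorm (PedersenMultiplier A) where
  toSeminorm := Seminorm.ofSMulLE (L.opNorm n)
    (le_antisymm (L.opNorm_le le_rfl fun x => by
      have : (0 : PedersenMultiplier A).left (L.elt n x) = 0 := rfl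
      simp [this]) (L.opNorm_nonneg _ _))
    (fun a b => L.opNorm_le (add_nonneg (L.opNorm_nonneg _ _) (L.opNorm_nonneg _ _)) fun x => by
      rw [left_add, Submodule.coe_add, add_mul]
      exact (norm_add_le _ _).trans (add_le_add (L.norm_left_elt_le _ _ _)
        (L.norm_left_elt_le _ _ _)))
    (fun c a => L.opNorm_le (mul_nonneg (norm_nonneg _) (L.opNorm_nonneg _ _)) fun x => by
      rw [left_smul, Submodule.coe_smul, norm_smul, mul_assoc]
      exact mul_le_mul_of_nonneg_left (L.norm_left_elt_le _ _ _) (norm_nonneg _))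
  mul_le' a b := L.opNorm_le (mul_nonneg (L.opNorm_nonneg _ _) (L.opNorm_nonneg _ _)) fun x => by
    rw [left_mul, L.left_elt b]
    refine (L.norm_left_elt_le _ _ _).trans ?_
    rw [← L.left_elt b, mul_assoc]
    exact mul_le_mul_of_nonneg_left (L.norm_left_elt_le _ _ _) (L.opNorm_nonneg _ _)
  sq_le' a := by
    have h : L.opNorm n a ≤ √(L.opNorm n (star a * a)) := L.opNorm_le (by positivity) fun x => by
      refine abs_le_of_sq_le_sq' ?_ (by positivity) |>.2
      rw [mul_pow, Real.sq_sqrt (L.opNorm_nonneg _ _), sq, sq]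
      refine (norm_left_sq_le _ _).trans ?_
      calc _ ≤ ‖(L.elt n x : A)‖ * (L.opNorm n (star a * a) * ‖(L.elt n x : A)‖) :=
            mul_le_mul_of_nonneg_left (L.norm_left_elt_le _ _ _) (norm_nonneg _)
        _ = _ := by ring
    have h2 := mul_self_le_mul_self (L.opNorm_nonneg n a) h
    rwa [Real.mul_self_sqrt (L.opNorm_nonneg _ _)] at h2

theorem seminorm_apply (n : ℕ) (m : PedersenMultiplier A) : L.seminorm n m = L.opNorm n m := rfl

theorem seminorm_le {n : ℕ} {m : PedersenMultiplier A} {C : ℝ} (hC : 0 ≤ C)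
    (h : ∀ x, ‖(m.left (L.elt n x) : A)‖ ≤ C * ‖(L.elt n x : A)‖) : L.seminorm n m ≤ C :=
  L.opNorm_le hC h

theorem seminorm_mono (n : ℕ) (m : PedersenMultiplier A) :
    L.seminorm n m ≤ L.seminorm (n + 1) m :=
  L.seminorm_le ((L.seminorm (n + 1)).nonneg m) fun x => by
    rw [elt_eq]; exact L.norm_left_elt_le _ _ _

theorem ideal_le_pedersenIdeal (n : ℕ) : L.ideal n ≤ pedersenIdeal A := by
  refine Submodule.span_le.2 ?_
  rintro _ ⟨a, b, rfl⟩
  exact pedersenIdeal_mul_mem _ (mul_mem_pedersenIdeal _ (L.mem_pedersenIdeal n))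

/-- A first bound on the ideal generated by `e n`, with a factor which depends on a representation
of `y` as a sum of products `a * e n * b`, but not on the multiplier. -/
theorem exists_norm_left_le {n : ℕ} {y : A} (hy : y ∈ L.ideal n) :
    ∃ C, 0 ≤ C ∧ ∀ (m : PedersenMultiplier A) (hy' : y ∈ pedersenIdeal A),
      ‖(m.left ⟨y, hy'⟩ : A)‖ ≤ C * L.seminorm n m := by
  induction hy using Submodule.span_induction with
  | mem x hx =>
    obtain ⟨a, b, rfl⟩ := hx
    refine ⟨‖(L.elt n a : A)‖ * ‖b‖, by positivity, fun m hy' => ?_⟩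
    have e : (m.left ⟨a * L.e n * b, hy'⟩ : A) = m.left (L.elt n a) * b :=
      m.left_mul_elem (L.elt n a).2 b hy'
    rw [e]
    refine (norm_mul_le _ _).trans ?_
    calc _ ≤ (L.opNorm n m * ‖(L.elt n a : A)‖) * ‖b‖ :=
          mul_le_mul_of_nonneg_right (L.norm_left_elt_le _ _ _) (norm_nonneg _)
      _ = _ := by rw [seminorm_apply]; ring
  | zero =>
    refine ⟨0, le_rfl, fun m hy' => ?_⟩
    have : (⟨0, hy'⟩ : pedersenIdeal A) = 0 := rfl
    simp [this]
  | add x y hx hy hx' hy' =>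
    obtain ⟨C, hC, h⟩ := hx'
    obtain ⟨D, hD, h'⟩ := hy'
    refine ⟨C + D, by positivity, fun m hxy => ?_⟩
    have hx := L.ideal_le_pedersenIdeal n hx
    have hy := L.ideal_le_pedersenIdeal n hy
    have e : (⟨x + y, hxy⟩ : pedersenIdeal A) = ⟨x, hx⟩ + ⟨y, hy⟩ := rfl
    rw [e, map_add, Submodule.coe_add, add_mul]
    exact (norm_add_le _ _).trans (add_le_add (h m hx) (h' m hy))
  | smul c x hx hx' =>
    obtain ⟨C, hC, h⟩ := hx'
    refine ⟨‖c‖ * C, by positivity, fun m hxy => ?_⟩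
    have hx := L.ideal_le_pedersenIdeal n hx
    have e : (⟨c • x, hxy⟩ : pedersenIdeal A) = c • ⟨x, hx⟩ := rfl
    rw [e, map_smul, Submodule.coe_smul, norm_smul, mul_assoc]
    exact mul_le_mul_of_nonneg_left (h m hx) (norm_nonneg _)

theorem le_of_pow_two_pow_le {s q D : ℝ} (hq : 0 ≤ q)
    (h : ∀ k : ℕ, s ^ 2 ^ k ≤ D * q ^ 2 ^ k) : s ≤ q := by
  by_contra! hlt
  have hs0 : 0 < s := hq.trans_lt hlt
  have h1 : Tendsto (fun k : ℕ => D * (q / s) ^ 2 ^ k) atTop (𝓝 (D * 0)) :=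
    ((tendsto_pow_atTop_nhds_zero_of_lt_one (by positivity) ((div_lt_one hs0).2 hlt)).comp
      (tendsto_pow_atTop_atTop_of_one_lt (one_lt_two (α := ℕ)))).const_mul D
  have h2 := ge_of_tendsto' h1 (b := 1) fun k => by
    rw [div_pow, ← mul_div_assoc, le_div_iff₀ (by positivity), one_mul]; exact h k
  norm_num at h2

/-- The `n`-th seminorm controls the multipliers on the whole ideal generated by `e n`. By
`exists_norm_left_le` this holds up to a factor which depends on `y`; the factor is removed by
applying the C*-identity to the powers of `m* m`. -/
theorem norm_left_le {n : ℕ} (y : pedersenIdeal A) (hy : (y : A) ∈ L.ideal n)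
    (m : PedersenMultiplier A) : ‖(m.left y : A)‖ ≤ L.seminorm n m * ‖(y : A)‖ := by
  obtain ⟨C, hC, h⟩ := L.exists_norm_left_le hy
  rcases (norm_nonneg (y : A)).eq_or_lt with h0 | h0
  · have h0 : y = 0 := Subtype.ext (norm_eq_zero.1 h0.symm)
    simp [h0]
  set c := star m * m with hc
  have hcs : ∀ k : ℕ, star (c ^ 2 ^ k) = c ^ 2 ^ k := fun k => by
    rw [star_pow, hc, star_mul, star_star]
  have hq : ∀ k : ℕ, L.seminorm n (c ^ 2 ^ k) ≤ L.seminorm n c ^ 2 ^ k := by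
    intro k
    induction k with
    | zero => simp
    | succ k ih =>
      rw [pow_succ, pow_mul, pow_mul, sq, sq]
      exact ((L.seminorm n).mul_le _ _).trans (mul_self_le_mul_self ((L.seminorm n).nonneg _) ih)
  have ht : ∀ k : ℕ, (‖(c.left y : A)‖ / ‖(y : A)‖) ^ 2 ^ k
      ≤ ‖((c ^ 2 ^ k).left y : A)‖ / ‖(y : A)‖ := by
    intro k
    induction k with
    | zero => simp
    | succ k ih =>
      have h1 := norm_left_sq_le (c ^ 2 ^ k) y
      rw [hcs, ← sq (c ^ 2 ^ k), ← pow_mul] at h1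
      rw [pow_succ, pow_mul, sq]
      refine (mul_self_le_mul_self (by positivity) ih).trans ?_
      rw [div_mul_div_comm, div_le_div_iff₀ (by positivity) h0]
      nlinarith
  have h1 : ‖(c.left y : A)‖ / ‖(y : A)‖ ≤ L.seminorm n c := by
    refine le_of_pow_two_pow_le (D := C / ‖(y : A)‖) ((L.seminorm n).nonneg _)
      fun k => (ht k).trans ?_
    rw [div_mul_eq_mul_div]
    refine div_le_div_of_nonneg_right ((h _ y.2).trans ?_) h0.le
    exact mul_le_mul_of_nonneg_left (hq k) hC
  rw [div_le_iff₀ h0] at h1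
  refine abs_le_of_sq_le_sq' ?_ (mul_nonneg ((L.seminorm n).nonneg _) h0.le) |>.2
  rw [sq, sq]
  calc _ ≤ ‖(y : A)‖ * ‖(c.left y : A)‖ := norm_left_sq_le m y
    _ ≤ ‖(y : A)‖ * (L.seminorm n c * ‖(y : A)‖) := mul_le_mul_of_nonneg_left h1 h0.le
    _ ≤ ‖(y : A)‖ * ((L.seminorm n m * L.seminorm n m) * ‖(y : A)‖) := by
      have h2 := (L.seminorm n).mul_le (star m) m
      rw [CStarSeminorm.apply_star] at h2
      gcongr
    _ = _ := by ring

theorem seminorm_separating (m : PedersenMultiplier A) (h : ∀ n, L.seminorm n m = 0) : m = 0 :=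
  ext_left fun y => by
    obtain ⟨n, hn⟩ := L.exists_mem_ideal y.2
    have h1 := L.norm_left_le y hn m
    rw [h, zero_mul, norm_le_zero_iff] at h1
    exact Subtype.ext h1

end LocalUnits

end GammaSeminorms

/-! ### `Γ(K(A))` is a locally compact σ-C*-algebra -/

section GammaTopology

variable {A : Type u} [NonUnitalCStarAlgebra A]

/-- Convergence for the projective topology, in terms of norms. -/
theorem PedersenMultiplier.tendsto_iff {ι : Type*} {l : Filter ι} {F : ι → PedersenMultiplier A}
    {m : PedersenMultiplier A} : Tendsto F l (𝓝 m) ↔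
      ∀ b : A, star b * b ∈ pedersenIdeal A → ∀ ε > 0, ∀ᶠ i in l, ∀ y ∈ leftIdealBall (star b * b),
        ‖((F i - m).left y : A)‖ < ε := by
  rw [nhds_induced, tendsto_comap_iff, UniformOnFun.tendsto_iff_tendstoUniformlyOn]
  constructor
  · intro h b hb ε hε
    filter_upwards [Metric.tendstoUniformlyOn_iff.1 (h _ ⟨b, hb, rfl⟩) ε hε] with i hi y hy
    have := hi y hy
    rwa [dist_comm, dist_eq_norm] at this
  · rintro h _ ⟨b, hb, rfl⟩
    refine Metric.tendstoUniformlyOn_iff.2 fun ε hε => ?_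
    filter_upwards [h b hb ε hε] with i hi y hy
    rw [dist_comm, dist_eq_norm]
    exact hi y hy

namespace LocalUnits

open PedersenMultiplier

variable (L : LocalUnits A)

theorem seminorm_le_of_unitBall {n : ℕ} {m : PedersenMultiplier A} {C : ℝ} (hC : 0 ≤ C)
    (h : ∀ x, ‖(L.elt n x : A)‖ ≤ 1 → ‖(m.left (L.elt n x) : A)‖ ≤ C) : L.seminorm n m ≤ C := by
  refine L.seminorm_le hC fun x => ?_
  rcases (norm_nonneg (L.elt n x : A)).eq_or_lt with h0 | h0
  · have h0 : L.elt n x = 0 := Subtype.ext (norm_eq_zero.1 h0.symm)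
    simp [h0]
  · have e : L.elt n ((‖(L.elt n x : A)‖⁻¹ : ℂ) • x) = (‖(L.elt n x : A)‖⁻¹ : ℂ) • L.elt n x :=
      Subtype.ext (by simp [smul_mul_assoc])
    have h1 := h ((‖(L.elt n x : A)‖⁻¹ : ℂ) • x) (by
      rw [e, Submodule.coe_smul, norm_smul, norm_inv, Complex.norm_real, norm_norm,
        inv_mul_cancel₀ h0.ne'])
    rwa [e, map_smul, Submodule.coe_smul, norm_smul, norm_inv, Complex.norm_real, norm_norm,
      inv_mul_le_iff₀ h0, mul_comm] at h1

theorem seminorm_le_of_leftIdealBall {n : ℕ} {m : PedersenMultiplier A} {C : ℝ} (hC : 0 ≤ C)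
    (h : ∀ y ∈ leftIdealBall (L.e n), ‖(m.left y : A)‖ ≤ C) : L.seminorm n m ≤ C :=
  L.seminorm_le_of_unitBall hC fun x hx => h _ ⟨subset_closure ⟨x, rfl⟩, hx⟩

theorem norm_left_le_of_mem_leftIdealBall {n : ℕ} {a : A} (ha : a ∈ L.ideal n)
    {y : pedersenIdeal A} (hy : y ∈ leftIdealBall a) (m : PedersenMultiplier A) :
    ‖(m.left y : A)‖ ≤ L.seminorm n m := by
  obtain ⟨u, hu, hu'⟩ := mem_closure_iff_seq_limit.1 hy.1
  choose x hx using hu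
  simp only at hx
  have hK : ∀ k, x k * a ∈ L.ideal n := fun k => L.mul_mem_ideal _ ha
  refine (m.norm_left_le_of_tendsto (u := fun k => ⟨x k * a, L.ideal_le_pedersenIdeal n (hK k)⟩)
    (by simpa only [hx] using hu') (c := fun k => L.seminorm n m * ‖x k * a‖) ?_
    (fun k => L.norm_left_le _ (hK k) m)).trans
    (mul_le_of_le_one_right ((L.seminorm n).nonneg m) hy.2)
  simpa only [hx] using (hu'.norm.const_mul (L.seminorm n m))

theorem tendsto_iff {ι : Type*} {l : Filter ι} {F : ι → PedersenMultiplier A}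
    {m : PedersenMultiplier A} : Tendsto F l (𝓝 m) ↔
      ∀ n, Tendsto (fun i => L.seminorm n (F i - m)) l (𝓝 0) := by
  rw [PedersenMultiplier.tendsto_iff]
  constructor
  · intro h n
    obtain ⟨b, hb⟩ := L.exists_sqrt n
    refine tendsto_order.2 ⟨fun c hc => Eventually.of_forall fun i =>
      hc.trans_le ((L.seminorm n).nonneg _), fun ε hε => ?_⟩
    filter_upwards [h b (hb ▸ L.mem_pedersenIdeal n) (ε / 2) (half_pos hε)] with i hi
    refine (L.seminorm_le_of_leftIdealBall (half_pos hε).le fun y hy => ?_).trans_lt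
      (half_lt_self hε)
    exact (hi y (hb ▸ hy)).le
  · intro h b hb ε hε
    obtain ⟨n, hn⟩ := L.exists_mem_ideal hb
    filter_upwards [(h n).eventually (gt_mem_nhds hε)] with i hi y hy
    exact (L.norm_left_le_of_mem_leftIdealBall hn hy _).trans_lt hi

theorem topology_eq :
    (inferInstance : TopologicalSpace (PedersenMultiplier A)) =
      ⨅ n, TopologicalSpace.induced (L.seminorm n).hom inferInstance := by
  refine TopologicalSpace.ext_nhds fun m => ?_
  have e : @nhds _ (⨅ n, TopologicalSpace.induced (L.seminorm n).hom inferInstance) m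
      = ⨅ n, comap (L.seminorm n).hom (𝓝 ((L.seminorm n).hom m)) := by
    rw [nhds_iInf]
    exact iInf_congr fun n => nhds_induced _ _
  rw [e]
  refine eq_of_forall_le_iff fun l => ?_
  have h := L.tendsto_iff (F := id) (l := l) (m := m)
  rw [Tendsto, map_id] at h
  refine h.trans ?_
  rw [le_iInf_iff]
  refine forall_congr' fun n => ?_
  rw [← tendsto_iff_comap]
  refine Iff.trans ?_ tendsto_iff_norm_sub_tendsto_zero.symm
  simp only [← map_sub, CStarSeminorm.norm_hom, id]

/-- A pointwise limit of left components takes values in the Pedersen ideal, since the images of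
`x * e n` are fixed under multiplication by `e (n + 1)`. -/
theorem exists_left_limit (L : LocalUnits A) {ι : Type*} {l : Filter ι} [l.NeBot]
    {F : ι → PedersenMultiplier A}
    (h : ∀ x : pedersenIdeal A, ∃ z : A, Tendsto (fun i => ((F i).left x : A)) l (𝓝 z))
    (x : pedersenIdeal A) :
    ∃ z : pedersenIdeal A, Tendsto (fun i => ((F i).left x : A)) l (𝓝 (z : A)) := by
  obtain ⟨n, hn⟩ := L.exists_mem_ideal x.2
  suffices H : ∀ x ∈ L.ideal n, ∀ hx : x ∈ pedersenIdeal A, ∃ z : pedersenIdeal A,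
      Tendsto (fun i => ((F i).left ⟨x, hx⟩ : A)) l (𝓝 (z : A)) from H x hn x.2
  clear hn x
  intro x hx
  induction hx using Submodule.span_induction with
  | mem x hx =>
    obtain ⟨a, b, rfl⟩ := hx
    intro hx
    obtain ⟨z, hz⟩ := h (L.elt n a)
    have hz' : z * L.e (n + 1) = z := by
      refine tendsto_nhds_unique (hz.mul_const _) ?_
      simpa only [left_elt_mul] using hz
    have hzK : z ∈ pedersenIdeal A := by
      rw [← hz']; exact mul_mem_pedersenIdeal _ (L.mem_pedersenIdeal _)
    refine ⟨⟨z * b, pedersenIdeal_mul_mem _ hzK⟩, (hz.mul_const b).congr fun i => ?_⟩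
    exact ((F i).left_mul_elem (L.elt n a).2 b hx).symm
  | zero =>
    intro hx
    refine ⟨0, ?_⟩
    have : ∀ i, (F i).left ⟨0, hx⟩ = 0 := fun i => map_zero (F i).left
    simp [this]
  | add x y hx hy hx' hy' =>
    intro hxy
    have hx := L.ideal_le_pedersenIdeal n hx
    have hy := L.ideal_le_pedersenIdeal n hy
    obtain ⟨z, hz⟩ := hx' hx
    obtain ⟨w, hw⟩ := hy' hy
    refine ⟨z + w, (hz.add hw).congr fun i => ?_⟩
    rw [← Submodule.coe_add, ← map_add]; rfl
  | smul c x hx hx' =>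
    intro hxy
    have hx := L.ideal_le_pedersenIdeal n hx
    obtain ⟨z, hz⟩ := hx' hx
    refine ⟨c • z, (hz.const_smul c).congr fun i => ?_⟩
    rw [← Submodule.coe_smul, ← map_smul]; rfl

/-- `Γ(K(A))` is complete for the topology of pointwise convergence of both components. -/
theorem exists_limit (L : LocalUnits A) {ι : Type*} {l : Filter ι} [l.NeBot]
    {F : ι → PedersenMultiplier A}
    (h : ∀ x : pedersenIdeal A, ∃ z : A, Tendsto (fun i => ((F i).left x : A)) l (𝓝 z))
    (h' : ∀ x : pedersenIdeal A, ∃ z : A, Tendsto (fun i => ((F i).right x : A)) l (𝓝 z)) :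
    ∃ m : PedersenMultiplier A, ∀ x,
      Tendsto (fun i => ((F i).left x : A)) l (𝓝 (m.left x : A)) ∧
        Tendsto (fun i => ((F i).right x : A)) l (𝓝 (m.right x : A)) := by
  choose S hS using L.exists_left_limit h
  have h2 : ∀ x : pedersenIdeal A, ∃ z : pedersenIdeal A,
      Tendsto (fun i => ((F i).right x : A)) l (𝓝 (z : A)) := fun x => by
    have h3 : ∀ x : pedersenIdeal A, ∃ z : A,
        Tendsto (fun i => ((star (F i)).left x : A)) l (𝓝 z) := fun x => by
      obtain ⟨z, hz⟩ := h' ⟨star (x : A), star_mem_pedersenIdeal x.2⟩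
      exact ⟨star z, by simpa using hz.star⟩
    obtain ⟨z, hz⟩ := L.exists_left_limit h3 ⟨star (x : A), star_mem_pedersenIdeal x.2⟩
    exact ⟨⟨star (z : A), star_mem_pedersenIdeal z.2⟩, by simpa using hz.star⟩
  choose T hT using h2
  refine ⟨PedersenMultiplier.mk'
    { toFun := S
      map_add' := fun x y => Subtype.ext (tendsto_nhds_unique (hS (x + y))
        (by simpa using (hS x).add (hS y)))
      map_smul' := fun c x => Subtype.ext (tendsto_nhds_unique (hS (c • x))
        (by simpa using (hS x).const_smul c)) }
    { toFun := T
      map_add' := fun x y => Subtype.ext (tendsto_nhds_unique (hT (x + y))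
        (by simpa using (hT x).add (hT y)))
      map_smul' := fun c x => Subtype.ext (tendsto_nhds_unique (hT (c • x))
        (by simpa using (hT x).const_smul c)) }
    fun x y => ?_, fun x => ⟨hS x, hT x⟩⟩
  refine tendsto_nhds_unique ((hS y).const_mul (x : A)) ?_
  refine ((hT x).mul_const (y : A)).congr fun i => ?_
  exact ((F i).central x y).symm

theorem cauchySeq_left {a : ℕ → PedersenMultiplier A}
    (ha : ∀ n, CauchySeq fun k => (L.seminorm n).hom (a k)) (x : pedersenIdeal A) :
    CauchySeq fun k => ((a k).left x : A) := by
  obtain ⟨n, hn⟩ := L.exists_mem_ideal x.2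
  rw [Metric.cauchySeq_iff]
  intro ε hε
  obtain ⟨N, hN⟩ := Metric.cauchySeq_iff.1 (ha n) (ε / (‖(x : A)‖ + 1)) (by positivity)
  refine ⟨N, fun j hj k hk => ?_⟩
  have h1 := hN j hj k hk
  rw [dist_eq_norm, ← map_sub, CStarSeminorm.norm_hom, lt_div_iff₀ (by positivity)] at h1
  rw [dist_eq_norm, ← Submodule.coe_sub, ← left_sub]
  refine (L.norm_left_le x hn _).trans_lt (lt_of_le_of_lt ?_ h1)
  exact mul_le_mul_of_nonneg_left (by linarith) ((L.seminorm n).nonneg _)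

theorem isSeqComplete : CStarSeminorm.IsSeqComplete L.seminorm := by
  intro a ha
  obtain ⟨b, hb⟩ := L.exists_limit (l := atTop) (F := a)
    (fun x => cauchySeq_tendsto_of_complete (L.cauchySeq_left ha x))
    (fun x => by
      have h1 : ∀ n, CauchySeq fun k => (L.seminorm n).hom (star (a k)) := fun n => by
        simp only [map_star]
        exact (star_isometry (E := (L.seminorm n).Completion)).uniformContinuous.comp_cauchySeq
          (ha n)
      obtain ⟨z, hz⟩ := cauchySeq_tendsto_of_complete
        (L.cauchySeq_left h1 ⟨star (x : A), star_mem_pedersenIdeal x.2⟩)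
      exact ⟨star z, by simpa using hz.star⟩)
  refine ⟨b, fun n => ?_⟩
  rw [Metric.tendsto_atTop]
  intro ε hε
  obtain ⟨N, hN⟩ := Metric.cauchySeq_iff.1 (ha n) (ε / 2) (half_pos hε)
  refine ⟨N, fun k hk => ?_⟩
  rw [dist_eq_norm, ← map_sub, CStarSeminorm.norm_hom]
  refine (L.seminorm_le (half_pos hε).le fun x => ?_).trans_lt (half_lt_self hε)
  have h1 : Tendsto (fun j => ‖((a k - a j).left (L.elt n x) : A)‖) atTop
      (𝓝 ‖((a k - b).left (L.elt n x) : A)‖) := by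
    simp only [left_sub, Submodule.coe_sub]
    exact (tendsto_const_nhds.sub (hb _).1).norm
  refine le_of_tendsto h1 ?_
  filter_upwards [eventually_ge_atTop N] with j hj
  have h2 := hN k hk j hj
  rw [dist_eq_norm, ← map_sub, CStarSeminorm.norm_hom] at h2
  exact (L.norm_left_elt_le _ _ _).trans (mul_le_mul_of_nonneg_right h2.le (norm_nonneg _))

/-- `Γ(K(A))` as the inverse limit of its completions for the seminorms `L.seminorm n`. -/
def presentation : SigmaCStarPresentation (PedersenMultiplier A) :=
  L.isSeqComplete.presentation L.seminorm_mono L.seminorm_separating L.topology_eq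

theorem enorm_proj (n : ℕ) (m : PedersenMultiplier A) :
    ‖L.presentation.proj n m‖ₑ = ENNReal.ofReal (L.seminorm n m) := by
  rw [← ofReal_norm]
  exact congrArg ENNReal.ofReal ((L.seminorm n).norm_hom m)

theorem supNorm_le {m : PedersenMultiplier A} {C : ℝ} (h : ∀ n, L.seminorm n m ≤ C) :
    L.presentation.supNorm m ≤ ENNReal.ofReal C :=
  iSup_le fun n => by rw [enorm_proj]; exact ENNReal.ofReal_le_ofReal (h n)

theorem seminorm_ofElem_le (n : ℕ) (a : A) : L.seminorm n (ofElem A a) ≤ ‖a‖ :=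
  L.seminorm_le (norm_nonneg a) fun _ => norm_mul_le _ _

theorem norm_le_of_seminorm_ofElem_le {k : A} {C : ℝ} (hC : 0 ≤ C)
    (h : ∀ n, L.seminorm n (ofElem A k) ≤ C) : ‖k‖ ≤ C := by
  have h1 : Tendsto (fun n => ‖k * (star k * L.e n)‖) atTop (𝓝 ‖k * star k‖) :=
    ((L.mul_tendsto (star k)).const_mul k).norm
  have h2 : ‖k * star k‖ ≤ C * ‖k‖ := le_of_tendsto' h1 fun n => by
    refine (L.norm_left_elt_le n (ofElem A k) (star k)).trans ?_
    refine mul_le_mul (h n) ?_ (norm_nonneg _) hC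
    refine (norm_mul_le _ _).trans ?_
    rw [norm_star]
    exact mul_le_of_le_one_right (norm_nonneg _) (L.norm_le_one n)
  rw [CStarRing.norm_self_mul_star] at h2
  rcases (norm_nonneg k).eq_or_lt with h0 | h0
  · rwa [← h0]
  · exact le_of_mul_le_mul_right h2 h0

/-- On `A` the possibly infinite norm `‖·‖_∞` of `Γ(K(A))` is the norm of `A`. -/
theorem supNorm_ofElem (k : A) : L.presentation.supNorm (ofElem A k) = ‖k‖ₑ := by
  refine le_antisymm ?_ ?_
  · rw [← ofReal_norm]; exact L.supNorm_le fun n => L.seminorm_ofElem_le n k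
  · by_cases htop : L.presentation.supNorm (ofElem A k) = ⊤
    · rw [htop]; exact le_top
    · rw [← ofReal_norm, ← ENNReal.ofReal_toReal htop]
      refine ENNReal.ofReal_le_ofReal (L.norm_le_of_seminorm_ofElem_le ENNReal.toReal_nonneg
        fun n => ?_)
      have h1 : ‖L.presentation.proj n (ofElem A k)‖ₑ ≤ L.presentation.supNorm (ofElem A k) :=
        le_iSup (fun n => ‖L.presentation.proj n (ofElem A k)‖ₑ) n
      rw [enorm_proj] at h1
      exact (ENNReal.ofReal_le_iff_le_toReal htop).1 h1

end LocalUnits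

namespace PedersenMultiplier

theorem ofElem_add (a b : A) : ofElem A (a + b) = ofElem A a + ofElem A b :=
  ext_left fun x => Subtype.ext (add_mul a b (x : A))

theorem ofElem_sub (a b : A) : ofElem A (a - b) = ofElem A a - ofElem A b :=
  ext_left fun x => Subtype.ext (sub_mul a b (x : A))

theorem ofElem_smul (c : ℂ) (a : A) : ofElem A (c • a) = c • ofElem A a :=
  ext_left fun x => Subtype.ext (smul_mul_assoc c a (x : A))

theorem ofElem_zero : ofElem A 0 = 0 :=
  ext_left fun x => Subtype.ext (zero_mul (x : A))

theorem ofElem_mul (a b : A) : ofElem A (a * b) = ofElem A a * ofElem A b :=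
  ext_left fun x => Subtype.ext (mul_assoc a b (x : A))

theorem ofElem_star (a : A) : ofElem A (star a) = star (ofElem A a) :=
  ext_left fun x => Subtype.ext (by simp)

theorem mul_ofElem (m : PedersenMultiplier A) (k : pedersenIdeal A) :
    m * ofElem A k = ofElem A (m.left k) :=
  ext_left fun x => Subtype.ext (m.left_mul_elem k.2 x _)

theorem ofElem_mul' (m : PedersenMultiplier A) (k : pedersenIdeal A) :
    ofElem A k * m = ofElem A (m.right k) :=
  ext_left fun x => Subtype.ext (m.central k x)

end PedersenMultiplier

namespace LocalUnits

open PedersenMultiplier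

variable (L : LocalUnits A)

theorem supportAlgebra_eq : support A = supportAlgebra fun n => ofElem A (L.e n) := by
  refine Set.Subset.antisymm ?_ (Set.iUnion_subset fun n x hx => ?_)
  · rintro _ ⟨k, hk, rfl⟩
    obtain ⟨n, hn⟩ := L.exists_mem_ideal hk
    refine Set.mem_iUnion.2 ⟨n + 1, ?_⟩
    clear hk
    induction hn using Submodule.span_induction with
    | mem x hx =>
      obtain ⟨a, b, rfl⟩ := hx
      refine Submodule.subset_span ⟨ofElem A a, ofElem A (L.e n * b), ?_⟩
      rw [sq, ← ofElem_mul, ← ofElem_mul, ← ofElem_mul]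
      have h := L.mul_eq n _ n.lt_succ_self
      rw [mul_assoc a (_ * _), mul_assoc (L.e (n + 1)), ← mul_assoc (L.e (n + 1)) (L.e n) b, h,
        ← mul_assoc (L.e (n + 1)) (L.e n) b, h, mul_assoc]
    | zero => rw [ofElem_zero]; exact Submodule.zero_mem _
    | add x y _ _ hx hy => rw [ofElem_add]; exact Submodule.add_mem _ hx hy
    | smul c x _ hx => rw [ofElem_smul]; exact Submodule.smul_mem _ _ hx
  · have hx' : x ∈ Submodule.span ℂ {x : PedersenMultiplier A |
        ∃ a b, x = a * ofElem A (L.e n) ^ 2 * b} := hx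
    clear hx
    induction hx' using Submodule.span_induction with
    | mem x hx =>
      obtain ⟨a, b, rfl⟩ := hx
      have h := mul_mem_pedersenIdeal (L.e n) (L.mem_pedersenIdeal n)
      rw [sq, ← ofElem_mul, mul_ofElem a ⟨_, h⟩, ofElem_mul']
      exact ⟨_, Subtype.prop _, rfl⟩
    | zero => exact ⟨0, zero_mem _, ofElem_zero⟩
    | add x y _ _ hx hy =>
      obtain ⟨k, hk, rfl⟩ := hx
      obtain ⟨k', hk', rfl⟩ := hy
      exact ⟨k + k', add_mem hk hk', ofElem_add _ _⟩
    | smul c x _ hx =>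
      obtain ⟨k, hk, rfl⟩ := hx
      exact ⟨c • k, Submodule.smul_mem _ _ hk, ofElem_smul _ _⟩

theorem isLocallyCompactSigmaCStar (L : LocalUnits A) :
    IsLocallyCompactSigmaCStar (PedersenMultiplier A) (support A) := by
  have hmulR : ∀ (k : pedersenIdeal A) (m : PedersenMultiplier A),
      L.presentation.supNorm (ofElem A k * m) = ‖(m.right k : A)‖ₑ := fun k m => by
    rw [ofElem_mul', supNorm_ofElem]
  have hmulL : ∀ (k : pedersenIdeal A) (m : PedersenMultiplier A),
      L.presentation.supNorm (m * ofElem A k) = ‖(m.left k : A)‖ₑ := fun k m => by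
    rw [mul_ofElem, supNorm_ofElem]
  have hsq : ∀ (n : ℕ) (m : PedersenMultiplier A), ENNReal.ofReal (L.seminorm n m)
      = ENNReal.ofReal (L.seminorm n (star m)) := fun n m => by rw [CStarSeminorm.apply_star]
  refine ⟨L.presentation, fun n => ofElem A (L.e n), fun n => ⟨?_, ?_⟩, fun n a => ⟨?_, ?_⟩,
    fun n m hnm => ?_, L.supportAlgebra_eq, ?_, ?_, fun n a => ⟨?_, ?_⟩⟩
  · obtain ⟨b, hb⟩ := L.exists_sqrt n
    refine ⟨ofElem A b, ?_⟩
    rw [← ofElem_star, ← ofElem_mul, ← hb]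
  · obtain ⟨c, hc, h⟩ := L.exists_sqrt_one_sub n
    refine ⟨1 - ofElem A c, ?_⟩
    beta_reduce
    rw [star_sub, star_one, ← ofElem_star, hc.star_eq, h, ofElem_sub, ofElem_add, ofElem_mul]
    noncomm_ring
  · rw [hmulR ⟨_, L.mem_pedersenIdeal n⟩]; exact enorm_lt_top
  · rw [hmulL ⟨_, L.mem_pedersenIdeal n⟩]; exact enorm_lt_top
  · rw [← ofElem_mul, L.mul_eq n m hnm]
  · rintro _ ⟨k, hk, rfl⟩
    rw [tendsto_map'_iff, tendsto_map'_iff]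
    simp only [Function.comp_def, mul_one, one_mul, ← ofElem_mul, ← ofElem_sub, supNorm_ofElem]
    exact ⟨tendsto_iff_enorm_sub_tendsto_zero.1 (L.mul_tendsto k),
      tendsto_iff_enorm_sub_tendsto_zero.1 (L.tendsto_mul k)⟩
  · rintro l ⟨hl, h⟩
    have h1 : ∀ x : pedersenIdeal A, Tendsto (fun p : PedersenMultiplier A × PedersenMultiplier A =>
        ‖(p.1.left x : A) - p.2.left x‖ₑ) (l ×ˢ l) (𝓝 0) := fun x => by
      have := (h _ ⟨x, x.2, rfl⟩).2
      simpa only [mul_ofElem, ← ofElem_sub, supNorm_ofElem] using this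
    have h2 : ∀ x : pedersenIdeal A, Tendsto (fun p : PedersenMultiplier A × PedersenMultiplier A =>
        ‖(p.1.right x : A) - p.2.right x‖ₑ) (l ×ˢ l) (𝓝 0) := fun x => by
      have := (h _ ⟨x, x.2, rfl⟩).1
      simpa only [ofElem_mul', ← ofElem_sub, supNorm_ofElem] using this
    have h3 : ∀ f : PedersenMultiplier A → A,
        Tendsto (fun p : PedersenMultiplier A × PedersenMultiplier A => ‖f p.1 - f p.2‖ₑ)
          (l ×ˢ l) (𝓝 0) → ∃ z, Tendsto f l (𝓝 z) := by
      intro f hf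
      have hc : Cauchy (map f l) := by
        refine ⟨inferInstance, ?_⟩
        rw [prod_map_map_eq]
        refine tendsto_uniformity_iff_dist_tendsto_zero.2 ?_
        simp only [dist_eq_norm]
        exact (tendsto_zero_iff_norm_tendsto_zero).1 (tendsto_zero_iff_enorm_tendsto_zero.2 hf)
      exact CompleteSpace.complete hc
    obtain ⟨m, hm⟩ := L.exists_limit (F := id) (l := l) (fun x => h3 _ (h1 x))
      (fun x => h3 _ (h2 x))
    refine ⟨m, ?_⟩
    rintro _ ⟨k, hk, rfl⟩
    lift k to pedersenIdeal A using hk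
    simp only [mul_ofElem, ofElem_mul', ← ofElem_sub, supNorm_ofElem]
    exact ⟨tendsto_iff_enorm_sub_tendsto_zero.1 (hm k).2,
      tendsto_iff_enorm_sub_tendsto_zero.1 (hm k).1⟩
  · -- `e n * a` is, up to the involution, the value of `star a` at `e n = e (n + 1) * e n`
    rw [enorm_proj, hmulR ⟨_, L.mem_pedersenIdeal n⟩, hsq, ← ofReal_norm]
    refine ENNReal.ofReal_le_ofReal ?_
    have h := L.norm_left_elt_le n (star a) (L.e (n + 1))
    have e : L.elt n (L.e (n + 1)) = ⟨L.e n, L.mem_pedersenIdeal n⟩ :=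
      Subtype.ext (L.mul_eq _ _ n.lt_succ_self)
    rw [e] at h
    have h2 := h.trans (mul_le_of_le_one_right ((L.seminorm n).nonneg _) (L.norm_le_one n))
    refine le_of_eq_of_le ?_ h2
    simp [(L.isSelfAdjoint n).star_eq]
  · rw [enorm_proj, hsq]
    set C := ⨆ (b : PedersenMultiplier A) (_ : L.presentation.supNorm (ofElem A (L.e n) * b) ≤ 1),
      L.presentation.supNorm (ofElem A (L.e n) * b * a) with hC
    by_cases htop : C = ⊤
    · rw [htop]; exact le_top
    rw [← ENNReal.ofReal_toReal htop]
    refine ENNReal.ofReal_le_ofReal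
      (L.seminorm_le_of_unitBall ENNReal.toReal_nonneg fun x hx => ?_)
    have h := star_mem_pedersenIdeal (L.elt n x).2
    have e : ofElem A (L.e n) * ofElem A (star x) = ofElem A (star (L.elt n x : A)) := by
      rw [← ofElem_mul, coe_elt, star_mul, (L.isSelfAdjoint n).star_eq]
    have h1 : L.presentation.supNorm (ofElem A (L.e n) * ofElem A (star x) * a) ≤ C := by
      refine le_iSup₂_of_le (f := fun (b : PedersenMultiplier A)
        (_ : L.presentation.supNorm (ofElem A (L.e n) * b) ≤ 1) =>
          L.presentation.supNorm (ofElem A (L.e n) * b * a)) (ofElem A (star x)) ?_ le_rfl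
      rw [e, supNorm_ofElem, ← ofReal_norm, norm_star]
      exact ENNReal.ofReal_le_one.2 hx
    rw [e, hmulR ⟨_, h⟩, ← ofReal_norm] at h1
    simpa using (ENNReal.ofReal_le_iff_le_toReal htop).1 h1

end LocalUnits

end GammaTopology

/-! ### Extension of strictly nondegenerate morphisms -/

section Multipliers

variable {A B : Type u} [NonUnitalCStarAlgebra A] [NonUnitalCStarAlgebra B]

/-- The Pedersen ideal is idempotent, since its square is a dense ideal. -/
theorem pedersenIdeal_le_span_mul : pedersenIdeal B ≤
    Submodule.span ℂ {z : B | ∃ x ∈ pedersenIdeal B, ∃ y ∈ pedersenIdeal B, z = x * y} := by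
  refine pedersenIdeal_le ⟨fun a x hx => ?_, Dense.of_closure (pedersenIdeal_dense.mono ?_)⟩
  · induction hx using Submodule.span_induction with
    | mem z hz =>
      obtain ⟨x, hx, y, hy, rfl⟩ := hz
      exact ⟨Submodule.subset_span ⟨a * x, mul_mem_pedersenIdeal a hx, y, hy, by rw [mul_assoc]⟩,
        Submodule.subset_span ⟨x, hx, y * a, pedersenIdeal_mul_mem a hy, by rw [mul_assoc]⟩⟩
    | zero => simp
    | add x y _ _ hx hy =>
      rw [mul_add, add_mul]
      exact ⟨Submodule.add_mem _ hx.1 hy.1, Submodule.add_mem _ hx.2 hy.2⟩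
    | smul c x _ hx =>
      rw [mul_smul_comm, smul_mul_assoc]
      exact ⟨Submodule.smul_mem _ _ hx.1, Submodule.smul_mem _ _ hx.2⟩
  · intro x hx
    obtain ⟨l, hl, -, -, hR⟩ := exists_approximateUnit B
    refine isClosed_closure.mem_of_tendsto (hR x) (Eventually.of_forall fun u => ?_)
    refine closure_mono ?_ (image_closure_subset_closure_image (continuous_const_mul x)
      (Set.mem_image_of_mem _ (pedersenIdeal_dense u)))
    rintro _ ⟨y, hy, rfl⟩
    exact Submodule.subset_span ⟨x, hx, y, hy, rfl⟩

theorem multiplier_fst_mul (s : 𝓜(ℂ, B)) (x y : B) : s.fst (x * y) = s.fst x * y :=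
  eq_of_pedersenIdeal_mul fun w => by
    rw [← s.central, ← mul_assoc, ← mul_assoc, ← s.central]

theorem fst_mem_pedersenIdeal (s : 𝓜(ℂ, B)) {y : B} (hy : y ∈ pedersenIdeal B) :
    s.fst y ∈ pedersenIdeal B := by
  have h := pedersenIdeal_le_span_mul hy
  clear hy
  induction h using Submodule.span_induction with
  | mem z hz =>
    obtain ⟨x, hx, y, hy, rfl⟩ := hz
    rw [multiplier_fst_mul]; exact mul_mem_pedersenIdeal _ hy
  | zero => simp
  | add x y _ _ hx hy => rw [map_add]; exact add_mem hx hy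
  | smul c x _ hx => rw [map_smul]; exact Submodule.smul_mem _ _ hx

theorem snd_mem_pedersenIdeal (s : 𝓜(ℂ, B)) {y : B} (hy : y ∈ pedersenIdeal B) :
    s.snd y ∈ pedersenIdeal B := by
  have h := star_mem_pedersenIdeal (fst_mem_pedersenIdeal (star s) (star_mem_pedersenIdeal hy))
  simpa [DoubleCentralizer.star_fst] using h

/-- The multiplier algebra of `B` acts on the Pedersen ideal of `B`. -/
def ofMultiplier : 𝓜(ℂ, B) →⋆ₐ[ℂ] PedersenMultiplier B where
  toFun s := PedersenMultiplier.mk'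
    { toFun := fun y => ⟨s.fst y, fst_mem_pedersenIdeal s y.2⟩
      map_add' := fun x y => Subtype.ext (map_add s.fst (x : B) y)
      map_smul' := fun c x => Subtype.ext (map_smul s.fst c (x : B)) }
    { toFun := fun y => ⟨s.snd y, snd_mem_pedersenIdeal s y.2⟩
      map_add' := fun x y => Subtype.ext (map_add s.snd (x : B) y)
      map_smul' := fun c x => Subtype.ext (map_smul s.snd c (x : B)) }
    fun x y => (s.central _ _).symm
  map_one' := rfl
  map_mul' _ _ := rfl
  map_zero' := rfl
  map_add' _ _ := rfl
  commutes' c := PedersenMultiplier.ext_left fun x => Subtype.ext (by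
    simp [Algebra.algebraMap_eq_smul_one])
  map_star' s := PedersenMultiplier.ext_left fun x => Subtype.ext (by
    simp [DoubleCentralizer.star_fst])

@[simp] theorem coe_left_ofMultiplier (s : 𝓜(ℂ, B)) (y : pedersenIdeal B) :
    ((ofMultiplier s).left y : B) = s.fst y := rfl

theorem ofMultiplier_coe (b : B) :
    ofMultiplier (b : 𝓜(ℂ, B)) = PedersenMultiplier.ofElem B b :=
  PedersenMultiplier.ext_left fun x => Subtype.ext (by simp)

theorem norm_fst_apply_le (φ : A →⋆ₙₐ[ℂ] 𝓜(ℂ, B)) (a : A) (b : B) :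
    ‖(φ a).fst b‖ ≤ ‖a‖ * ‖b‖ := by
  refine ((φ a).fst.le_opNorm b).trans (mul_le_mul_of_nonneg_right ?_ (norm_nonneg b))
  rw [DoubleCentralizer.norm_fst]
  exact NonUnitalStarAlgHom.norm_apply_le φ a

theorem norm_snd_apply_le (φ : A →⋆ₙₐ[ℂ] 𝓜(ℂ, B)) (a : A) (b : B) :
    ‖(φ a).snd b‖ ≤ ‖a‖ * ‖b‖ := by
  refine ((φ a).snd.le_opNorm b).trans (mul_le_mul_of_nonneg_right ?_ (norm_nonneg b))
  rw [DoubleCentralizer.norm_snd]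
  exact NonUnitalStarAlgHom.norm_apply_le φ a

theorem tendsto_fst_apply {ι : Type*} {l : Filter ι} (φ : A →⋆ₙₐ[ℂ] 𝓜(ℂ, B)) {u : ι → A} {a : A}
    (hu : Tendsto u l (𝓝 a)) (b : B) :
    Tendsto (fun i => (φ (u i)).fst b) l (𝓝 ((φ a).fst b)) := by
  refine tendsto_iff_norm_sub_tendsto_zero.2 (squeeze_zero (fun _ => norm_nonneg _) (fun i => ?_)
    (by simpa using (tendsto_iff_norm_sub_tendsto_zero.1 hu).mul_const ‖b‖))
  simpa using norm_fst_apply_le φ (u i - a) b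

theorem tendsto_snd_apply {ι : Type*} {l : Filter ι} (φ : A →⋆ₙₐ[ℂ] 𝓜(ℂ, B)) {u : ι → A} {a : A}
    (hu : Tendsto u l (𝓝 a)) (b : B) :
    Tendsto (fun i => (φ (u i)).snd b) l (𝓝 ((φ a).snd b)) := by
  refine tendsto_iff_norm_sub_tendsto_zero.2 (squeeze_zero (fun _ => norm_nonneg _) (fun i => ?_)
    (by simpa using (tendsto_iff_norm_sub_tendsto_zero.1 hu).mul_const ‖b‖))
  simpa using norm_snd_apply_le φ (u i - a) b

theorem LocalUnits.tendsto_left_mul (L : LocalUnits A) (m : PedersenMultiplier A)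
    (k : pedersenIdeal A) :
    Tendsto (fun n => (m.left ⟨L.e n, L.mem_pedersenIdeal n⟩ : A) * k) atTop
      (𝓝 (m.left k : A)) := by
  obtain ⟨j, hj⟩ := L.exists_mem_ideal k.2
  refine tendsto_iff_norm_sub_tendsto_zero.2 (squeeze_zero (fun _ => norm_nonneg _) (fun n => ?_)
    (by simpa using
      (tendsto_iff_norm_sub_tendsto_zero.1 (L.tendsto_mul k)).const_mul (L.seminorm j m)))
  have hn : L.e n * k ∈ pedersenIdeal A := mul_mem_pedersenIdeal _ k.2
  have h := L.norm_left_le (⟨L.e n * k, hn⟩ - k) (sub_mem (L.mul_mem_ideal _ hj) hj) m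
  rwa [map_sub, Submodule.coe_sub, m.left_mul_elem (L.mem_pedersenIdeal n)] at h

theorem LocalUnits.tendsto_mul_left (L : LocalUnits A) (m : PedersenMultiplier A)
    (k : pedersenIdeal A) :
    Tendsto (fun n => (k : A) * (m.left ⟨L.e n, L.mem_pedersenIdeal n⟩ : A)) atTop
      (𝓝 (m.right k : A)) := by
  simpa only [m.central] using L.mul_tendsto (m.right k : A)

end Multipliers

section Extension

variable {A B : Type u} [NonUnitalCStarAlgebra A] [NonUnitalCStarAlgebra B]
  {φ : A →⋆ₙₐ[ℂ] 𝓜(ℂ, B)}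

theorem IsStrict.mem_span_fst (hφ : IsStrict φ) {y : B} (hy : y ∈ pedersenIdeal B) :
    y ∈ Submodule.span ℂ {y : B | ∃ k : pedersenIdeal A, ∃ z : pedersenIdeal B,
      y = (φ k).fst z} := by
  have h := pedersenIdeal_le_span_mul hy
  clear hy
  induction h using Submodule.span_induction with
  | mem z hz =>
    obtain ⟨x, hx, y, hy, rfl⟩ := hz
    have h := hφ hx
    clear hx
    induction h using Submodule.span_induction with
    | mem x hx =>
      obtain ⟨k, hk, b, rfl⟩ := hx
      rw [← multiplier_fst_mul]
      exact Submodule.subset_span ⟨⟨k, hk⟩, ⟨b * y, mul_mem_pedersenIdeal _ hy⟩, rfl⟩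
    | zero => simp
    | add x z _ _ hx hz => rw [add_mul]; exact add_mem hx hz
    | smul c x _ hx => rw [smul_mul_assoc]; exact Submodule.smul_mem _ _ hx
  | zero => simp
  | add x y _ _ hx hy => exact add_mem hx hy
  | smul c x _ hx => exact Submodule.smul_mem _ _ hx

theorem IsStrict.eq_of_mul (hφ : IsStrict φ) {s t : PedersenMultiplier B}
    (h : ∀ k : pedersenIdeal A, s * ofMultiplier (φ k) = t * ofMultiplier (φ k)) : s = t := by
  refine PedersenMultiplier.ext_left fun y => ?_
  suffices H : ∀ y ∈ Submodule.span ℂ {y : B | ∃ k : pedersenIdeal A, ∃ z : pedersenIdeal B,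
      y = (φ k).fst z}, ∃ hy : y ∈ pedersenIdeal B, s.left ⟨y, hy⟩ = t.left ⟨y, hy⟩ from
    (H y (hφ.mem_span_fst y.2)).2
  intro y hy
  induction hy using Submodule.span_induction with
  | mem y hy =>
    obtain ⟨k, z, rfl⟩ := hy
    exact ⟨fst_mem_pedersenIdeal _ z.2, congrArg (fun m => PedersenMultiplier.left m z) (h k)⟩
  | zero => exact ⟨zero_mem _, (map_zero s.left).trans (map_zero t.left).symm⟩
  | add x y _ _ hx hy =>
    obtain ⟨hx, hx'⟩ := hx
    obtain ⟨hy, hy'⟩ := hy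
    have e : (⟨x + y, add_mem hx hy⟩ : pedersenIdeal B) = ⟨x, hx⟩ + ⟨y, hy⟩ := rfl
    exact ⟨add_mem hx hy, by rw [e, map_add, map_add, hx', hy']⟩
  | smul c x _ hx =>
    obtain ⟨hx, hx'⟩ := hx
    have e : (⟨c • x, Submodule.smul_mem _ c hx⟩ : pedersenIdeal B) = c • ⟨x, hx⟩ := rfl
    exact ⟨Submodule.smul_mem _ c hx, by rw [e, map_smul, map_smul, hx']⟩

theorem ofMultiplier_map_star (a : A) : ofMultiplier (φ (star a)) = star (ofMultiplier (φ a)) := by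
  rw [map_star, map_star]

/-- Every `m ∈ Γ(K(A))` has an image in `Γ(K(B))`, the strict limit of the multipliers
`φ (m * e n)`. -/
theorem IsStrict.exists_extension (hφ : IsStrict φ) (LA : LocalUnits A) (LB : LocalUnits B)
    (m : PedersenMultiplier A) : ∃ t : PedersenMultiplier B,
      ∀ k : pedersenIdeal A, t * ofMultiplier (φ k) = ofMultiplier (φ (m.left k)) := by
  set F : ℕ → PedersenMultiplier B := fun n =>
    ofMultiplier (φ (m.left ⟨LA.e n, LA.mem_pedersenIdeal n⟩)) with hF
  have h1 : ∀ (k : pedersenIdeal A) (z : pedersenIdeal B),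
      Tendsto (fun n => ((F n).left ((ofMultiplier (φ k)).left z) : B)) atTop
        (𝓝 ((φ (m.left k)).fst z)) := fun k z => by
    refine (tendsto_fst_apply φ (LA.tendsto_left_mul m k) z).congr fun n => ?_
    rw [map_mul]; rfl
  have h2 : ∀ (k : pedersenIdeal A) (z : pedersenIdeal B),
      Tendsto (fun n => ((F n).right ((ofMultiplier (φ k)).right z) : B)) atTop
        (𝓝 ((φ (m.right k)).snd z)) := fun k z => by
    refine (tendsto_snd_apply φ (LA.tendsto_mul_left m k) z).congr fun n => ?_
    rw [map_mul]; rfl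
  have h3 : ∀ y : pedersenIdeal B, ∃ z : B,
      Tendsto (fun n => ((F n).left y : B)) atTop (𝓝 z) := by
    intro y
    suffices H : ∀ y ∈ Submodule.span ℂ {y : B | ∃ k : pedersenIdeal A, ∃ z : pedersenIdeal B,
        y = (φ k).fst z}, ∃ z : B, Tendsto (fun n =>
          (φ (m.left ⟨LA.e n, LA.mem_pedersenIdeal n⟩)).fst y) atTop (𝓝 z) from
      H y (hφ.mem_span_fst y.2)
    intro y hy
    induction hy using Submodule.span_induction with
    | mem y hy =>
      obtain ⟨k, z, rfl⟩ := hy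
      exact ⟨_, h1 k z⟩
    | zero => exact ⟨0, by simp⟩
    | add x y _ _ hx hy =>
      obtain ⟨z, hz⟩ := hx
      obtain ⟨w, hw⟩ := hy
      exact ⟨z + w, by simpa only [map_add] using hz.add hw⟩
    | smul c x _ hx =>
      obtain ⟨z, hz⟩ := hx
      exact ⟨c • z, by simpa only [map_smul] using hz.const_smul c⟩
  have h4 : ∀ y : pedersenIdeal B, ∃ z : B,
      Tendsto (fun n => ((F n).right y : B)) atTop (𝓝 z) := by
    intro y
    suffices H : ∀ y ∈ Submodule.span ℂ {y : B | ∃ k : pedersenIdeal A, ∃ z : pedersenIdeal B,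
        y = (φ k).fst z}, ∃ z : B, Tendsto (fun n =>
          (φ (m.left ⟨LA.e n, LA.mem_pedersenIdeal n⟩)).snd (star y)) atTop (𝓝 z) by
      have h := H _ (hφ.mem_span_fst (star_mem_pedersenIdeal y.2))
      rw [star_star] at h
      exact h
    intro y hy
    induction hy using Submodule.span_induction with
    | mem y hy =>
      obtain ⟨k, z, rfl⟩ := hy
      have h := h2 ⟨star (k : A), star_mem_pedersenIdeal k.2⟩
        ⟨star (z : B), star_mem_pedersenIdeal z.2⟩
      refine ⟨_, h.congr fun n => ?_⟩
      change (φ _).snd ((φ (star (k : A))).snd (star (z : B))) = _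
      rw [map_star φ, DoubleCentralizer.star_snd, star_star]
    | zero => exact ⟨0, by simp⟩
    | add x y _ _ hx hy =>
      obtain ⟨z, hz⟩ := hx
      obtain ⟨w, hw⟩ := hy
      exact ⟨z + w, by simpa only [map_add, star_add] using hz.add hw⟩
    | smul c x _ hx =>
      obtain ⟨z, hz⟩ := hx
      exact ⟨star c • z, by simpa only [map_smul, star_smul] using hz.const_smul (star c)⟩
  obtain ⟨t, ht⟩ := LB.exists_limit h3 h4
  refine ⟨t, fun k => PedersenMultiplier.ext_left fun z => Subtype.ext ?_⟩
  exact tendsto_nhds_unique (ht _).1 (h1 k z)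

/-- The value at `m` of the extension of `φ : A → M(B)` to `Γ(K(A)) → Γ(K(B))`. -/
def gammaMapFun (hφ : IsStrict φ) (LA : LocalUnits A) (LB : LocalUnits B)
    (m : PedersenMultiplier A) : PedersenMultiplier B := (hφ.exists_extension LA LB m).choose

theorem gammaMapFun_mul (hφ : IsStrict φ) (LA : LocalUnits A) (LB : LocalUnits B)
    (m : PedersenMultiplier A) (k : pedersenIdeal A) :
    gammaMapFun hφ LA LB m * ofMultiplier (φ k) = ofMultiplier (φ (m.left k)) :=
  (hφ.exists_extension LA LB m).choose_spec k

theorem gammaMapFun_unique (hφ : IsStrict φ) (LA : LocalUnits A) (LB : LocalUnits B)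
    {m : PedersenMultiplier A} {t : PedersenMultiplier B}
    (ht : ∀ k : pedersenIdeal A, t * ofMultiplier (φ k) = ofMultiplier (φ (m.left k))) :
    gammaMapFun hφ LA LB m = t :=
  hφ.eq_of_mul fun k => by rw [gammaMapFun_mul, ht]

theorem mul_gammaMapFun (hφ : IsStrict φ) (LA : LocalUnits A) (LB : LocalUnits B)
    (m : PedersenMultiplier A) (k : pedersenIdeal A) :
    ofMultiplier (φ k) * gammaMapFun hφ LA LB m = ofMultiplier (φ (m.right k)) :=
  hφ.eq_of_mul fun k' => by
    rw [mul_assoc, gammaMapFun_mul, ← map_mul, ← map_mul, ← map_mul, ← map_mul, m.central]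

/-- The extension of a strictly nondegenerate `φ : A → M(B)` to `Γ(K(A)) → Γ(K(B))`. -/
def gammaMap (hφ : IsStrict φ) (LA : LocalUnits A) (LB : LocalUnits B) :
    PedersenMultiplier A →⋆ₐ[ℂ] PedersenMultiplier B where
  toFun := gammaMapFun hφ LA LB
  map_one' := gammaMapFun_unique hφ LA LB fun k => by simp
  map_mul' m n := gammaMapFun_unique hφ LA LB fun k => by
    rw [mul_assoc, gammaMapFun_mul, gammaMapFun_mul]; rfl
  map_zero' := gammaMapFun_unique hφ LA LB fun k => by
    have : (0 : PedersenMultiplier A).left k = 0 := rfl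
    simp [this]
  map_add' m n := gammaMapFun_unique hφ LA LB fun k => by
    rw [add_mul, gammaMapFun_mul, gammaMapFun_mul, ← map_add, ← map_add]; rfl
  commutes' c := gammaMapFun_unique hφ LA LB fun k => by
    simp [Algebra.algebraMap_eq_smul_one]
  map_star' m := gammaMapFun_unique hφ LA LB fun k => by
    have h := congrArg star (mul_gammaMapFun hφ LA LB m ⟨star (k : A), star_mem_pedersenIdeal k.2⟩)
    rw [star_mul, ← ofMultiplier_map_star, ← ofMultiplier_map_star, star_star] at h
    rw [h]; rfl

theorem gammaMap_mul (hφ : IsStrict φ) (LA : LocalUnits A) (LB : LocalUnits B)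
    (m : PedersenMultiplier A) (k : pedersenIdeal A) :
    gammaMap hφ LA LB m * ofMultiplier (φ k) = ofMultiplier (φ (m.left k)) :=
  gammaMapFun_mul hφ LA LB m k

theorem gammaMap_unique (hφ : IsStrict φ) (LA : LocalUnits A) (LB : LocalUnits B)
    {m : PedersenMultiplier A} {t : PedersenMultiplier B}
    (ht : ∀ k : pedersenIdeal A, t * ofMultiplier (φ k) = ofMultiplier (φ (m.left k))) :
    gammaMap hφ LA LB m = t :=
  gammaMapFun_unique hφ LA LB ht

theorem gammaMap_ofElem (hφ : IsStrict φ) (LA : LocalUnits A) (LB : LocalUnits B) (a : A) :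
    gammaMap hφ LA LB (PedersenMultiplier.ofElem A a) = ofMultiplier (φ a) :=
  gammaMap_unique hφ LA LB fun k => by
    rw [PedersenMultiplier.coe_left_ofElem, map_mul, map_mul]

theorem left_gammaMap (hφ : IsStrict φ) (LA : LocalUnits A) (LB : LocalUnits B)
    (m : PedersenMultiplier A) (k : pedersenIdeal A) (z : pedersenIdeal B)
    (h : (φ k).fst z ∈ pedersenIdeal B) :
    ((gammaMap hφ LA LB m).left ⟨(φ k).fst z, h⟩ : B) = (φ (m.left k)).fst z :=
  congrArg (fun t => ((PedersenMultiplier.left t z : pedersenIdeal B) : B))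
    (gammaMap_mul hφ LA LB m k)

theorem support_subset_span_gammaMap (hφ : IsStrict φ) (LA : LocalUnits A) (LB : LocalUnits B) :
    PedersenMultiplier.support B ⊆ Submodule.span ℂ {y : PedersenMultiplier B |
      ∃ a ∈ PedersenMultiplier.support A, ∃ b, y = gammaMap hφ LA LB a * b} := by
  rintro _ ⟨y, hy, rfl⟩
  have h := hφ.mem_span_fst hy
  clear hy
  induction h using Submodule.span_induction with
  | mem y hy =>
    obtain ⟨k, z, rfl⟩ := hy
    refine Submodule.subset_span ⟨PedersenMultiplier.ofElem A k, ⟨k, k.2, rfl⟩,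
      PedersenMultiplier.ofElem B z, ?_⟩
    rw [gammaMap_ofElem, PedersenMultiplier.mul_ofElem]; rfl
  | zero => rw [PedersenMultiplier.ofElem_zero]; exact Submodule.zero_mem _
  | add x y _ _ hx hy => rw [PedersenMultiplier.ofElem_add]; exact Submodule.add_mem _ hx hy
  | smul c x _ hx => rw [PedersenMultiplier.ofElem_smul]; exact Submodule.smul_mem _ _ hx

/-- Each element of `K(B)` is controlled by one of the seminorms of `Γ(K(A))`. -/
theorem exists_norm_left_gammaMap_le (hφ : IsStrict φ) (LA : LocalUnits A) (LB : LocalUnits B)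
    (y : pedersenIdeal B) : ∃ N : ℕ, ∀ a,
      ‖((gammaMap hφ LA LB a).left y : B)‖ ≤ N * LA.seminorm N a := by
  have hmono : ∀ a, Monotone fun n => LA.seminorm n a := fun a =>
    monotone_nat_of_le_succ fun n => LA.seminorm_mono n a
  suffices H : ∀ y ∈ Submodule.span ℂ {y : B | ∃ k : pedersenIdeal A, ∃ z : pedersenIdeal B,
      y = (φ k).fst z}, ∃ hy : y ∈ pedersenIdeal B, ∃ N : ℕ, ∀ a,
        ‖((gammaMap hφ LA LB a).left ⟨y, hy⟩ : B)‖ ≤ N * LA.seminorm N a from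
    (H y (hφ.mem_span_fst y.2)).2
  intro y hy
  induction hy using Submodule.span_induction with
  | mem y hy =>
    obtain ⟨k, z, rfl⟩ := hy
    obtain ⟨n, hn⟩ := LA.exists_mem_ideal k.2
    obtain ⟨N, hN⟩ := exists_nat_ge (‖(k : A)‖ * ‖(z : B)‖)
    refine ⟨fst_mem_pedersenIdeal _ z.2, max n N, fun a => ?_⟩
    rw [left_gammaMap]
    calc _ ≤ ‖(a.left k : A)‖ * ‖(z : B)‖ := norm_fst_apply_le φ _ _
      _ ≤ LA.seminorm n a * ‖(k : A)‖ * ‖(z : B)‖ :=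
        mul_le_mul_of_nonneg_right (LA.norm_left_le k hn a) (norm_nonneg _)
      _ = (‖(k : A)‖ * ‖(z : B)‖) * LA.seminorm n a := by ring
      _ ≤ _ := mul_le_mul (hN.trans (by exact_mod_cast le_max_right n N))
        (hmono a (le_max_left n N)) ((LA.seminorm n).nonneg a) (by positivity)
  | zero =>
    refine ⟨zero_mem _, 0, fun a => ?_⟩
    have : (gammaMap hφ LA LB a).left ⟨0, zero_mem _⟩ = 0 := map_zero _
    simp [this]
  | add x y _ _ hx hy =>
    obtain ⟨hx, N, hN⟩ := hx
    obtain ⟨hy, M, hM⟩ := hy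
    have e : (⟨x + y, add_mem hx hy⟩ : pedersenIdeal B) = ⟨x, hx⟩ + ⟨y, hy⟩ := rfl
    refine ⟨add_mem hx hy, N + M, fun a => ?_⟩
    rw [e, map_add, Submodule.coe_add, Nat.cast_add, add_mul]
    refine (norm_add_le _ _).trans (add_le_add ((hN a).trans ?_) ((hM a).trans ?_))
    · exact mul_le_mul_of_nonneg_left (hmono a (Nat.le_add_right N M)) (Nat.cast_nonneg N)
    · exact mul_le_mul_of_nonneg_left (hmono a (Nat.le_add_left M N)) (Nat.cast_nonneg M)
  | smul c x _ hx =>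
    obtain ⟨hx, N, hN⟩ := hx
    obtain ⟨M, hM⟩ := exists_nat_ge (‖c‖ * N)
    have e : (⟨c • x, Submodule.smul_mem _ c hx⟩ : pedersenIdeal B) = c • ⟨x, hx⟩ := rfl
    refine ⟨Submodule.smul_mem _ c hx, max N M, fun a => ?_⟩
    rw [e, map_smul, Submodule.coe_smul, norm_smul]
    calc _ ≤ ‖c‖ * (N * LA.seminorm N a) := mul_le_mul_of_nonneg_left (hN a) (norm_nonneg c)
      _ = (‖c‖ * N) * LA.seminorm N a := by ring
      _ ≤ _ := mul_le_mul (hM.trans (by exact_mod_cast le_max_right N M))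
        (hmono a (le_max_left N M)) ((LA.seminorm N).nonneg a) (by positivity)

/-- The preceding bound holds uniformly on the elements `y` with `y * e = y`, by Baire's theorem. -/
theorem exists_uniform_norm_left_gammaMap_le (hφ : IsStrict φ) (LA : LocalUnits A)
    (LB : LocalUnits B) {e : B} (he : e ∈ pedersenIdeal B) : ∃ (N : ℕ) (C : ℝ), 0 ≤ C ∧
      ∀ y : pedersenIdeal B, (y : B) * e = y → ∀ a,
        ‖((gammaMap hφ LA LB a).left y : B)‖ ≤ C * LA.seminorm N a * ‖(y : B)‖ := by
  let V : Submodule ℂ B := PedersenMultiplier.fixedSubmodule e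
  have : CompleteSpace V := (PedersenMultiplier.isClosed_fixedSubmodule e).completeSpace_coe
  let j : V →ₗ[ℂ] pedersenIdeal B :=
    Submodule.inclusion (PedersenMultiplier.fixedSubmodule_le he)
  let S : ℕ → Set V := fun N => {y | ∀ a,
    ‖((gammaMap hφ LA LB a).left (j y) : B)‖ ≤ N * LA.seminorm N a}
  have hS : ∀ N, IsClosed (S N) := fun N => by
    refine IsSeqClosed.isClosed fun u y hu hy a => ?_
    exact PedersenMultiplier.norm_left_le_of_tendsto _ (u := fun k => j (u k)) (y := j y)
      ((continuous_subtype_val.tendsto y).comp hy) tendsto_const_nhds fun k => hu k a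
  have hU : ⋃ N, S N = Set.univ := Set.eq_univ_of_forall fun y => Set.mem_iUnion.2
    (exists_norm_left_gammaMap_le hφ LA LB (j y))
  obtain ⟨N, x, hx⟩ := nonempty_interior_of_iUnion_of_closed hS hU
  obtain ⟨r, hr, hr'⟩ := Metric.isOpen_iff.1 isOpen_interior x hx
  have hball : ∀ y : V, ‖y‖ < r → x + y ∈ S N := fun y hy =>
    interior_subset (hr' (by rwa [Metric.mem_ball, dist_eq_norm, add_sub_cancel_left]))
  refine ⟨N, 4 * N / r, by positivity, fun y hy a => ?_⟩
  let y' : V := ⟨y, hy⟩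
  have hjy : j y' = y := rfl
  rcases (norm_nonneg (y : B)).eq_or_lt with h0 | h0
  · have h0 : y = 0 := Subtype.ext (norm_eq_zero.1 h0.symm)
    simp [h0]
  set c : ℂ := ((r / 2 / ‖(y : B)‖ : ℝ) : ℂ) with hc
  have hcn : ‖c‖ = r / 2 / ‖(y : B)‖ := by
    rw [hc, Complex.norm_real, Real.norm_of_nonneg (by positivity)]
  have hcy : ‖c • y'‖ < r := by
    have h1 : ‖y'‖ = ‖(y : B)‖ := rfl
    rw [norm_smul, hcn, h1, div_mul_cancel₀ _ h0.ne']
    exact half_lt_self hr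
  have h1 := hball (c • y') hcy a
  have h2 := hball 0 (by simpa using hr) a
  rw [add_zero] at h2
  rw [map_add, map_smul, hjy, map_add, map_smul, Submodule.coe_add, Submodule.coe_smul] at h1
  set w : B := ((gammaMap hφ LA LB a).left y : B) with hw
  have h3 : ‖c • w‖ ≤ 2 * N * LA.seminorm N a := by
    have := norm_sub_le (((gammaMap hφ LA LB a).left (j x) : B) + c • w)
      ((gammaMap hφ LA LB a).left (j x) : B)
    rw [add_sub_cancel_left] at this
    linarith
  rw [norm_smul, hcn, div_mul_eq_mul_div, div_le_iff₀ h0] at h3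
  rw [div_mul_eq_mul_div, div_mul_eq_mul_div, le_div_iff₀ hr]
  linarith

theorem continuous_gammaMap (hφ : IsStrict φ) (LA : LocalUnits A) (LB : LocalUnits B) :
    Continuous (gammaMap hφ LA LB) := by
  refine continuous_iff_continuousAt.2 fun m => LB.tendsto_iff.2 fun n => ?_
  obtain ⟨N, C, hC, h⟩ := exists_uniform_norm_left_gammaMap_le hφ LA LB
    (LB.mem_pedersenIdeal (n + 1))
  have h1 : Tendsto (fun a => C * LA.seminorm N (a - m)) (𝓝 m) (𝓝 0) := by
    simpa using (LA.tendsto_iff.1 (tendsto_id (x := 𝓝 m)) N).const_mul C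
  refine squeeze_zero (fun _ => (LB.seminorm n).nonneg _) (fun a => ?_) h1
  rw [← map_sub]
  exact LB.seminorm_le (mul_nonneg hC ((LA.seminorm N).nonneg _)) fun x =>
    h _ (LB.elt_mul x) _

end Extension

/-! ### The Pedersen ideal of `C₀(X)` -/

section ContinuousFunctions

variable {X : Type u} [TopologicalSpace X]

theorem ZeroAtInftyContinuousMap.norm_le_of_forall {f : C₀(X, ℂ)} {C : ℝ} (hC : 0 ≤ C)
    (h : ∀ x, ‖f x‖ ≤ C) : ‖f‖ ≤ C := by
  rw [← ZeroAtInftyContinuousMap.norm_toBCF_eq_norm]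
  exact (BoundedContinuousFunction.norm_le hC).2 h

theorem ZeroAtInftyContinuousMap.norm_apply_le (f : C₀(X, ℂ)) (x : X) : ‖f x‖ ≤ ‖f‖ := by
  rw [← ZeroAtInftyContinuousMap.norm_toBCF_eq_norm]
  exact f.toBCF.norm_coe_le_norm x

/-- A compactly supported function as an element of `C₀(X)`. -/
def zeroAtInftyOfCompactSupport (f : C(X, ℂ)) (hf : HasCompactSupport f) : C₀(X, ℂ) where
  toContinuousMap := f
  zero_at_infty' := HasCompactSupport.is_zero_at_infty hf

@[simp] theorem zeroAtInftyOfCompactSupport_apply (f : C(X, ℂ)) (hf : HasCompactSupport f) (x : X) :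
    zeroAtInftyOfCompactSupport f hf x = f x := rfl

/-- The elements of `C₀(X)` with compact support. -/
def compactSupportSubmodule (X : Type u) [TopologicalSpace X] : Submodule ℂ C₀(X, ℂ) where
  carrier := {f | HasCompactSupport f}
  add_mem' := fun hf hg => HasCompactSupport.add hf hg
  zero_mem' := HasCompactSupport.zero
  smul_mem' := fun c f hf => by
    change HasCompactSupport (fun x => c • f x)
    exact HasCompactSupport.smul_left (f := fun _ => c) hf

/-- Functions in `C₀(X)` are almost unchanged by multiplication with a bump function which is `1` on
a large compact set. -/
theorem exists_norm_sub_mul_le (f : C₀(X, ℂ)) {ε : ℝ} (hε : 0 < ε) : ∃ s : Set X, IsCompact s ∧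
    ∀ b : C₀(X, ℂ), (∀ x ∈ s, b x = 1) → (∀ x, ∃ t : ℝ, 0 ≤ t ∧ t ≤ 1 ∧ b x = t) →
      ‖b * f - f‖ ≤ ε := by
  have h := f.zero_at_infty'.eventually (Metric.ball_mem_nhds 0 hε)
  obtain ⟨s, hs, hs'⟩ := mem_cocompact.1 h
  refine ⟨s, hs, fun b h1 h2 => ZeroAtInftyContinuousMap.norm_le_of_forall hε.le fun x => ?_⟩
  by_cases hx : x ∈ s
  · simp [h1 x hx, hε.le]
  · have h3 : ‖f x‖ < ε := by
      have : f x ∈ Metric.ball 0 ε := hs' hx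
      simpa using this
    obtain ⟨t, ht0, ht1, ht⟩ := h2 x
    have h4 : (b * f - f) x = ((t - 1 : ℝ) : ℂ) * f x := by
      simp [ht, sub_mul]
    rw [h4, norm_mul, Complex.norm_real, Real.norm_eq_abs]
    have h5 : |t - 1| ≤ 1 := abs_le.2 ⟨by linarith, by linarith⟩
    calc _ ≤ 1 * ‖f x‖ := mul_le_mul_of_nonneg_right h5 (norm_nonneg _)
      _ ≤ ε := by rw [one_mul]; exact h3.le

/-- As `C₀(X)` is commutative, a multiplier of its Pedersen ideal acts pointwise. -/
theorem PedersenMultiplier.left_apply_mul (m : PedersenMultiplier C₀(X, ℂ))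
    (y z : pedersenIdeal C₀(X, ℂ)) (x : X) : (m.left y : C₀(X, ℂ)) x * (z : C₀(X, ℂ)) x =
      (m.left z : C₀(X, ℂ)) x * (y : C₀(X, ℂ)) x := by
  have h1 := congrArg (fun f : C₀(X, ℂ) => f x)
    (m.left_mul_elem y.2 (z : C₀(X, ℂ)) (mul_comm (z : C₀(X, ℂ)) y ▸ mul_mem_pedersenIdeal _ y.2))
  have h2 := congrArg (fun f : C₀(X, ℂ) => f x)
    (m.left_mul_elem z.2 (y : C₀(X, ℂ)) (mul_comm (y : C₀(X, ℂ)) z ▸ mul_mem_pedersenIdeal _ z.2))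
  simp only [mul_comm (z : C₀(X, ℂ)) y] at h2
  exact h1.symm.trans h2

theorem eq_zero_of_mem_leftIdealBall {a : C₀(X, ℂ)} {y : pedersenIdeal C₀(X, ℂ)}
    (hy : y ∈ PedersenMultiplier.leftIdealBall a) {x : X} (hx : a x = 0) :
    (y : C₀(X, ℂ)) x = 0 := by
  obtain ⟨u, hu, hu'⟩ := mem_closure_iff_seq_limit.1 hy.1
  have h1 := ((ZeroAtInftyContinuousMap.tendsto_iff_tendstoUniformly).1 hu').tendsto_at x
  refine tendsto_nhds_unique h1 (tendsto_const_nhds.congr fun n => ?_)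
  obtain ⟨z, hz⟩ := hu n
  rw [← hz]
  simp [hx]

variable [T2Space X] [LocallyCompactSpace X]

/-- For every compact set there is a compactly supported `[0, 1]`-valued function which is `1` on
this set. -/
theorem exists_bump {s : Set X} (hs : IsCompact s) : ∃ b : C₀(X, ℂ), HasCompactSupport b ∧
    (∀ x ∈ s, b x = 1) ∧ (∀ x, ∃ t : ℝ, 0 ≤ t ∧ t ≤ 1 ∧ b x = t) := by
  obtain ⟨f, h1, -, h3, h4⟩ := exists_continuous_one_zero_of_isCompact hs isClosed_empty
    (Set.disjoint_empty _)
  let g : C(X, ℂ) := ⟨fun x => (f x : ℂ), Complex.continuous_ofReal.comp f.continuous⟩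
  have hg : HasCompactSupport g := h3.comp_left (g := fun t : ℝ => (t : ℂ)) Complex.ofReal_zero
  refine ⟨zeroAtInftyOfCompactSupport g hg, hg, fun x hx => ?_, fun x => ⟨f x, (h4 x).1, (h4 x).2,
    rfl⟩⟩
  change (f x : ℂ) = 1
  rw [h1 hx]; simp

theorem isDenseIdeal_compactSupportSubmodule :
    IsDenseIdeal C₀(X, ℂ) (compactSupportSubmodule X) := by
  refine ⟨fun a f hf => ⟨HasCompactSupport.mul_left hf, HasCompactSupport.mul_right hf⟩, ?_⟩
  intro f
  refine Metric.mem_closure_iff.2 fun ε hε => ?_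
  obtain ⟨s, hs, h⟩ := exists_norm_sub_mul_le f (half_pos hε)
  obtain ⟨b, hb, hb1, hb2⟩ := exists_bump hs
  refine ⟨b * f, HasCompactSupport.mul_right hb, ?_⟩
  rw [dist_comm, dist_eq_norm]
  exact (h b hb1 hb2).trans_lt (half_lt_self hε)

/-- The Pedersen ideal of `C₀(X)` consists of the functions with compact support. -/
theorem mem_pedersenIdeal_iff {f : C₀(X, ℂ)} :
    f ∈ pedersenIdeal C₀(X, ℂ) ↔ HasCompactSupport f := by
  refine ⟨fun h => pedersenIdeal_le isDenseIdeal_compactSupportSubmodule h, fun h => ?_⟩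
  obtain ⟨b, -, hb, -⟩ := exists_bump h
  refine mem_of_mul_eq isDenseIdeal_pedersenIdeal (y := b) ?_
  ext x
  by_cases hx : x ∈ tsupport f
  · simp [hb x hx]
  · simp [image_eq_zero_of_notMem_tsupport hx]

theorem exists_bump_sqrt {s : Set X} (hs : IsCompact s) : ∃ b : C₀(X, ℂ),
    star b * b ∈ pedersenIdeal C₀(X, ℂ) ∧ (∀ x ∈ s, (star b * b) x = 1) ∧
      (∀ x, ∃ t : ℝ, 0 ≤ t ∧ t ≤ 1 ∧ (star b * b) x = t) := by
  obtain ⟨b, hb, hb1, hb2⟩ := exists_bump hs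
  refine ⟨b, mul_mem_pedersenIdeal _ (mem_pedersenIdeal_iff.2 hb), fun x hx => by simp [hb1 x hx],
    fun x => ?_⟩
  obtain ⟨t, h0, h1, ht⟩ := hb2 x
  exact ⟨t * t, mul_nonneg h0 h0, mul_le_one₀ h1 h0 h1, by simp [ht]⟩

theorem isSigmaUnital_zeroAtInfty [SigmaCompactSpace X] : IsSigmaUnital C₀(X, ℂ) := by
  let K := CompactExhaustion.choice X
  choose b hb hb1 hb2 using fun n => exists_bump_sqrt (K.isCompact n)
  have hT : ∀ a : C₀(X, ℂ), Tendsto (fun n => star (b n) * b n * a) atTop (𝓝 a) := fun a => by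
    refine Metric.tendsto_atTop.2 fun ε hε => ?_
    obtain ⟨s, hs, h⟩ := exists_norm_sub_mul_le a (half_pos hε)
    obtain ⟨N, hN⟩ := K.exists_superset_of_isCompact hs
    refine ⟨N, fun n hn => ?_⟩
    rw [dist_eq_norm]
    exact (h _ (fun x hx => hb1 n x (K.subset hn (hN hx))) (hb2 n)).trans_lt (half_lt_self hε)
  refine ⟨fun n => star (b n) * b n, fun n => ⟨⟨b n, rfl⟩, ?_⟩, fun a => ⟨hT a, ?_⟩⟩
  · refine ZeroAtInftyContinuousMap.norm_le_of_forall zero_le_one fun x => ?_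
    obtain ⟨t, h0, h1, ht⟩ := hb2 n x
    rw [ht, Complex.norm_real, Real.norm_of_nonneg h0]
    exact h1
  · simpa only [mul_comm a] using hT a

/-! ### The isomorphism of `C(X)` with `Γ(K(C₀(X)))` -/

/-- Multiplication by `f ∈ C(X)`, as a linear map on `K(C₀(X))`. -/
def mulPedersen (f : C(X, ℂ)) : pedersenIdeal C₀(X, ℂ) →ₗ[ℂ] pedersenIdeal C₀(X, ℂ) where
  toFun y := ⟨zeroAtInftyOfCompactSupport (f * (y : C₀(X, ℂ)).toContinuousMap)
      (HasCompactSupport.mul_left (mem_pedersenIdeal_iff.1 y.2)),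
    mem_pedersenIdeal_iff.2 (HasCompactSupport.mul_left (mem_pedersenIdeal_iff.1 y.2))⟩
  map_add' y z := Subtype.ext (by ext x; simp [mul_add])
  map_smul' c y := Subtype.ext (by ext x; simp [mul_left_comm])

@[simp] theorem mulPedersen_apply (f : C(X, ℂ)) (y : pedersenIdeal C₀(X, ℂ)) (x : X) :
    (mulPedersen f y : C₀(X, ℂ)) x = f x * (y : C₀(X, ℂ)) x := rfl

/-- The canonical map `C(X) → Γ(K(C₀(X)))`. -/
def ofContinuous : C(X, ℂ) →⋆ₐ[ℂ] PedersenMultiplier C₀(X, ℂ) where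
  toFun f := PedersenMultiplier.mk' (mulPedersen f) (mulPedersen f) fun y z => by
    ext x; simp [mul_left_comm, mul_assoc]
  map_one' := PedersenMultiplier.ext_left fun y => Subtype.ext (by ext x; simp)
  map_mul' f g := PedersenMultiplier.ext_left fun y => Subtype.ext (by ext x; simp [mul_assoc])
  map_zero' := PedersenMultiplier.ext_left fun y => Subtype.ext (by
    have : (0 : PedersenMultiplier C₀(X, ℂ)).left y = 0 := rfl
    ext x; simp [this])
  map_add' f g := PedersenMultiplier.ext_left fun y => Subtype.ext (by ext x; simp [add_mul])
  commutes' c := PedersenMultiplier.ext_left fun y => Subtype.ext (by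
    ext x; simp [Algebra.algebraMap_eq_smul_one])
  map_star' f := PedersenMultiplier.ext_left fun y => Subtype.ext (by ext x; simp)

@[simp] theorem left_ofContinuous (f : C(X, ℂ)) (y : pedersenIdeal C₀(X, ℂ)) (x : X) :
    ((ofContinuous f).left y : C₀(X, ℂ)) x = f x * (y : C₀(X, ℂ)) x := rfl

theorem exists_bump_pedersen {s : Set X} (hs : IsCompact s) : ∃ b : pedersenIdeal C₀(X, ℂ),
    ∀ x ∈ s, (b : C₀(X, ℂ)) x = 1 := by
  obtain ⟨b, hb, hb1, -⟩ := exists_bump hs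
  exact ⟨⟨b, mem_pedersenIdeal_iff.2 hb⟩, hb1⟩

/-- A multiplier `m` comes from the function `x ↦ m (u x) x`, where `u x` is a bump function with
`u x x = 1`; near a given point this function agrees with `m b` for a single bump function `b`. -/
theorem bijective_ofContinuous :
    Function.Bijective (ofContinuous : C(X, ℂ) →⋆ₐ[ℂ] PedersenMultiplier C₀(X, ℂ)) := by
  constructor
  · intro f g h
    ext x
    obtain ⟨b, hb⟩ := exists_bump_pedersen (isCompact_singleton (x := x))
    have := congrArg (fun m => (PedersenMultiplier.left m b : C₀(X, ℂ)) x) h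
    simpa [hb x rfl] using this
  · intro m
    choose u hu using fun x : X => exists_bump_pedersen (isCompact_singleton (x := x))
    have key : ∀ (y : pedersenIdeal C₀(X, ℂ)) (x : X), (m.left y : C₀(X, ℂ)) x =
        (m.left (u x) : C₀(X, ℂ)) x * (y : C₀(X, ℂ)) x := fun y x => by
      rw [← m.left_apply_mul y (u x), hu x x rfl, mul_one]
    have hc : Continuous fun x => (m.left (u x) : C₀(X, ℂ)) x := by
      refine continuous_iff_continuousAt.2 fun x₀ => ?_
      obtain ⟨s, hs, hs'⟩ := exists_compact_mem_nhds x₀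
      obtain ⟨b, hb⟩ := exists_bump_pedersen hs
      refine ((m.left b : C₀(X, ℂ)).continuous.continuousAt (x := x₀)).congr ?_
      filter_upwards [hs'] with x hx
      change (m.left b : C₀(X, ℂ)) x = _
      rw [key, hb x hx, mul_one]
    refine ⟨⟨_, hc⟩, PedersenMultiplier.ext_left fun y => Subtype.ext ?_⟩
    ext x
    rw [key, left_ofContinuous]
    rfl

/-- Under `C(X) ≅ Γ(K(C₀(X)))` the projective topology is the compact-open topology: the functions
in the unit ball of `cl (C₀(X) a)` vanish off the support of `a`, and the squares of bump
functions which are `1` on a given compact set lie in such a ball. -/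
theorem tendsto_ofContinuous_iff {ι : Type*} {l : Filter ι} {F : ι → C(X, ℂ)} {f : C(X, ℂ)} :
    Tendsto (fun i => ofContinuous (F i)) l (𝓝 (ofContinuous f)) ↔ Tendsto F l (𝓝 f) := by
  rw [PedersenMultiplier.tendsto_iff, ContinuousMap.tendsto_iff_forall_isCompact_tendstoUniformlyOn]
  simp only [← map_sub]
  constructor
  · intro h s hs
    obtain ⟨b, hb, hb1, hb2⟩ := exists_bump_sqrt hs
    refine Metric.tendstoUniformlyOn_iff.2 fun ε hε => ?_
    have hy : (⟨star b * b * (star b * b), mul_mem_pedersenIdeal _ hb⟩ : pedersenIdeal C₀(X, ℂ)) ∈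
        PedersenMultiplier.leftIdealBall (star b * b) := by
      refine ⟨subset_closure ⟨star b * b, rfl⟩,
        ZeroAtInftyContinuousMap.norm_le_of_forall zero_le_one fun x => ?_⟩
      obtain ⟨t, h0, h1, ht⟩ := hb2 x
      change ‖(star b * b) x * (star b * b) x‖ ≤ 1
      rw [ht, norm_mul, Complex.norm_real, Real.norm_of_nonneg h0]
      exact mul_le_one₀ h1 h0 h1
    filter_upwards [h b hb ε hε] with i hi x hx
    have h1 := (ZeroAtInftyContinuousMap.norm_apply_le _ x).trans_lt (hi _ hy)
    rw [left_ofContinuous] at h1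
    change ‖(F i - f) x * ((star b * b) x * (star b * b) x)‖ < ε at h1
    rw [hb1 x hx, mul_one, mul_one] at h1
    rw [dist_comm, dist_eq_norm]
    exact h1
  · intro h b hb ε hε
    filter_upwards [Metric.tendstoUniformlyOn_iff.1 (h _ (mem_pedersenIdeal_iff.1 hb)) (ε / 2)
      (half_pos hε)] with i hi y hy
    refine (ZeroAtInftyContinuousMap.norm_le_of_forall (half_pos hε).le fun x => ?_).trans_lt
      (half_lt_self hε)
    rw [left_ofContinuous]
    by_cases hx : x ∈ tsupport (star b * b)
    · have h1 := hi x hx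
      rw [dist_comm, dist_eq_norm] at h1
      rw [norm_mul]
      exact (mul_le_of_le_one_right (norm_nonneg _)
        ((ZeroAtInftyContinuousMap.norm_apply_le _ x).trans hy.2)).trans h1.le
    · rw [eq_zero_of_mem_leftIdealBall hy (image_eq_zero_of_notMem_tsupport hx), mul_zero,
        norm_zero]
      exact (half_pos hε).le

theorem isInducing_ofContinuous :
    IsInducing (ofContinuous : C(X, ℂ) →⋆ₐ[ℂ] PedersenMultiplier C₀(X, ℂ)) := by
  refine isInducing_iff_nhds.2 fun f => le_antisymm ?_ ?_
  · exact tendsto_iff_comap.1 (tendsto_ofContinuous_iff.2 tendsto_id)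
  · exact tendsto_id'.1 (tendsto_ofContinuous_iff.1 tendsto_comap)

theorem ofContinuous_mem_support_iff {f : C(X, ℂ)} :
    ofContinuous f ∈ PedersenMultiplier.support C₀(X, ℂ) ↔ HasCompactSupport f := by
  constructor
  · rintro ⟨k, hk, h⟩
    have e : ⇑f = k := by
      ext x
      obtain ⟨b, hb⟩ := exists_bump_pedersen (isCompact_singleton (x := x))
      have := congrArg (fun m => (PedersenMultiplier.left m b : C₀(X, ℂ)) x) h
      simpa [hb x rfl] using this.symm
    rw [e]
    exact mem_pedersenIdeal_iff.1 hk
  · intro hf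
    exact ⟨zeroAtInftyOfCompactSupport f hf, mem_pedersenIdeal_iff.2 hf,
      PedersenMultiplier.ext_left fun y => Subtype.ext (by ext x; simp)⟩

end ContinuousFunctions

/-! ### Transport of local compactness along isomorphisms -/

section Transfer

variable {A B : Type u} [Ring A] [StarRing A] [Algebra ℂ A] [TopologicalSpace A]
  [Ring B] [StarRing B] [Algebra ℂ B] [TopologicalSpace B]

/-- The presentation of `B` as an inverse limit induced by an isomorphism `B ≅ A`. -/
def SigmaCStarPresentation.comap (P : SigmaCStarPresentation A) (Φ : B →⋆ₐ[ℂ] A)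
    (hΦ : Function.Bijective Φ) (hΦ' : IsInducing Φ) : SigmaCStarPresentation B where
  stage := P.stage
  bond := P.bond
  proj n := (P.proj n).comp Φ
  bond_proj n b := P.bond_proj n (Φ b)
  limit x hx := by
    obtain ⟨a, ha, ha'⟩ := P.limit x hx
    obtain ⟨b, rfl⟩ := hΦ.2 a
    exact ⟨b, ha, fun b' hb' => hΦ.1 (ha' _ hb')⟩
  topology_eq := by
    have h : ‹TopologicalSpace A› =
        ⨅ n, TopologicalSpace.induced (P.proj n) inferInstance := P.topology_eq
    have h' := congrArg (TopologicalSpace.induced Φ) h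
    rw [induced_iInf] at h'
    simp only [induced_compose] at h'
    exact hΦ'.eq_induced.trans h'
  surjective n := (P.surjective n).comp hΦ.2

theorem IsLocallyCompactSigmaCStar.preimage {S : Set A} (h : IsLocallyCompactSigmaCStar A S)
    (Φ : B →⋆ₐ[ℂ] A) (hΦ : Function.Bijective Φ) (hΦ' : IsInducing Φ) :
    IsLocallyCompactSigmaCStar B (Φ ⁻¹' S) := by
  obtain ⟨P, e, h1, h2, h3, h4, h5, h6, h7⟩ := h
  choose e' he' using fun n => hΦ.2 (e n)
  have hs : ∀ b, (P.comap Φ hΦ hΦ').supNorm b = P.supNorm (Φ b) := fun b => rfl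
  have hp : ∀ n b, ‖(P.comap Φ hΦ hΦ').proj n b‖ₑ = ‖P.proj n (Φ b)‖ₑ := fun n b => rfl
  refine ⟨P.comap Φ hΦ hΦ', e', fun n => ⟨?_, ?_⟩, fun n a => ?_, fun n m hnm => hΦ.1 ?_, ?_, ?_,
    fun l hl => ?_, fun n a => ?_⟩
  · obtain ⟨b, hb⟩ := (h1 n).1
    obtain ⟨b, rfl⟩ := hΦ.2 b
    exact ⟨b, hΦ.1 (by rw [he', hb, map_mul, map_star])⟩
  · obtain ⟨b, hb⟩ := (h1 n).2
    obtain ⟨b, rfl⟩ := hΦ.2 b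
    exact ⟨b, hΦ.1 (by rw [map_sub, map_one, he', hb, map_mul, map_star])⟩
  · simpa only [hs, map_mul, he'] using h2 n (Φ a)
  · rw [map_mul, he', he', h3 n m hnm]
  · rw [h4]
    simp only [supportAlgebra, Set.preimage_iUnion]
    refine Set.iUnion_congr fun n => ?_
    ext b
    have e1 : {x : A | ∃ a c, x = a * e n ^ 2 * c} =
        (Φ : B →⋆ₐ[ℂ] A).toAlgHom.toLinearMap '' {x : B | ∃ a c, x = a * e' n ^ 2 * c} := by
      ext x
      constructor
      · rintro ⟨a, c, rfl⟩
        obtain ⟨a, rfl⟩ := hΦ.2 a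
        obtain ⟨c, rfl⟩ := hΦ.2 c
        refine ⟨_, ⟨a, c, rfl⟩, ?_⟩
        change Φ _ = _
        rw [map_mul, map_mul, map_pow, he']
      · rintro ⟨_, ⟨a, c, rfl⟩, rfl⟩
        refine ⟨Φ a, Φ c, ?_⟩
        change Φ _ = _
        rw [map_mul, map_mul, map_pow, he']
    rw [e1, ← Submodule.map_span]
    exact Function.Injective.mem_set_image hΦ.1
  · intro x hx
    have := h5 (Φ x) hx
    rw [tendsto_map'_iff, tendsto_map'_iff] at this ⊢
    simpa only [Function.comp_def, hs, map_mul, map_sub, he', map_one] using this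
  · have hl' : P.SupportCauchy S (map Φ l) := by
      refine ⟨hl.1.map _, fun x hx => ?_⟩
      obtain ⟨x, rfl⟩ := hΦ.2 x
      have := hl.2 x hx
      rw [prod_map_map_eq, tendsto_map'_iff, tendsto_map'_iff]
      simpa only [Function.comp_def, hs, map_mul, map_sub] using this
    obtain ⟨a, ha⟩ := h6 _ hl'
    obtain ⟨a, rfl⟩ := hΦ.2 a
    refine ⟨a, fun x hx => ?_⟩
    have := ha (Φ x) hx
    rw [tendsto_map'_iff, tendsto_map'_iff] at this
    simpa only [Function.comp_def, hs, map_mul, map_sub] using this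
  · have := h7 n (Φ a)
    refine ⟨by simpa only [hs, hp, map_mul, he'] using this.1, this.2.trans ?_⟩
    refine iSup₂_le fun b hb => ?_
    obtain ⟨b, rfl⟩ := hΦ.2 b
    refine le_iSup₂_of_le b ?_ ?_
    · rwa [hs, map_mul, he']
    · rw [hs, map_mul, map_mul, he']

end Transfer

/-! ### The functor and its value at `C₀(X)` -/

section Functor

open PedersenMultiplier

/-- A choice of local units in a σ-unital C*-algebra. -/
def SigmaUnitalCStarAlg.localUnits (A : SigmaUnitalCStarAlg.{u}) : LocalUnits A.carrier :=
  A.sigmaUnital.nonempty_localUnits.some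

theorem SigmaUnitalCStarAlg.isLocallyCompactSigmaCStar (A : SigmaUnitalCStarAlg.{u}) :
    IsLocallyCompactSigmaCStar (PedersenMultiplier A.carrier) (support A.carrier) :=
  A.localUnits.isLocallyCompactSigmaCStar

/-- The extensions of `ψ : B → M(C)` to `M(B)` and to `Γ(K(B))` agree. -/
theorem gammaMap_ofMultiplier {B C : Type u} [NonUnitalCStarAlgebra B] [NonUnitalCStarAlgebra C]
    {ψ : B →⋆ₙₐ[ℂ] 𝓜(ℂ, C)} (hψ : IsStrict ψ) (hψ' : IsNondegenerate ψ) (LB : LocalUnits B)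
    (LC : LocalUnits C) (s : 𝓜(ℂ, B)) :
    gammaMap hψ LB LC (ofMultiplier s) = ofMultiplier (extension hψ' s) :=
  gammaMap_unique hψ LB LC fun k => by
    rw [← map_mul]
    exact congrArg ofMultiplier (extensionFun_spec_left hψ' s k)

theorem gammaMap_coeHom {A : Type u} [NonUnitalCStarAlgebra A] (L : LocalUnits A)
    (h : IsStrict (DoubleCentralizer.coeHom (𝕜 := ℂ) (A := A))) :
    gammaMap h L L = StarAlgHom.id ℂ (PedersenMultiplier A) :=
  StarAlgHom.ext fun m => gammaMap_unique _ _ _ fun k => by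
    change m * ofMultiplier ((k : A) : 𝓜(ℂ, A)) = ofMultiplier ((m.left k : A) : 𝓜(ℂ, A))
    rw [ofMultiplier_coe, ofMultiplier_coe, mul_ofElem]

theorem gammaMap_compMor {A B C : Type u} [NonUnitalCStarAlgebra A] [NonUnitalCStarAlgebra B]
    [NonUnitalCStarAlgebra C] {φ : A →⋆ₙₐ[ℂ] 𝓜(ℂ, B)} {ψ : B →⋆ₙₐ[ℂ] 𝓜(ℂ, C)}
    (hφ : IsStrict φ) (hψ : IsStrict ψ) (hψ' : IsNondegenerate ψ)
    (h : IsStrict (compMor φ hψ')) (LA : LocalUnits A) (LB : LocalUnits B) (LC : LocalUnits C) :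
    gammaMap h LA LC = (gammaMap hψ LB LC).comp (gammaMap hφ LA LB) :=
  StarAlgHom.ext fun m => gammaMap_unique _ _ _ fun k => by
    rw [compMor_apply, compMor_apply, StarAlgHom.comp_apply,
      ← gammaMap_ofMultiplier hψ hψ' LB LC, ← map_mul, gammaMap_mul, gammaMap_ofMultiplier]

/-- The functor `A ↦ Γ(K(A))`. -/
def gammaFunctor : SigmaUnitalCStarAlg.{u} ⥤ LocallyCompactSigmaCStarAlg.{u} where
  obj A := gammaObj A A.isLocallyCompactSigmaCStar
  map {A B} f := LocallyCompactSigmaCStarAlg.Hom.mk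
    (A := gammaObj A A.isLocallyCompactSigmaCStar) (B := gammaObj B B.isLocallyCompactSigmaCStar)
    (gammaMap f.strict A.localUnits B.localUnits)
    (continuous_gammaMap f.strict A.localUnits B.localUnits)
    (support_subset_span_gammaMap f.strict A.localUnits B.localUnits)
  map_id _ := LocallyCompactSigmaCStarAlg.Hom.ext (gammaMap_coeHom _ _)
  map_comp {A B C} f g := LocallyCompactSigmaCStarAlg.Hom.ext
    (gammaMap_compMor f.strict g.strict g.nondegenerate _ A.localUnits B.localUnits C.localUnits)

end Functor

section ContinuousIso

variable (X : Type u) [TopologicalSpace X] [T2Space X] [LocallyCompactSpace X]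

/-- The isomorphism `C(X) ≅ Γ(K(C₀(X)))`. -/
def continuousEquiv : C(X, ℂ) ≃⋆ₐ[ℂ] PedersenMultiplier C₀(X, ℂ) :=
  StarAlgEquiv.ofBijective ofContinuous bijective_ofContinuous

theorem continuousEquiv_apply (f : C(X, ℂ)) : continuousEquiv X f = ofContinuous f := rfl

theorem preimage_support :
    (ofContinuous : C(X, ℂ) →⋆ₐ[ℂ] PedersenMultiplier C₀(X, ℂ)) ⁻¹'
      PedersenMultiplier.support C₀(X, ℂ) = {f : C(X, ℂ) | HasCompactSupport f} :=
  Set.ext fun _ => ofContinuous_mem_support_iff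

theorem isLocallyCompactSigmaCStar_continuous [SigmaCompactSpace X] :
    IsLocallyCompactSigmaCStar C(X, ℂ) {f | HasCompactSupport f} := by
  rw [← preimage_support]
  exact (SigmaUnitalCStarAlg.isLocallyCompactSigmaCStar
    (zeroAtInftyObj X isSigmaUnital_zeroAtInfty)).preimage ofContinuous bijective_ofContinuous
      isInducing_ofContinuous

/-- The isomorphism `Γ(K(C₀(X))) ≅ C(X)` of locally compact σ-C*-algebras. -/
def continuousIso [SigmaCompactSpace X] :
    gammaObj (zeroAtInftyObj X isSigmaUnital_zeroAtInfty)
      (SigmaUnitalCStarAlg.isLocallyCompactSigmaCStar _) ≅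
        continuousObj X (isLocallyCompactSigmaCStar_continuous X) where
  hom := LocallyCompactSigmaCStarAlg.Hom.mk
    (A := gammaObj (zeroAtInftyObj X isSigmaUnital_zeroAtInfty)
      (SigmaUnitalCStarAlg.isLocallyCompactSigmaCStar _))
    (B := continuousObj X (isLocallyCompactSigmaCStar_continuous X))
    ((continuousEquiv X).symm : PedersenMultiplier C₀(X, ℂ) →⋆ₐ[ℂ] C(X, ℂ))
    (isInducing_ofContinuous.continuous_iff.2 (continuous_id.congr fun m =>
      ((continuousEquiv X).apply_symm_apply m).symm))
    (fun f hf => Submodule.subset_span ⟨continuousEquiv X f, ofContinuous_mem_support_iff.2 hf,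
      (1 : C(X, ℂ)),
      (((continuousEquiv X).symm_apply_apply f).symm.trans (mul_one _).symm :
        (f : C(X, ℂ)) = (continuousEquiv X).symm (continuousEquiv X f) * (1 : C(X, ℂ)))⟩)
  inv := LocallyCompactSigmaCStarAlg.Hom.mk
    (A := continuousObj X (isLocallyCompactSigmaCStar_continuous X))
    (B := gammaObj (zeroAtInftyObj X isSigmaUnital_zeroAtInfty)
      (SigmaUnitalCStarAlg.isLocallyCompactSigmaCStar _))
    (ofContinuous : C(X, ℂ) →⋆ₐ[ℂ] PedersenMultiplier C₀(X, ℂ))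
    isInducing_ofContinuous.continuous
    (fun m hm => by
      obtain ⟨f, rfl⟩ := bijective_ofContinuous.2 m
      exact Submodule.subset_span ⟨f, ofContinuous_mem_support_iff.1 hm, 1, (mul_one _).symm⟩)
  hom_inv_id := LocallyCompactSigmaCStarAlg.Hom.ext (StarAlgHom.ext fun m =>
    (continuousEquiv X).apply_symm_apply m)
  inv_hom_id := LocallyCompactSigmaCStarAlg.Hom.ext (StarAlgHom.ext fun f =>
    (continuousEquiv X).symm_apply_apply f)

theorem left_apply_eq_continuousEquiv_symm (m : PedersenMultiplier C₀(X, ℂ))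
    (y : pedersenIdeal C₀(X, ℂ)) (x : X) :
    (m.left y : C₀(X, ℂ)) x = (continuousEquiv X).symm m x * (y : C₀(X, ℂ)) x := by
  obtain ⟨f, rfl⟩ := bijective_ofContinuous.2 m
  rw [← continuousEquiv_apply, StarAlgEquiv.symm_apply_apply]
  rfl

end ContinuousIso

end

theorem theorem3p2 :
    ∃ (hΓ : ∀ A : SigmaUnitalCStarAlg.{u},
        IsLocallyCompactSigmaCStar (PedersenMultiplier A.carrier)
          (PedersenMultiplier.support A.carrier))
      (F : SigmaUnitalCStarAlg.{u} ⥤ LocallyCompactSigmaCStarAlg.{u})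
      (hF : ∀ A : SigmaUnitalCStarAlg.{u}, F.obj A = gammaObj A (hΓ A)),
      -- `F.map φ : Γ(K(A)) → Γ(K(B))` extends `φ : A → M(B)`
      (∀ (A B : SigmaUnitalCStarAlg.{u}) (φ : A ⟶ B) (a : A.carrier)
        (y : pedersenIdeal B.carrier),
        let Fφ : gammaObj A (hΓ A) ⟶ gammaObj B (hΓ B) :=
          eqToHom (hF A).symm ≫ F.map φ ≫ eqToHom (hF B)
        let m : PedersenMultiplier B.carrier :=
          Fφ.toHom (PedersenMultiplier.ofElem A.carrier a)
        (m.left y : B.carrier) = (φ.toHom a).fst y ∧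
          (m.right y : B.carrier) = (φ.toHom a).snd y) ∧
      -- `F` sends `C₀(X)` to `C(X)`
      (∀ (X : Type u) [TopologicalSpace X] [T2Space X] [LocallyCompactSpace X]
        [SigmaCompactSpace X],
        ∃ (h₀ : IsSigmaUnital C₀(X, ℂ))
          (h : IsLocallyCompactSigmaCStar C(X, ℂ) {f | HasCompactSupport f})
          (i : gammaObj (zeroAtInftyObj X h₀) (hΓ _) ≅ continuousObj X h),
          ∀ (m : PedersenMultiplier C₀(X, ℂ)) (y : pedersenIdeal C₀(X, ℂ)) (x : X),
            let f : C(X, ℂ) := i.hom.toHom m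
            (m.left y : C₀(X, ℂ)) x = f x * (y : C₀(X, ℂ)) x) := by
  refine ⟨fun A => A.isLocallyCompactSigmaCStar, gammaFunctor, fun _ => rfl, fun A B φ a y => ?_,
    fun X _ _ _ _ => ⟨isSigmaUnital_zeroAtInfty, isLocallyCompactSigmaCStar_continuous X,
      continuousIso X, fun m y x => left_apply_eq_continuousEquiv_symm X m y x⟩⟩
  have h := gammaMap_ofElem φ.strict A.localUnits B.localUnits a
  exact ⟨congrArg (fun m => (PedersenMultiplier.left m y : B.carrier)) h,
    congrArg (fun m => (PedersenMultiplier.right m y : B.carrier)) h⟩
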